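/- All graphs are finite, directed and without parallel edges. A *flow graph* $G$ is a graph with a distinguished source $s(G)$ that reaches every vertex; $n$ and $m$ denote its numbers of vertices and edges. $G$ is *reducible* if every cycle $C$ of $G$ contains a vertex $v$ that separates $s(G)$ from all vertices of $C\setminus\{v\}$. *Statement graphs.* The trivial graph has one vertex and no edge. The non-trivial statement graphs, with source $s$ and sink $t$ (all named vertices distinct), have the edge sets - sequence: $\{st\}$; - if: $\{sa, at, st\}$; - if-then-else ($p=2$) and $p$-case ($p\ge 3$): $\{sa_1,\dots,sa_p,a_1t,\dots,a_pt\}$; - while: $\{sa, as, st\}$, with cycle edge $as$; - repeat: $\{sa, as, at\}$, with cycle edge $as$. *Dijkstra graphs.* The trivial graph, with its vertex labeled $X$, is a Dijkstra graph. If $G'$ is a Dijkstra graph and $v$ is an $X$-labeled vertex of $G'$, then replacing $v$ by a disjoint non-trivial statement graph $H$, so that the in-edges of $v$ become in-edges of $s(H)$ and the out-edges of $v$ become out-edges of $t(H)$, gives a Dijkstra graph; in it $s(H)$ is labeled $R$, the other vertices of $H$ are labeled $X$, and its source is $s(H)$ if $v$ was the source of $G'$ and the source of $G'$ otherwise. An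 unlabeled flow graph is a Dijkstra graph if, as a digraph with distinguished source, it is isomorphic to one obtained in this way. *Cycle edges.* In a depth-first search (DFS) of $G$ from $s(G)$, an edge $vw$ is a cycle edge if $w$ is on the stack at the moment when $v$ is inserted (with $w=v$ allowed). *Primes and contraction.* Let $G$ be a digraph with a marked set $E_C$ of edges. A *prime subgraph* of $G$ with source $s$ and sink $t$ is an induced subgraph $H$ that is a non-trivial statement graph with source $s$ and sink $t$ whose cycle edges are exactly the edges of $H$ in $E_C$, such that only $s$ may have in-neighbors outside $H$, only $t$ may have out-neighbors outside $H$, and $xs\in E_C$ implies that $x$ is an out-neighbor of $s$. The contraction $G\downarrow H$ identifies the vertices of $H$ with $s$, and removes the parallel edges and the loops created by this; edges keep their marks. *Algorithm* (input: a flow graph $G$ without labels). 1. If $m\ge 2n-1$, return NO. 2. Let $E_C$ be the set of cycle edges of a DFS of $G$ from $s(G)$, and let $v_1,\dots,v_n$ be a topological sorting of $G-E_C$. 3. For $i=n,n-1,\dots,1$: if $G$ has a single vertex, return YES; otherwise, if $v_i$ is the source of a prime subgraph $H$ of the current $G$, put $G:=G\downarrow H$. 4. Return YES if $G$ has a single vertex,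 and NO otherwise. **Statement.** (a) For every flow graph $G$ (reducible or not), a DFS from $s(G)$ exists, $G-E_C$ has a topological sorting for every such DFS, and for every DFS and every topological sorting the loop runs to an answer. Whatever DFS and topological sorting are chosen, the algorithm returns YES if and only if $G$ is a Dijkstra graph. In particular, if $G$ is not reducible, it returns NO. (b) The algorithm runs in $O(n)$ time: there are a program for a unit-cost random access machine (registers and arrays of natural numbers; the operations are loading a constant, copying, adding or subtracting one, reading and writing an array cell, and comparing two registers) and a constant $c$ such that, for every flow graph $G$ with vertices $0,\dots,n-1$, given by $n$, $s(G)$ and adjacency lists, the program halts after at most $cn$ steps with the outcome of a run of the algorithm on $G$, namely the answer, the topological sorting that was used, and the list of the sources of the contracted primes in the order of their contraction (both lists are empty if step 1 answers). -/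

import Mathlib

/-! ### Flow graphs -/

/-- A finite directed graph without parallel edges, with vertices taken from `V`. -/
structure FinDigraph (V : Type*) where
  verts : Finset V
  edges : Finset (V × V)
  fst_mem : ∀ {x y : V}, (x, y) ∈ edges → x ∈ verts
  snd_mem : ∀ {x y : V}, (x, y) ∈ edges → y ∈ verts

/-- A flow graph: a finite digraph with a distinguished source that reaches every vertex. -/
structure FlowGraph (V : Type*) extends FinDigraph V where
  source : V
  source_mem : source ∈ verts
  reach : ∀ v ∈ verts, Relation.ReflTransGen (fun x y => (x, y) ∈ edges) source v

/-- A directed cycle, given by the list of its (distinct) vertices in cyclic order. -/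
def FinDigraph.IsCycle {V : Type*} (G : FinDigraph V) (l : List V) : Prop :=
  l.Nodup ∧ l.IsChain (fun x y => (x, y) ∈ G.edges) ∧
    ∃ h : l ≠ [], (l.getLast h, l.head h) ∈ G.edges

/-- `v` separates `s` from `w`: no path from `s` to `w` avoids `v` (used for `w ≠ v`). -/
def FinDigraph.Separates {V : Type*} (G : FinDigraph V) (v s w : V) : Prop :=
  ¬ (s ≠ v ∧ Relation.ReflTransGen (fun x y => (x, y) ∈ G.edges ∧ x ≠ v ∧ y ≠ v) s w)

/-- A flow graph is reducible if every cycle is single-entry: some vertex of the cycle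
separates the source from all the other vertices of the cycle. -/
def FlowGraph.Reducible {V : Type*} (G : FlowGraph V) : Prop :=
  ∀ l : List V, G.IsCycle l →
    ∃ v ∈ l, ∀ w ∈ l, w ≠ v → G.Separates v G.source w

/-! ### Statement graphs -/

/-- `IsStatement H s t B`: `H` is a non-trivial statement graph with source `s` and sink `t`, and
`B` is the set of its cycle edges (with respect to the source `s`). The vertex names are arbitrary,
so this is closed under isomorphism. -/
inductive IsStatement {V : Type*} [DecidableEq V] (H : FinDigraph V) (s t : V) :
    Finset (V × V) → Prop
  /-- sequence graph -/
  | sequence : s ≠ t → H.verts = {s, t} → H.edges = {(s, t)} → IsStatement H s t ∅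
  /-- if graph -/
  | ifThen (a : V) : s ≠ a → a ≠ t → s ≠ t → H.verts = {s, a, t} →
      H.edges = {(s, a), (a, t), (s, t)} → IsStatement H s t ∅
  /-- if-then-else graph (two branches) and `p`-case graph (`p ≥ 3` branches) -/
  | branch (A : Finset V) : 2 ≤ A.card → s ∉ A → t ∉ A → s ≠ t →
      H.verts = insert s (insert t A) →
      H.edges = A.image (fun a => (s, a)) ∪ A.image (fun a => (a, t)) → IsStatement H s t ∅
  /-- while graph -/
  | whileLoop (a : V) : s ≠ a → a ≠ t → s ≠ t → H.verts = {s, a, t} →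
      H.edges = {(s, a), (a, s), (s, t)} → IsStatement H s t {(a, s)}
  /-- repeat graph -/
  | repeatLoop (a : V) : s ≠ a → a ≠ t → s ≠ t → H.verts = {s, a, t} →
      H.edges = {(s, a), (a, s), (a, t)} → IsStatement H s t {(a, s)}

/-! ### Dijkstra graphs -/

/-- A digraph with a distinguished source, whose vertices are labeled `X` (expansible, the members
of `expansible`) or `R` (regular, all the other vertices). -/
structure LabeledGraph extends FinDigraph ℕ where
  source : ℕ
  expansible : Finset ℕ

/-- `G'` is obtained from `G` by expanding the vertex `v` into the graph `H` with source `s` and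
sink `t`: `v` is replaced by `H`, the in-edges of `v` now enter `s` and the out-edges of `v` now
leave `t`. In `H` the source is labeled `R` and all the other vertices are labeled `X`. -/
structure IsExpansion (G : LabeledGraph) (v : ℕ) (H : FinDigraph ℕ) (s t : ℕ)
    (G' : LabeledGraph) : Prop where
  disjoint : Disjoint G.verts H.verts
  verts_eq : G'.verts = G.verts.erase v ∪ H.verts
  edges_iff : ∀ x y : ℕ, (x, y) ∈ G'.edges ↔
    ((x, y) ∈ G.edges ∧ x ≠ v ∧ y ≠ v) ∨ (x, y) ∈ H.edges ∨
    ((x, v) ∈ G.edges ∧ x ≠ v ∧ y = s) ∨ (x = t ∧ (v, y) ∈ G.edges ∧ y ≠ v)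
  source_eq : G'.source = if G.source = v then s else G.source
  expansible_eq : G'.expansible = G.expansible.erase v ∪ H.verts.erase s

/-- Labeled Dijkstra graphs: the trivial graph with its vertex labeled `X`, and every graph
obtained from a Dijkstra graph by expanding an `X`-vertex into a non-trivial statement graph. -/
inductive IsLabeledDijkstra : LabeledGraph → Prop
  | trivial (G : LabeledGraph) (v : ℕ) : G.verts = {v} → G.edges = ∅ → G.source = v →
      G.expansible = {v} → IsLabeledDijkstra G
  | expand (G G' : LabeledGraph) (v : ℕ) (H : FinDigraph ℕ) (s t : ℕ) (B : Finset (ℕ × ℕ)) :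
      IsLabeledDijkstra G → v ∈ G.expansible → IsStatement H s t B →
      IsExpansion G v H s t G' → IsLabeledDijkstra G'

/-- An unlabeled flow graph is a Dijkstra graph if it is isomorphic, by an isomorphism that respects
the source, to a labeled Dijkstra graph whose labels are forgotten. -/
def FlowGraph.IsDijkstra {V : Type*} (G : FlowGraph V) : Prop :=
  ∃ L : LabeledGraph, IsLabeledDijkstra L ∧ ∃ f : V → ℕ,
    Set.BijOn f G.verts L.verts ∧ f G.source = L.source ∧
    ∀ x ∈ G.verts, ∀ y ∈ G.verts, ((x, y) ∈ G.edges ↔ (f x, f y) ∈ L.edges)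

/-! ### Depth-first search and topological sorting -/

/-- A state of a depth-first search: the stack (top first), the set of vertices inserted so far,
and the set of cycle edges found so far. -/
structure DFSState (V : Type*) where
  stack : List V
  visited : Finset V
  cycleEdges : Finset (V × V)

/-- One step of a depth-first search: insert an unvisited out-neighbor `w` of the top vertex
(the edges from `w` to vertices that are on the stack at that moment are cycle edges), or remove
the top vertex once all its out-neighbors are visited. -/
inductive DFSStep {V : Type*} [DecidableEq V] (G : FinDigraph V) : DFSState V → DFSState V → Prop
  | insert (u w : V) (st : List V) (vis : Finset V) (C : Finset (V × V)) :
      (u, w) ∈ G.edges → w ∉ vis →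
      DFSStep G ⟨u :: st, vis, C⟩
        ⟨w :: u :: st, insert w vis,
          C ∪ G.edges.filter (fun e => e.1 = w ∧ e.2 ∈ w :: u :: st)⟩
  | remove (u : V) (st : List V) (vis : Finset V) (C : Finset (V × V)) :
      (∀ w, (u, w) ∈ G.edges → w ∈ vis) →
      DFSStep G ⟨u :: st, vis, C⟩ ⟨st, vis, C⟩

/-- `C` is the set of cycle edges of some complete depth-first search of `G` from its source. -/
def FlowGraph.IsDFSCycleEdges {V : Type*} [DecidableEq V] (G : FlowGraph V)
    (C : Finset (V × V)) : Prop :=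
  ∃ vis : Finset V, Relation.ReflTransGen (DFSStep G.toFinDigraph)
    ⟨[G.source], {G.source}, G.edges.filter (fun e => e = (G.source, G.source))⟩ ⟨[], vis, C⟩

/-- `ord` is a topological sorting of `G - C`. -/
def FinDigraph.IsTopSort {V : Type*} [DecidableEq V] (G : FinDigraph V) (C : Finset (V × V))
    (ord : List V) : Prop :=
  ord.Nodup ∧ ord.toFinset = G.verts ∧
    ∀ (i j : ℕ) (hi : i < ord.length) (hj : j < ord.length),
      (ord[i], ord[j]) ∈ G.edges → (ord[i], ord[j]) ∉ C → i < j

/-! ### Prime subgraphs, contraction, and the recognition algorithm -/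

/-- A digraph some of whose edges are marked as cycle edges. -/
structure MarkedGraph (V : Type*) extends FinDigraph V where
  cycleEdges : Finset (V × V)

/-- `H` is an induced subgraph of `G`. -/
def FinDigraph.IsInducedIn {V : Type*} (H G : FinDigraph V) : Prop :=
  H.verts ⊆ G.verts ∧
    ∀ x y : V, (x, y) ∈ H.edges ↔ (x, y) ∈ G.edges ∧ x ∈ H.verts ∧ y ∈ H.verts

/-- The subgraph `H` of `G`, with source `s` and sink `t`, is closed. -/
def MarkedGraph.IsClosed {V : Type*} (G : MarkedGraph V) (H : FinDigraph V) (s t : V) : Prop :=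
  (∀ x y, y ∈ H.verts → y ≠ s → (x, y) ∈ G.edges → x ∈ H.verts) ∧
  (∀ x y, x ∈ H.verts → x ≠ t → (x, y) ∈ G.edges → y ∈ H.verts) ∧
  (∀ x, (x, s) ∈ G.cycleEdges → (s, x) ∈ G.edges)

/-- `H` is a prime subgraph of `G` with source `s` and sink `t`: a closed induced subgraph that is
a non-trivial statement graph, the cycle edges of the statement graph being exactly the edges of
`H` that are cycle edges of `G` (this is what tells the source of a loop). -/
def MarkedGraph.IsPrime {V : Type*} [DecidableEq V] (G : MarkedGraph V) (H : FinDigraph V)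
    (s t : V) : Prop :=
  H.IsInducedIn G.toFinDigraph ∧ IsStatement H s t (H.edges ∩ G.cycleEdges) ∧ G.IsClosed H s t

/-- The map that identifies all the vertices of `S` with `s`. -/
def collapse {V : Type*} [DecidableEq V] (S : Finset V) (s x : V) : V := if x ∈ S then s else x

/-- The images of the edges after identifying the vertices of `S` with `s`; parallel edges are
merged and the loops that the identification creates are removed. -/
def collapseEdges {V : Type*} [DecidableEq V] (S : Finset V) (s : V) (E : Finset (V × V)) :
    Finset (V × V) :=
  (E.filter (fun e => ¬ (e.1 ∈ S ∧ e.2 ∈ S))).image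
    (fun e => (collapse S s e.1, collapse S s e.2))

/-- Contraction of the subgraph `H` into its source `s`; cycle edges keep their marks. -/
def MarkedGraph.contract {V : Type*} [DecidableEq V] (G : MarkedGraph V) (H : FinDigraph V)
    (s : V) : MarkedGraph V where
  verts := G.verts.image (collapse H.verts s)
  edges := collapseEdges H.verts s G.edges
  fst_mem := by
    intro x y h
    simp only [collapseEdges, Finset.mem_image, Finset.mem_filter] at h
    obtain ⟨⟨a, b⟩, ⟨hab, -⟩, he⟩ := h
    rw [← (Prod.mk.inj he).1]
    exact Finset.mem_image_of_mem _ (G.fst_mem hab)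
  snd_mem := by
    intro x y h
    simp only [collapseEdges, Finset.mem_image, Finset.mem_filter] at h
    obtain ⟨⟨a, b⟩, ⟨hab, -⟩, he⟩ := h
    rw [← (Prod.mk.inj he).2]
    exact Finset.mem_image_of_mem _ (G.snd_mem hab)
  cycleEdges := collapseEdges H.verts s G.cycleEdges

/-- The main loop. `GreedyRun vs G tr b`: started on the graph `G` with the list `vs` of vertices
still to be treated, the loop answers `b`, and `tr` lists the sources of the prime subgraphs that
it contracts, in the order of the contractions. -/
inductive GreedyRun {V : Type*} [DecidableEq V] :
    List V → MarkedGraph V → List V → Bool → Prop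
  | yes (vs : List V) (G : MarkedGraph V) : G.verts.card = 1 → GreedyRun vs G [] true
  | no (G : MarkedGraph V) : G.verts.card ≠ 1 → GreedyRun [] G [] false
  | contract (v t : V) (vs : List V) (G : MarkedGraph V) (H : FinDigraph V) (tr : List V)
      (b : Bool) : G.verts.card ≠ 1 → G.IsPrime H v t → GreedyRun vs (G.contract H v) tr b →
      GreedyRun (v :: vs) G (v :: tr) b
  | skip (v : V) (vs : List V) (G : MarkedGraph V) (tr : List V) (b : Bool) :
      G.verts.card ≠ 1 → (¬ ∃ H t, G.IsPrime H v t) → GreedyRun vs G tr b →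
      GreedyRun (v :: vs) G tr b

/-- The recognition algorithm. `RecognitionRun G ord tr b`: on input `G` some run of the algorithm
answers `b` (`true` is YES); `ord` is the topological sorting it uses, treated from the last vertex
to the first, and `tr` lists the sources of the contracted primes. Both are empty if the algorithm
stops at once because there are too many edges. -/
inductive RecognitionRun {V : Type*} [DecidableEq V] (G : FlowGraph V) :
    List V → List V → Bool → Prop
  | tooManyEdges : 2 * G.verts.card ≤ G.edges.card + 1 → RecognitionRun G [] [] false
  | greedy (C : Finset (V × V)) (ord tr : List V) (b : Bool) :
      ¬ 2 * G.verts.card ≤ G.edges.card + 1 →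
      G.IsDFSCycleEdges C → G.IsTopSort C ord →
      GreedyRun ord.reverse ⟨G.toFinDigraph, C⟩ tr b → RecognitionRun G ord tr b

/-! ### A random access machine with unit costs -/

/-- The memory: registers and arrays, all holding natural numbers. -/
structure Store where
  reg : ℕ → ℕ
  arr : ℕ → ℕ → ℕ

/-- Programs. The only arithmetic is adding or subtracting one. -/
inductive Prog where
  /-- `x := k` -/
  | const (x k : ℕ)
  /-- `x := y` -/
  | copy (x y : ℕ)
  /-- `x := x + 1` -/
  | incr (x : ℕ)
  /-- `x := x - 1` (truncated) -/
  | decr (x : ℕ)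
  /-- `x := a[y]` -/
  | load (x a y : ℕ)
  /-- `a[y] := x` -/
  | store (a y x : ℕ)
  /-- first `p`, then `q` -/
  | seq (p q : Prog)
  /-- if `x < y` then `p` else `q` -/
  | ifLt (x y : ℕ) (p q : Prog)
  /-- while `x < y` do `p` -/
  | whileLt (x y : ℕ) (p : Prog)

def Store.setReg (σ : Store) (x k : ℕ) : Store :=
  ⟨Function.update σ.reg x k, σ.arr⟩

def Store.setArr (σ : Store) (a i k : ℕ) : Store :=
  ⟨σ.reg, Function.update σ.arr a (Function.update (σ.arr a) i k)⟩

/-- `Exec p σ t σ'`: started in `σ`, the program `p` halts in `σ'` after exactly `t` steps. Every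
elementary instruction and every evaluation of a test is one step. -/
inductive Exec : Prog → Store → ℕ → Store → Prop
  | const (x k : ℕ) (σ : Store) : Exec (.const x k) σ 1 (σ.setReg x k)
  | copy (x y : ℕ) (σ : Store) : Exec (.copy x y) σ 1 (σ.setReg x (σ.reg y))
  | incr (x : ℕ) (σ : Store) : Exec (.incr x) σ 1 (σ.setReg x (σ.reg x + 1))
  | decr (x : ℕ) (σ : Store) : Exec (.decr x) σ 1 (σ.setReg x (σ.reg x - 1))
  | load (x a y : ℕ) (σ : Store) : Exec (.load x a y) σ 1 (σ.setReg x (σ.arr a (σ.reg y)))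
  | store (a y x : ℕ) (σ : Store) :
      Exec (.store a y x) σ 1 (σ.setArr a (σ.reg y) (σ.reg x))
  | seq (p q : Prog) (σ σ₁ σ₂ : Store) (t₁ t₂ : ℕ) :
      Exec p σ t₁ σ₁ → Exec q σ₁ t₂ σ₂ → Exec (.seq p q) σ (t₁ + t₂) σ₂
  | ifLt_true (x y : ℕ) (p q : Prog) (σ σ' : Store) (t : ℕ) :
      σ.reg x < σ.reg y → Exec p σ t σ' → Exec (.ifLt x y p q) σ (t + 1) σ'
  | ifLt_false (x y : ℕ) (p q : Prog) (σ σ' : Store) (t : ℕ) :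
      ¬ σ.reg x < σ.reg y → Exec q σ t σ' → Exec (.ifLt x y p q) σ (t + 1) σ'
  | whileLt_true (x y : ℕ) (p : Prog) (σ σ₁ σ₂ : Store) (t₁ t₂ : ℕ) :
      σ.reg x < σ.reg y → Exec p σ t₁ σ₁ → Exec (.whileLt x y p) σ₁ t₂ σ₂ →
      Exec (.whileLt x y p) σ (t₁ + t₂ + 1) σ₂
  | whileLt_false (x y : ℕ) (p : Prog) (σ : Store) :
      ¬ σ.reg x < σ.reg y → Exec (.whileLt x y p) σ 1 σ

/-- The memory `σ` holds the flow graph `G` with vertices `0, …, n - 1` by adjacency lists: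
register 0 holds `n`, register 1 holds the source, and the out-neighbors of `u` are listed, in any
order and without repetition, in the cells of array 2 from index `σ.arr 0 u` (included) to index
`σ.arr 1 u` (excluded). All the other registers and arrays are zero. -/
structure EncodesGraph (G : FlowGraph ℕ) (n : ℕ) (σ : Store) : Prop where
  verts_eq : G.verts = Finset.range n
  reg_zero : σ.reg 0 = n
  reg_one : σ.reg 1 = G.source
  adj_iff : ∀ u < n, ∀ w, (u, w) ∈ G.edges ↔
    ∃ i, σ.arr 0 u ≤ i ∧ i < σ.arr 1 u ∧ σ.arr 2 i = w
  adj_inj : ∀ u < n, ∀ i j, σ.arr 0 u ≤ i → i < σ.arr 1 u → σ.arr 0 u ≤ j → j < σ.arr 1 u →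
    σ.arr 2 i = σ.arr 2 j → i = j
  reg_rest : ∀ x, 2 ≤ x → σ.reg x = 0
  arr_rest : ∀ a, 3 ≤ a → ∀ i, σ.arr a i = 0

/-- Array `a` of the memory `σ` starts with the list `l`. -/
def Store.ArrayHolds (σ : Store) (a : ℕ) (l : List ℕ) : Prop :=
  ∀ (i : ℕ) (hi : i < l.length), σ.arr a i = l[i]

/-! ### Statement graphs -/

section StatementGraphs

variable {V W : Type*} [DecidableEq V] [DecidableEq W]

/-! A Dijkstra graph is a graph that shrinks to a single vertex when primes with pairwise distinct
sources are contracted: the contractions undo the expansions in reverse order, and the labels say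
that a vertex serves as a source at most once, since an `R`-vertex is never expanded again. This is
`Reduces`, used together with `Ordered`: the unmarked edges increase a position function, the source
reaches everything by them, and the head of a marked edge reaches its tail by them.
`IsLabeledDijkstra.exists_reduces` and `Reduces.exists_labeled` translate between the two notions.

The marking is forced. If the graph can be contracted to a vertex, each marked edge enters a vertex
that separates the source from its tail (`Reduces.separates`). Every depth-first search marks such
edges, because its stack is a path from the source, and acyclicity of the unmarked edges leaves no
room for further ones (`FlowGraph.CycleEdgeProps.eq_of_reduces`). So the marks of any search are
those of the Dijkstra structure. Moreover each cycle contains a marked edge, whose head separates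
the source from the rest of the cycle; hence Dijkstra graphs are reducible.

The order of the contractions hardly matters. Two primes with the same source have the same vertices
(`IsPrime.verts_eq`); two primes with different sources meet at most in one vertex, the sink of the
earlier and source of the later one (`IsPrime.inter_of_pos_lt`). Hence contracting one keeps the
other prime (`IsPrime.contract_prime`), every prime has its source in any given contraction sequence
(`Reduces.source_mem`), and the last of these sources can be contracted first
(`Reduces.contract_last`). So the loop, which treats the vertices from last to first, follows a
contraction sequence whenever there is one (`Reduces.greedy`). Summing the edges of the contracted
primes gives `m ≤ 2n - 2`, which justifies step 1.

For the running time, the search gives up once it meets `2n - 1` edges. Afterwards a prime with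
source `v` is recognized from the adjacency lists of `v` and its out-neighbors, the indegrees and
the numbers of entering cycle edges (`PrimeShape`). Contraction merges no edges and moves no heads,
so it changes only four array cells (`Represents.contract`): `v` takes over the list of the sink and
loses its entering cycle edges. When a vertex is treated, its list is still the original one, so all
tests together cost `O(n + m) = O(n)`. -/

@[ext] theorem FinDigraph.ext' {H K : FinDigraph V} (hv : H.verts = K.verts)
    (he : H.edges = K.edges) : H = K := by
  cases H; cases K; simp_all

/-- The image of a digraph under a renaming of its vertices. -/
def FinDigraph.map (H : FinDigraph V) (f : V → W) : FinDigraph W where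
  verts := H.verts.image f
  edges := H.edges.image (Prod.map f f)
  fst_mem := by
    intro x y h
    simp only [Finset.mem_image, Prod.exists, Prod.map_apply, Prod.mk.injEq] at h
    obtain ⟨a, b, hab, rfl, rfl⟩ := h
    exact Finset.mem_image_of_mem _ (H.fst_mem hab)
  snd_mem := by
    intro x y h
    simp only [Finset.mem_image, Prod.exists, Prod.map_apply, Prod.mk.injEq] at h
    obtain ⟨a, b, hab, rfl, rfl⟩ := h
    exact Finset.mem_image_of_mem _ (H.snd_mem hab)

theorem FinDigraph.mem_map_edges {H : FinDigraph V} {f : V → W} {x y : W} :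
    (x, y) ∈ (H.map f).edges ↔ ∃ a b, (a, b) ∈ H.edges ∧ f a = x ∧ f b = y := by
  simp [FinDigraph.map]

theorem FinDigraph.mem_map_verts {H : FinDigraph V} {f : V → W} {x : W} :
    x ∈ (H.map f).verts ↔ ∃ a, a ∈ H.verts ∧ f a = x := by
  simp [FinDigraph.map]

theorem FinDigraph.map_eq_self {H : FinDigraph V} {f : V → V} (hf : ∀ x ∈ H.verts, f x = x) :
    H.map f = H := by
  apply FinDigraph.ext'
  · ext x
    rw [FinDigraph.mem_map_verts]
    constructor
    · rintro ⟨a, ha, rfl⟩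
      rwa [hf a ha]
    · exact fun h => ⟨x, h, hf x h⟩
  · ext ⟨x, y⟩
    rw [FinDigraph.mem_map_edges]
    constructor
    · rintro ⟨a, b, h, rfl, rfl⟩
      rwa [hf a (H.fst_mem h), hf b (H.snd_mem h)]
    · exact fun h => ⟨x, y, h, hf x (H.fst_mem h), hf y (H.snd_mem h)⟩

namespace IsStatement

variable {H : FinDigraph V} {s t : V} {B : Finset (V × V)}

theorem source_ne_sink (h : IsStatement H s t B) : s ≠ t := by
  cases h <;> assumption

theorem source_mem (h : IsStatement H s t B) : s ∈ H.verts := by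
  cases h <;> simp_all

theorem sink_mem (h : IsStatement H s t B) : t ∈ H.verts := by
  cases h <;> simp_all

theorem marked_subset (h : IsStatement H s t B) : B ⊆ H.edges := by
  cases h <;> simp_all

/-- The uniform description of all shapes: an edge leaves the source, or goes unmarked from a middle
vertex to the sink, or goes marked from a middle vertex back to the source. Many later arguments use
only this; in particular no inner edge leaves the sink. -/
theorem edge_cases (h : IsStatement H s t B) {x y : V} (hxy : (x, y) ∈ H.edges) :
    (x = s ∧ y ∈ H.verts ∧ y ≠ s ∧ (x, y) ∉ B) ∨
    (x ∈ H.verts ∧ x ≠ s ∧ x ≠ t ∧ y = t ∧ (x, y) ∉ B) ∨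
    (x ∈ H.verts ∧ x ≠ s ∧ x ≠ t ∧ y = s ∧ (x, y) ∈ B) := by
  cases h with
  | sequence h1 h2 h3 => simp_all; tauto
  | ifThen a h1 h2 h3 h4 h5 =>
    rw [h5] at hxy
    simp only [Finset.mem_insert, Finset.mem_singleton, Prod.mk.injEq] at hxy
    rw [h4]
    rcases hxy with ⟨rfl, rfl⟩ | ⟨rfl, rfl⟩ | ⟨rfl, rfl⟩ <;> simp_all [Ne.symm]
  | branch A h1 h2 h3 h4 h5 h6 =>
    rw [h6] at hxy
    simp only [Finset.mem_union, Finset.mem_image, Prod.mk.injEq] at hxy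
    rw [h5]
    rcases hxy with ⟨a, ha, rfl, rfl⟩ | ⟨a, ha, rfl, rfl⟩
    · left
      simp [ha]
      rintro rfl; contradiction
    · right; left
      simp [ha]
      constructor <;> (rintro rfl; contradiction)
  | whileLoop a h1 h2 h3 h4 h5 =>
    rw [h5] at hxy
    simp only [Finset.mem_insert, Finset.mem_singleton, Prod.mk.injEq] at hxy
    rw [h4]
    rcases hxy with ⟨rfl, rfl⟩ | ⟨rfl, rfl⟩ | ⟨rfl, rfl⟩ <;> simp_all [Ne.symm]
  | repeatLoop a h1 h2 h3 h4 h5 =>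
    rw [h5] at hxy
    simp only [Finset.mem_insert, Finset.mem_singleton, Prod.mk.injEq] at hxy
    rw [h4]
    rcases hxy with ⟨rfl, rfl⟩ | ⟨rfl, rfl⟩ | ⟨rfl, rfl⟩ <;> simp_all [Ne.symm]

theorem source_edge (h : IsStatement H s t B) {m : V} (hm : m ∈ H.verts) (hs : m ≠ s)
    (ht : m ≠ t) : (s, m) ∈ H.edges := by
  cases h <;> simp_all

/-- This prevents a middle vertex from being the source of another prime: a closed set that it
starts would take in either the source or the sink together with the other in-neighbor of the sink.
See `IsPrime.inter_of_pos_lt`. -/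
theorem mid_out (h : IsStatement H s t B) {m : V} (hm : m ∈ H.verts) (hs : m ≠ s)
    (ht : m ≠ t) :
    (m, s) ∈ H.edges ∨ ((m, t) ∈ H.edges ∧ ∃ y, y ≠ m ∧ (y, t) ∈ H.edges) := by
  cases h with
  | sequence h1 h2 h3 => simp_all
  | ifThen a h1 h2 h3 h4 h5 =>
    have : m = a := by simp_all
    subst this
    right
    rw [h5]
    exact ⟨by simp, s, h1, by simp⟩
  | branch A h1 h2 h3 h4 h5 h6 =>
    have hmA : m ∈ A := by simp_all
    right
    obtain ⟨b, hb, hbm⟩ := Finset.exists_mem_ne (by omega : 1 < A.card) m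
    rw [h6]
    exact ⟨by simp [hmA], b, hbm, by simp [hb]⟩
  | whileLoop a h1 h2 h3 h4 h5 =>
    have : m = a := by simp_all
    subst this
    left; simp [h5]
  | repeatLoop a h1 h2 h3 h4 h5 =>
    have : m = a := by simp_all
    subst this
    left; simp [h5]

/-- The alternatives are a direct edge (sequence, if, while), a repeat graph, and two distinct
branches. Each of them forces the sink into every other prime with the same source; see
`IsPrime.verts_subset`. -/
theorem sink_in (h : IsStatement H s t B) :
    (s, t) ∈ H.edges ∨
    (∃ m, m ∈ H.verts ∧ m ≠ s ∧ m ≠ t ∧ (m, t) ∈ H.edges ∧ (m, s) ∈ H.edges) ∨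
    (∃ m m', m ≠ m' ∧ (m ∈ H.verts ∧ m ≠ s ∧ m ≠ t ∧ (m, t) ∈ H.edges ∧ (m, s) ∉ H.edges) ∧
      (m' ∈ H.verts ∧ m' ≠ s ∧ m' ≠ t ∧ (m', t) ∈ H.edges ∧ (m', s) ∉ H.edges)) := by
  cases h with
  | sequence h1 h2 h3 => simp_all
  | ifThen a h1 h2 h3 h4 h5 => simp_all
  | branch A h1 h2 h3 h4 h5 h6 =>
    right; right
    obtain ⟨a, ha, b, hb, hab⟩ := Finset.one_lt_card.1 (by omega : 1 < A.card)
    have key : ∀ m ∈ A, m ∈ H.verts ∧ m ≠ s ∧ m ≠ t ∧ (m, t) ∈ H.edges ∧ (m, s) ∉ H.edges := by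
      intro m hm
      refine ⟨by simp [h5, hm], by rintro rfl; contradiction, by rintro rfl; contradiction,
        by simp [h6, hm], ?_⟩
      rw [h6]
      simp only [Finset.mem_union, Finset.mem_image, Prod.mk.injEq, not_or]
      constructor
      · rintro ⟨c, hc, rfl, rfl⟩; contradiction
      · rintro ⟨c, hc, rfl, rfl⟩; contradiction
    exact ⟨a, b, hab, key a ha, key b hb⟩
  | whileLoop a h1 h2 h3 h4 h5 => simp_all
  | repeatLoop a h1 h2 h3 h4 h5 =>
    right; left
    exact ⟨a, by simp [h4], h1.symm, h2, by simp [h5], by simp [h5]⟩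

/-- The form `m ≤ 2n - 2` is stable under contraction: the graph and the prime together lose exactly
one vertex count, so the bounds for the prime and the contracted graph add up to the same bound for
the whole graph. -/
theorem card_edges_le (h : IsStatement H s t B) :
    H.edges.card + 2 ≤ 2 * H.verts.card := by
  have card3 : ∀ {a b c : V}, a ≠ b → b ≠ c → a ≠ c → ({a, b, c} : Finset V).card = 3 := by
    intro a b c h1 h2 h3
    rw [Finset.card_insert_of_notMem (by simp [h1, h3]), Finset.card_pair h2]
  cases h with
  | sequence h1 h2 h3 => rw [h2, h3, Finset.card_pair h1]; simp
  | ifThen a h1 h2 h3 h4 h5 =>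
    rw [h4, h5, card3 h1 h2 h3]
    have := Finset.card_le_three (a := (s, a)) (b := (a, t)) (c := (s, t))
    omega
  | branch A h1 h2 h3 h4 h5 h6 =>
    have e1 : (insert s (insert t A)).card = A.card + 2 := by
      rw [Finset.card_insert_of_notMem (by simp [h2, h4]), Finset.card_insert_of_notMem h3]
    rw [h5, h6, e1]
    have := Finset.card_union_le (A.image (fun a => (s, a))) (A.image (fun a => (a, t)))
    have := Finset.card_image_le (s := A) (f := fun a => (s, a))
    have := Finset.card_image_le (s := A) (f := fun a => (a, t))
    omega
  | whileLoop a h1 h2 h3 h4 h5 =>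
    rw [h4, h5, card3 h1 h2 h3]
    have := Finset.card_le_three (a := (s, a)) (b := (a, s)) (c := (s, t))
    omega
  | repeatLoop a h1 h2 h3 h4 h5 =>
    rw [h4, h5, card3 h1 h2 h3]
    have := Finset.card_le_three (a := (s, a)) (b := (a, s)) (c := (a, t))
    omega

theorem two_le_card (h : IsStatement H s t B) : 2 ≤ H.verts.card :=
  Finset.one_lt_card.2 ⟨s, h.source_mem, t, h.sink_mem, h.source_ne_sink⟩

theorem map (h : IsStatement H s t B) {f : V → W} (hf : Set.InjOn f H.verts) :
    IsStatement (H.map f) (f s) (f t) (B.image (Prod.map f f)) := by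
  have ne : ∀ {x y : V}, x ∈ H.verts → y ∈ H.verts → x ≠ y → f x ≠ f y :=
    fun hx hy hxy he => hxy (hf hx hy he)
  have hs := h.source_mem
  have ht := h.sink_mem
  have hst := ne hs ht h.source_ne_sink
  cases h with
  | sequence h1 h2 h3 =>
    exact .sequence hst (by simp [FinDigraph.map, h2]) (by simp [FinDigraph.map, h3])
  | ifThen a h1 h2 h3 h4 h5 =>
    have ha : a ∈ H.verts := by simp [h4]
    exact .ifThen (f a) (ne hs ha h1) (ne ha ht h2) hst (by simp [FinDigraph.map, h4])
      (by simp [FinDigraph.map, h5])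
  | branch A h1 h2 h3 h4 h5 h6 =>
    have hA : A ⊆ H.verts := by rw [h5]; intro x hx; simp [hx]
    refine .branch (A.image f) ?_ ?_ ?_ hst (by simp [FinDigraph.map, h5]) ?_
    · rw [Finset.card_image_of_injOn (hf.mono hA)]; exact h1
    · intro hm
      obtain ⟨x, hx, hxs⟩ := Finset.mem_image.1 hm
      exact h2 (hf (hA hx) hs hxs ▸ hx)
    · intro hm
      obtain ⟨x, hx, hxs⟩ := Finset.mem_image.1 hm
      exact h3 (hf (hA hx) ht hxs ▸ hx)
    · simp only [FinDigraph.map, h6, Finset.image_union, Finset.image_image]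
      rfl
  | whileLoop a h1 h2 h3 h4 h5 =>
    have ha : a ∈ H.verts := by simp [h4]
    exact .whileLoop (f a) (ne hs ha h1) (ne ha ht h2) hst (by simp [FinDigraph.map, h4])
      (by simp [FinDigraph.map, h5])
  | repeatLoop a h1 h2 h3 h4 h5 =>
    have ha : a ∈ H.verts := by simp [h4]
    exact .repeatLoop (f a) (ne hs ha h1) (ne ha ht h2) hst (by simp [FinDigraph.map, h4])
      (by simp [FinDigraph.map, h5])

end IsStatement

end StatementGraphs

/-! ### Primes and contraction -/

section Primes

variable {V : Type*} [DecidableEq V]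

theorem collapse_inside {S : Finset V} {s x : V} (h : x ∈ S) : collapse S s x = s := if_pos h

theorem collapse_outside {S : Finset V} {s x : V} (h : x ∉ S) : collapse S s x = x := if_neg h

theorem collapse_eq_source {S : Finset V} {s x : V} (hs : s ∈ S) :
    collapse S s x = s ↔ x ∈ S := by
  by_cases h : x ∈ S
  · simp [collapse_inside h, h]
  · simp only [collapse_outside h, h, iff_false]
    rintro rfl; exact h hs

theorem collapse_eq_of_notMem {S : Finset V} {s x y : V} (hs : s ∈ S) (hy : y ∉ S) :
    collapse S s x = y ↔ x = y := by
  by_cases h : x ∈ S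
  · rw [collapse_inside h]
    constructor
    · rintro rfl; exact absurd hs hy
    · rintro rfl; exact absurd h hy
  · rw [collapse_outside h]

theorem mem_collapseEdges {S : Finset V} {s x y : V} {E : Finset (V × V)} :
    (x, y) ∈ collapseEdges S s E ↔ ∃ p q, (p, q) ∈ E ∧ ¬ (p ∈ S ∧ q ∈ S) ∧
      collapse S s p = x ∧ collapse S s q = y := by
  simp [collapseEdges, and_assoc]

theorem collapse_mem_collapseEdges {S : Finset V} {s p q : V} {E : Finset (V × V)}
    (h : (p, q) ∈ E) (hn : ¬ (p ∈ S ∧ q ∈ S)) :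
    (collapse S s p, collapse S s q) ∈ collapseEdges S s E :=
  mem_collapseEdges.2 ⟨p, q, h, hn, rfl, rfl⟩

namespace MarkedGraph

/-- The edges that are not cycle edges. -/
def Fwd (G : MarkedGraph V) (x y : V) : Prop := (x, y) ∈ G.edges ∧ (x, y) ∉ G.cycleEdges

/-- The marked edges are cycle edges in the sense that they close cycles and that the other edges
respect the linear order `pos`; the source `s₀` reaches all vertices by unmarked edges. -/
structure Ordered (G : MarkedGraph V) (s₀ : V) (pos : V → ℕ) : Prop where
  sub : G.cycleEdges ⊆ G.edges
  src : s₀ ∈ G.verts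
  inc : ∀ {x y}, G.Fwd x y → pos x < pos y
  back : ∀ {x y}, (x, y) ∈ G.cycleEdges → Relation.ReflTransGen G.Fwd y x
  reach : ∀ v ∈ G.verts, Relation.ReflTransGen G.Fwd s₀ v

theorem Ordered.pos_le {G : MarkedGraph V} {s₀ : V} {pos : V → ℕ} (hG : G.Ordered s₀ pos) {x y : V}
    (h : Relation.ReflTransGen G.Fwd x y) : pos x ≤ pos y := by
  induction h with
  | refl => exact le_rfl
  | tail _ h ih => exact ih.trans (hG.inc h).le

theorem Ordered.marked_of_le {G : MarkedGraph V} {s₀ : V} {pos : V → ℕ} (hG : G.Ordered s₀ pos)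
    {x y : V} (h : (x, y) ∈ G.edges) (hle : pos y ≤ pos x) : (x, y) ∈ G.cycleEdges := by
  by_contra hc
  exact absurd (hG.inc ⟨h, hc⟩) (not_lt.2 hle)

namespace IsPrime

variable {G : MarkedGraph V} {H K : FinDigraph V} {a t v u s₀ : V} {pos : V → ℕ}

theorem statement (hp : G.IsPrime H a t) : IsStatement H a t (H.edges ∩ G.cycleEdges) := hp.2.1

theorem edge_mem (hp : G.IsPrime H a t) {p q : V} (h : (p, q) ∈ G.edges) (h1 : p ∈ H.verts)
    (h2 : q ∈ H.verts) : (p, q) ∈ H.edges := (hp.1.2 p q).2 ⟨h, h1, h2⟩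

theorem edge_of (hp : G.IsPrime H a t) {p q : V} (h : (p, q) ∈ H.edges) : (p, q) ∈ G.edges :=
  ((hp.1.2 p q).1 h).1

theorem in_closed (hp : G.IsPrime H a t) {p q : V} (h : (p, q) ∈ G.edges) (h1 : q ∈ H.verts)
    (h2 : q ≠ a) : p ∈ H.verts := hp.2.2.1 p q h1 h2 h

theorem out_closed (hp : G.IsPrime H a t) {p q : V} (h : (p, q) ∈ G.edges) (h1 : p ∈ H.verts)
    (h2 : p ≠ t) : q ∈ H.verts := hp.2.2.2.1 p q h1 h2 h

theorem cycle_source (hp : G.IsPrime H a t) {p : V} (h : (p, a) ∈ G.cycleEdges) :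
    (a, p) ∈ G.edges := hp.2.2.2.2 p h

theorem cycle_source_mem (hp : G.IsPrime H a t) {p : V} (h : (p, a) ∈ G.cycleEdges) :
    p ∈ H.verts :=
  hp.out_closed (hp.cycle_source h) hp.statement.source_mem hp.statement.source_ne_sink

theorem cross (hp : G.IsPrime H a t) {p q : V} (h : (p, q) ∈ G.edges)
    (hn : ¬ (p ∈ H.verts ∧ q ∈ H.verts)) :
    (p ∉ H.verts ∧ q ∉ H.verts) ∨ (p = t ∧ q ∉ H.verts) ∨ (p ∉ H.verts ∧ q = a) := by
  by_cases h1 : p ∈ H.verts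
  · have h2 : q ∉ H.verts := fun h2 => hn ⟨h1, h2⟩
    right; left
    exact ⟨by_contra fun h3 => h2 (hp.out_closed h h1 h3), h2⟩
  · by_cases h2 : q ∈ H.verts
    · right; right
      exact ⟨h1, by_contra fun h3 => h1 (hp.in_closed h h2 h3)⟩
    · exact .inl ⟨h1, h2⟩

/-- A prime is left only from its sink and entered only at its source, which keeps its name. So
contraction moves tails from the sink to the source and never moves a head. -/
theorem collapse_snd (hp : G.IsPrime H a t) {p q : V} (h : (p, q) ∈ G.edges)
    (hn : ¬ (p ∈ H.verts ∧ q ∈ H.verts)) : collapse H.verts a q = q := by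
  rcases hp.cross h hn with ⟨-, h2⟩ | ⟨-, h2⟩ | ⟨-, rfl⟩
  · exact collapse_outside h2
  · exact collapse_outside h2
  · exact collapse_inside hp.statement.source_mem

/-- All tails inside `H` of edges that leave `H` equal the sink, so no parallel edges arise: the
edges not inside `H` correspond bijectively to the edges after contraction. This lets marks,
indegrees and edge counts be carried over. -/
theorem collapse_inj (hp : G.IsPrime H a t) {p q p' q' : V} (h : (p, q) ∈ G.edges)
    (hn : ¬ (p ∈ H.verts ∧ q ∈ H.verts)) (h' : (p', q') ∈ G.edges)
    (hn' : ¬ (p' ∈ H.verts ∧ q' ∈ H.verts))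
    (e1 : collapse H.verts a p = collapse H.verts a p')
    (e2 : collapse H.verts a q = collapse H.verts a q') : p = p' ∧ q = q' := by
  have ha := hp.statement.source_mem
  rw [hp.collapse_snd h hn, hp.collapse_snd h' hn'] at e2
  refine ⟨?_, e2⟩
  by_cases h1 : p ∈ H.verts
  · have h1' : p' ∈ H.verts := by
      rw [collapse_inside h1] at e1
      exact (collapse_eq_source ha).1 e1.symm
    have e : ∀ {x y}, (x, y) ∈ G.edges → ¬ (x ∈ H.verts ∧ y ∈ H.verts) → x ∈ H.verts → x = t := by
      intro x y hxy hnn hx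
      rcases hp.cross hxy hnn with ⟨h2, -⟩ | ⟨h2, -⟩ | ⟨h2, -⟩
      · contradiction
      · exact h2
      · contradiction
    rw [e h hn h1, e h' hn' h1']
  · rw [collapse_outside h1] at e1
    exact ((collapse_eq_of_notMem ha h1).1 e1.symm).symm

theorem fwd_of_edge (hp : G.IsPrime H a t) {x y : V} (h : (x, y) ∈ H.edges) (hy : y ≠ a) :
    G.Fwd x y := by
  refine ⟨hp.edge_of h, fun hc => ?_⟩
  rcases hp.statement.edge_cases h with h' | h' | h'
  · exact h'.2.2.2 (Finset.mem_inter.2 ⟨h, hc⟩)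
  · exact h'.2.2.2.2 (Finset.mem_inter.2 ⟨h, hc⟩)
  · exact hy h'.2.2.2.1

theorem fwd_mid (hp : G.IsPrime H a t) {m : V} (hm : m ∈ H.verts) (hs : m ≠ a)
    (ht : m ≠ t) : G.Fwd a m := hp.fwd_of_edge (hp.statement.source_edge hm hs ht) hs

theorem reach_mem (hp : G.IsPrime H a t) {x : V} (hx : x ∈ H.verts) :
    Relation.ReflTransGen G.Fwd a x := by
  by_cases h1 : x = a
  · rw [h1]
  by_cases h2 : x = t
  · subst h2
    have hmid : ∀ m, m ∈ H.verts → m ≠ a → m ≠ x → (m, x) ∈ H.edges →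
        Relation.ReflTransGen G.Fwd a x := fun m hm hma hmx h =>
      (Relation.ReflTransGen.single (hp.fwd_mid hm hma hmx)).tail (hp.fwd_of_edge h h1)
    rcases hp.statement.sink_in with h | ⟨m, hm, hma, hmt, h, -⟩ | ⟨m, -, -, ⟨hm, hma, hmt, h, -⟩, -⟩
    · exact .single (hp.fwd_of_edge h h1)
    · exact hmid m hm hma hmt h
    · exact hmid m hm hma hmt h
  · exact .single (hp.fwd_mid hx h1 h2)

theorem pos_lt (hp : G.IsPrime H a t) (hG : G.Ordered s₀ pos) {x : V} (hx : x ∈ H.verts)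
    (h : x ≠ a) : pos a < pos x := by
  obtain h' | ⟨y, h1, h2⟩ := (hp.reach_mem hx).cases_head
  · exact absurd h'.symm h
  · exact (hG.inc h1).trans_le (hG.pos_le h2)

theorem pos_le (hp : G.IsPrime H a t) (hG : G.Ordered s₀ pos) {x : V} (hx : x ∈ H.verts) :
    pos a ≤ pos x := hG.pos_le (hp.reach_mem hx)

theorem source_eq_of_mem (hp : G.IsPrime H a t) (hG : G.Ordered s₀ pos) (h : s₀ ∈ H.verts) :
    s₀ = a := by
  by_contra hne
  have := hp.pos_lt hG h hne
  have := hG.pos_le (hG.reach a (hp.1.1 hp.statement.source_mem))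
  omega

theorem no_sink_out (hp : G.IsPrime H a t) {y : V} (h : (t, y) ∈ G.edges) : y ∉ H.verts := by
  intro hy
  rcases hp.statement.edge_cases (hp.edge_mem h hp.statement.sink_mem hy) with h' | h' | h'
  · exact hp.statement.source_ne_sink h'.1.symm
  · exact h'.2.2.1 rfl
  · exact h'.2.2.1 rfl

/-- All of `K` lies at or after `v`, so `a` is not in `K`. A middle vertex of `H` in `K` other than
`v` would pull in its in-neighbor `a`; a sink of `H` in `K` other than `v` would pull in its
in-neighbors in `H`, all of which must then be `v`. Thus `v` is in `H`, and `mid_out` shows that it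
is not a middle vertex. -/
theorem inter_of_pos_lt (hp : G.IsPrime H a t) (hk : G.IsPrime K v u) (hG : G.Ordered s₀ pos)
    (hlt : pos a < pos v) {x : V} (hxH : x ∈ H.verts) (hxK : x ∈ K.verts) : x = v ∧ v = t := by
  have haK : a ∉ K.verts := fun h => by
    have := hk.pos_le hG h
    omega
  have hmidK : ∀ m, m ∈ H.verts → m ≠ t → m ∈ K.verts → m = v := by
    intro m hm hmt hmK
    by_contra hmv
    have hma : m ≠ a := by rintro rfl; exact haK hmK
    exact haK (hk.in_closed (hp.fwd_mid hm hma hmt).1 hmK hmv)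
  have hsink : t ∈ K.verts → t ≠ v → v ∈ H.verts ∧ ∀ y, (y, t) ∈ H.edges → y = v := by
    intro htK htv
    have : ∀ y, (y, t) ∈ H.edges → y = v := by
      intro y hy
      refine hmidK y (H.fst_mem hy) ?_ (hk.in_closed (hp.edge_of hy) htK htv)
      rintro rfl
      exact hp.no_sink_out (hp.edge_of hy) hp.statement.sink_mem
    refine ⟨?_, this⟩
    rcases hp.statement.sink_in with h | ⟨m, hm, -, -, h, -⟩ | ⟨m, -, -, ⟨hm, -, -, h, -⟩, -⟩
    · exact this _ h ▸ hp.statement.source_mem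
    · exact this _ h ▸ hm
    · exact this _ h ▸ hm
  have hvH : v ∈ H.verts := by
    by_cases hxt : x = t
    · subst hxt
      by_cases hxv : x = v
      · exact hxv ▸ hxH
      · exact (hsink hxK hxv).1
    · exact hmidK x hxH hxt hxK ▸ hxH
  have hvu := hk.statement.source_ne_sink
  have hvK := hk.statement.source_mem
  have hvt : v = t := by
    by_contra hvt
    have hva : v ≠ a := by rintro rfl; exact haK hvK
    rcases hp.statement.mid_out hvH hva hvt with h | ⟨h, y, hyv, hy⟩
    · exact haK (hk.out_closed (hp.edge_of h) hvK hvu)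
    · exact hyv ((hsink (hk.out_closed (hp.edge_of h) hvK hvu) (Ne.symm hvt)).2 y hy)
  refine ⟨?_, hvt⟩
  by_cases hxt : x = t
  · rw [hxt, hvt]
  · exact hmidK x hxH hxt hxK

/-- The middle vertices are out-neighbors of the common source, hence in `K`. The sink `t` follows
if some middle vertex before it is not the sink `u` of `K`. With an edge back to `v` this is clear,
as `u` has no edge into `K`. In a branching graph, if `u` were one branch, another branch would be a
middle vertex of `K` and have an edge to `v` or to `u`, which it lacks. -/
theorem verts_subset (hp : G.IsPrime H v t) (hk : G.IsPrime K v u) : H.verts ⊆ K.verts := by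
  have hvK := hk.statement.source_mem
  have hvu := hk.statement.source_ne_sink
  have hmid : ∀ m, m ∈ H.verts → m ≠ v → m ≠ t → m ∈ K.verts := fun m hm hs ht =>
    hk.out_closed (hp.fwd_mid hm hs ht).1 hvK hvu
  intro x hx
  by_cases hxv : x = v
  · exact hxv ▸ hvK
  by_cases hxt : x = t
  swap
  · exact hmid x hx hxv hxt
  subst hxt
  rcases hp.statement.sink_in with h | ⟨m, hm, hma, hmt, h, h'⟩ |
    ⟨m, m', hne, ⟨hm, hma, hmt, h, h0⟩, ⟨hm', hma', hmt', h', h0'⟩⟩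
  · exact hk.out_closed (hp.edge_of h) hvK hvu
  · have hmK := hmid m hm hma hmt
    refine hk.out_closed (hp.edge_of h) hmK ?_
    rintro rfl
    exact hk.no_sink_out (hp.edge_of h') hvK
  · have key : ∀ m m', m ≠ m' → m ∈ H.verts → m ≠ v → m ≠ x → m' ∈ H.verts → m' ≠ v → m' ≠ x →
        (m', v) ∉ H.edges → m ≠ u := by
      intro m m' hne hm hma hmt hm' hma' hmt' h0' e
      subst e
      rcases hk.statement.mid_out (hmid m' hm' hma' hmt') hma' hne.symm with h | ⟨h, -⟩
      · exact h0' (hp.edge_mem (hk.edge_of h) hm' hp.statement.source_mem)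
      · rcases hp.statement.edge_cases (hp.edge_mem (hk.edge_of h) hm' hm) with h | h | h
        · exact hma' h.1
        · exact hmt h.2.2.2.1
        · exact hma h.2.2.2.1
    exact hk.out_closed (hp.edge_of h) (hmid m hm hma hmt)
      (key m m' hne hm hma hmt hm' hma' hmt' h0')

theorem verts_eq (hp : G.IsPrime H v t) (hk : G.IsPrime K v u) : H.verts = K.verts :=
  (hp.verts_subset hk).antisymm (hk.verts_subset hp)

theorem contract_eq (hp : G.IsPrime H v t) (hk : G.IsPrime K v u) :
    G.contract H v = G.contract K v := by
  simp only [contract, hp.verts_eq hk]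

end IsPrime

end MarkedGraph

end Primes

/-! ### Contraction preserves the order and the other primes -/

section Contraction

variable {V : Type*} [DecidableEq V]

namespace MarkedGraph

open Relation

theorem ext' {G K : MarkedGraph V} (hv : G.verts = K.verts) (he : G.edges = K.edges)
    (hc : G.cycleEdges = K.cycleEdges) : G = K := by
  obtain ⟨⟨_, _, _, _⟩, _⟩ := G
  obtain ⟨⟨_, _, _, _⟩, _⟩ := K
  simp_all

namespace IsPrime

variable {G : MarkedGraph V} {H K : FinDigraph V} {a t v u s₀ : V} {pos : V → ℕ}

theorem mem_contract_verts (hp : G.IsPrime H a t) {x : V} :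
    x ∈ (G.contract H a).verts ↔ x ∈ G.verts ∧ (x ∈ H.verts → x = a) := by
  have ha := hp.statement.source_mem
  simp only [contract, Finset.mem_image]
  constructor
  · rintro ⟨y, hy, rfl⟩
    by_cases h : y ∈ H.verts
    · rw [collapse_inside h]
      exact ⟨hp.1.1 ha, fun _ => rfl⟩
    · rw [collapse_outside h]
      exact ⟨hy, fun h' => absurd h' h⟩
  · rintro ⟨h1, h2⟩
    refine ⟨x, h1, ?_⟩
    by_cases h : x ∈ H.verts
    · rw [collapse_inside h, h2 h]
    · exact collapse_outside h

theorem card_contract (hp : G.IsPrime H a t) :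
    (G.contract H a).verts.card + H.verts.card = G.verts.card + 1 := by
  have ha := hp.statement.source_mem
  have e : (G.contract H a).verts = insert a (G.verts \ H.verts) := by
    ext x
    rw [hp.mem_contract_verts]
    simp only [Finset.mem_insert, Finset.mem_sdiff]
    constructor
    · rintro ⟨h1, h2⟩
      by_cases h : x ∈ H.verts
      · exact .inl (h2 h)
      · exact .inr ⟨h1, h⟩
    · rintro (rfl | ⟨h1, h2⟩)
      · exact ⟨hp.1.1 ha, fun _ => rfl⟩
      · exact ⟨h1, fun h => absurd h h2⟩
  rw [e, Finset.card_insert_of_notMem (by simp [ha]), Finset.card_sdiff_of_subset hp.1.1]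
  have := Finset.card_le_card hp.1.1
  omega

theorem fwd_collapse (hp : G.IsPrime H a t) (hG : G.Ordered s₀ pos) {x y : V} (h : G.Fwd x y) :
    ReflTransGen (G.contract H a).Fwd (collapse H.verts a x) (collapse H.verts a y) := by
  by_cases hn : x ∈ H.verts ∧ y ∈ H.verts
  · rw [collapse_inside hn.1, collapse_inside hn.2]
  · refine .single ⟨collapse_mem_collapseEdges h.1 hn, fun hc => h.2 ?_⟩
    obtain ⟨p, q, hpq, hn', e1, e2⟩ := mem_collapseEdges.1 hc
    obtain ⟨rfl, rfl⟩ := hp.collapse_inj (hG.sub hpq) hn' h.1 hn e1 e2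
    exact hpq

theorem reach_collapse (hp : G.IsPrime H a t) (hG : G.Ordered s₀ pos) {x y : V}
    (h : ReflTransGen G.Fwd x y) :
    ReflTransGen (G.contract H a).Fwd (collapse H.verts a x) (collapse H.verts a y) := by
  induction h with
  | refl => exact .refl
  | tail _ h ih => exact ih.trans (hp.fwd_collapse hG h)

theorem collapse_source (hp : G.IsPrime H a t) (hG : G.Ordered s₀ pos) :
    collapse H.verts a s₀ = s₀ := by
  by_cases h : s₀ ∈ H.verts
  · rw [collapse_inside h, hp.source_eq_of_mem hG h]
  · exact collapse_outside h

/-- The old positions still serve: the source has the least position in the prime, and only tails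
move, from the sink down to the source. -/
theorem ordered_contract (hp : G.IsPrime H a t) (hG : G.Ordered s₀ pos) :
    (G.contract H a).Ordered s₀ pos where
  sub := by
    rintro ⟨x, y⟩ h
    obtain ⟨p, q, hpq, hn, rfl, rfl⟩ := mem_collapseEdges.1 h
    exact collapse_mem_collapseEdges (hG.sub hpq) hn
  src := by
    have := Finset.mem_image_of_mem (collapse H.verts a) hG.src
    rwa [hp.collapse_source hG] at this
  inc := by
    rintro x y ⟨h, hc⟩
    obtain ⟨p, q, hpq, hn, rfl, rfl⟩ := mem_collapseEdges.1 h
    have h1 : G.Fwd p q := ⟨hpq, fun h' => hc (collapse_mem_collapseEdges h' hn)⟩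
    rw [hp.collapse_snd hpq hn]
    refine lt_of_le_of_lt ?_ (hG.inc h1)
    by_cases h2 : p ∈ H.verts
    · rw [collapse_inside h2]; exact hp.pos_le hG h2
    · rw [collapse_outside h2]
  back := by
    intro x y h
    obtain ⟨p, q, hpq, hn, rfl, rfl⟩ := mem_collapseEdges.1 h
    exact hp.reach_collapse hG (hG.back hpq)
  reach := by
    intro v hv
    obtain ⟨w, hw, rfl⟩ := Finset.mem_image.1 hv
    have := hp.reach_collapse hG (hG.reach w hw)
    rwa [hp.collapse_source hG] at this

/-- Contracting `H` creates no new edge inside the image of `K`: an edge whose image coincides with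
that of a pair in `K` is this pair. The critical pairs are those at the common vertex of `H` and
`K`. -/
theorem eq_of_collapse_eq (hp : G.IsPrime H a t) (hk : G.IsPrime K v u) (hG : G.Ordered s₀ pos)
    (hpos : pos a < pos v ∨ pos v < pos a) {x y p q : V} (hx : x ∈ K.verts) (hy : y ∈ K.verts)
    (hpq : (p, q) ∈ G.edges) (hn : ¬ (p ∈ H.verts ∧ q ∈ H.verts))
    (e1 : collapse H.verts a p = collapse H.verts a x)
    (e2 : collapse H.verts a q = collapse H.verts a y) : p = x ∧ q = y := by
  have ha := hp.statement.source_mem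
  by_cases hpH : p ∈ H.verts
  · have hqH : q ∉ H.verts := fun h => hn ⟨hpH, h⟩
    have hxH : x ∈ H.verts := by
      rw [collapse_inside hpH] at e1
      exact (collapse_eq_source ha).1 e1.symm
    rw [collapse_outside hqH] at e2
    have hqy : y = q := (collapse_eq_of_notMem ha hqH).1 e2.symm
    subst hqy
    have hpt : p = t := by
      by_contra h; exact hqH (hp.out_closed hpq hpH h)
    subst hpt
    refine ⟨?_, rfl⟩
    rcases hpos with hlt | hlt
    · obtain ⟨h1, h2⟩ := hp.inter_of_pos_lt hk hG hlt hxH hx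
      rw [h1, h2]
    · exfalso
      obtain ⟨h1, h2⟩ := hk.inter_of_pos_lt hp hG hlt hx hxH
      have hpK : p ∉ K.verts := fun h =>
        hp.statement.source_ne_sink (hk.inter_of_pos_lt hp hG hlt h hpH).1.symm
      by_cases hyv : y = v
      · subst hyv
        -- The edge enters the source of `K` from a later position, so it is marked, and the
        -- condition on cycle edges that enter the source of a prime puts its tail in `K`.
        have h3 := hp.pos_lt hG hpH hp.statement.source_ne_sink.symm
        exact hpK (hk.cycle_source_mem (hG.marked_of_le hpq (by omega)))
      · exact hpK (hk.in_closed hpq hy hyv)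
  · rw [collapse_outside hpH] at e1
    have hpx : x = p := (collapse_eq_of_notMem ha hpH).1 e1.symm
    subst hpx
    refine ⟨rfl, ?_⟩
    by_cases hqH : q ∈ H.verts
    · have hqa : q = a := by
        by_contra h; exact hpH (hp.in_closed hpq hqH h)
      subst hqa
      have hyH : y ∈ H.verts := by
        rw [collapse_inside hqH] at e2
        exact (collapse_eq_source ha).1 e2.symm
      rcases hpos with hlt | hlt
      · exfalso
        obtain ⟨h1, h2⟩ := hp.inter_of_pos_lt hk hG hlt hyH hy
        -- The same argument for the source of `H`: the tail lies in `K`, hence not before `v`,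
        -- which comes after `a`.
        have hle := hk.pos_le hG hx
        exact hpH (hp.cycle_source_mem (hG.marked_of_le hpq (by omega)))
      · exact (hk.inter_of_pos_lt hp hG hlt hy hyH).1.symm
    · rw [collapse_outside hqH] at e2
      exact ((collapse_eq_of_notMem ha hqH).1 e2.symm).symm

/-- Contracting a prime turns every prime with another source into a prime. -/
theorem contract_prime (hp : G.IsPrime H a t) (hk : G.IsPrime K v u) (hG : G.Ordered s₀ pos)
    (hpos : pos a < pos v ∨ pos v < pos a) :
    (G.contract H a).IsPrime (K.map (collapse H.verts a)) (collapse H.verts a v)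
      (collapse H.verts a u) := by
  have ha := hp.statement.source_mem
  have hcore := fun {x y p q : V} => hp.eq_of_collapse_eq hk hG hpos (x := x) (y := y) (p := p)
    (q := q)
  have hone : ∀ x y, x ∈ H.verts → x ∈ K.verts → y ∈ H.verts → y ∈ K.verts → x = y := by
    intro x y h1 h2 h3 h4
    rcases hpos with hlt | hlt
    · rw [(hp.inter_of_pos_lt hk hG hlt h1 h2).1, (hp.inter_of_pos_lt hk hG hlt h3 h4).1]
    · rw [(hk.inter_of_pos_lt hp hG hlt h2 h1).1, (hk.inter_of_pos_lt hp hG hlt h4 h3).1]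
  have hmeet : ∀ x, x ∈ H.verts → x ∈ K.verts → (x = v ∧ v = t) ∨ (x = a ∧ a = u) := by
    intro x h1 h2
    rcases hpos with hlt | hlt
    · exact .inl (hp.inter_of_pos_lt hk hG hlt h1 h2)
    · exact .inr (hk.inter_of_pos_lt hp hG hlt h2 h1)
  have hloop : ∀ x, (x, x) ∉ K.edges := by
    intro x h
    rcases hk.statement.edge_cases h with h | h | h
    · exact h.2.2.1 h.1
    · exact h.2.2.1 h.2.2.2.1
    · exact h.2.1 h.2.2.2.1
  have hnb : ∀ {x y}, (x, y) ∈ K.edges → ¬ (x ∈ H.verts ∧ y ∈ H.verts) := by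
    rintro x y h ⟨h1, h2⟩
    have := hone x y h1 (K.fst_mem h) h2 (K.snd_mem h)
    subst this
    exact hloop x h
  -- Collapsing moves only vertices of `H`, and at most one of these lies in `K`.
  have hinj : Set.InjOn (collapse H.verts a) K.verts := by
    intro x hx y hy e
    by_cases h1 : x ∈ H.verts
    · rw [collapse_inside h1] at e
      exact hone x y h1 hx ((collapse_eq_source ha).1 e.symm) hy
    · rw [collapse_outside h1] at e
      exact ((collapse_eq_of_notMem ha h1).1 e.symm).symm
  refine ⟨⟨?_, ?_⟩, ?_, ?_, ?_, ?_⟩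
  · exact Finset.image_subset_image hk.1.1
  · intro x y
    rw [FinDigraph.mem_map_edges]
    constructor
    · rintro ⟨p, q, h, rfl, rfl⟩
      exact ⟨collapse_mem_collapseEdges (hk.edge_of h) (hnb h),
        Finset.mem_image_of_mem _ (K.fst_mem h), Finset.mem_image_of_mem _ (K.snd_mem h)⟩
    · rintro ⟨h, h1, h2⟩
      obtain ⟨p, q, hpq, hn, e1, e2⟩ := mem_collapseEdges.1 h
      obtain ⟨x, hx, rfl⟩ := FinDigraph.mem_map_verts.1 h1
      obtain ⟨y, hy, rfl⟩ := FinDigraph.mem_map_verts.1 h2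
      obtain ⟨rfl, rfl⟩ := hcore hx hy hpq hn e1 e2
      exact ⟨p, q, hk.edge_mem hpq hx hy, rfl, rfl⟩
  · have e : (K.map (collapse H.verts a)).edges ∩ (G.contract H a).cycleEdges =
        (K.edges ∩ G.cycleEdges).image (Prod.map (collapse H.verts a) (collapse H.verts a)) := by
      ext ⟨x, y⟩
      rw [Finset.mem_inter, FinDigraph.mem_map_edges]
      simp only [Finset.mem_image, Prod.exists, Prod.map_apply, Prod.mk.injEq, Finset.mem_inter]
      constructor
      · rintro ⟨⟨x, y, h, rfl, rfl⟩, hc⟩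
        obtain ⟨p, q, hpq, hn, e1, e2⟩ := mem_collapseEdges.1 hc
        obtain ⟨rfl, rfl⟩ := hcore (K.fst_mem h) (K.snd_mem h) (hG.sub hpq) hn e1 e2
        exact ⟨p, q, ⟨h, hpq⟩, rfl, rfl⟩
      · rintro ⟨x, y, ⟨h, hc⟩, rfl, rfl⟩
        exact ⟨⟨x, y, h, rfl, rfl⟩, collapse_mem_collapseEdges hc (hnb h)⟩
    rw [e]
    exact hk.statement.map hinj
  · intro x y hy hne h
    obtain ⟨p, q, hpq, hn, rfl, rfl⟩ := mem_collapseEdges.1 h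
    obtain ⟨z, hz, e⟩ := FinDigraph.mem_map_verts.1 hy
    refine FinDigraph.mem_map_verts.2 ⟨p, ?_, rfl⟩
    by_cases hqH : q ∈ H.verts
    · have hpH : p ∉ H.verts := fun h => hn ⟨h, hqH⟩
      have hqa : q = a := by
        by_contra h; exact hpH (hp.in_closed hpq hqH h)
      rw [collapse_inside hqH] at e hne
      have hzH := (collapse_eq_source ha).1 e
      have hvH : v ∉ H.verts := fun h => hne (collapse_inside h).symm
      rcases hmeet z hzH hz with ⟨h1, h2⟩ | ⟨h1, -⟩
      · exact absurd (h1 ▸ hzH) hvH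
      · rw [h1, ← hqa] at hz
        refine hk.in_closed hpq hz ?_
        rintro rfl
        exact hvH hqH
    · rw [collapse_outside hqH] at e hne
      have := (collapse_eq_of_notMem ha hqH).1 e
      subst this
      refine hk.in_closed hpq hz ?_
      rintro rfl
      exact hne (collapse_outside hqH).symm
  · intro x y hx hne h
    obtain ⟨p, q, hpq, hn, rfl, rfl⟩ := mem_collapseEdges.1 h
    obtain ⟨z, hz, e⟩ := FinDigraph.mem_map_verts.1 hx
    refine FinDigraph.mem_map_verts.2 ⟨q, ?_, rfl⟩
    by_cases hpH : p ∈ H.verts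
    · have hqH : q ∉ H.verts := fun h => hn ⟨hpH, h⟩
      have hpt : p = t := by
        by_contra h; exact hqH (hp.out_closed hpq hpH h)
      rw [collapse_inside hpH] at e hne
      have hzH := (collapse_eq_source ha).1 e
      have huH : u ∉ H.verts := fun h => hne (collapse_inside h).symm
      rcases hmeet z hzH hz with ⟨h1, h2⟩ | ⟨h1, h2⟩
      · rw [h1, h2, ← hpt] at hz
        refine hk.out_closed hpq hz ?_
        rintro rfl
        exact huH hpH
      · exact absurd (h2 ▸ ha) huH
    · rw [collapse_outside hpH] at e hne
      have := (collapse_eq_of_notMem ha hpH).1 e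
      subst this
      refine hk.out_closed hpq hz ?_
      rintro rfl
      exact hne (collapse_outside hpH).symm
  · intro x hx
    obtain ⟨p, q, hpq, hn, rfl, e⟩ := mem_collapseEdges.1 hx
    by_cases hqH : q ∈ H.verts
    -- A marked edge that enters the source of `H` starts in `H`, so it disappears in the
    -- contraction.
    · exfalso
      have hpH : p ∉ H.verts := fun h => hn ⟨h, hqH⟩
      have hqa : q = a := by
        by_contra h; exact hpH (hp.in_closed (hG.sub hpq) hqH h)
      subst hqa
      exact hpH (hp.cycle_source_mem hpq)
    · rw [collapse_outside hqH] at e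
      have := (collapse_eq_of_notMem ha hqH).1 e.symm
      subst this
      exact collapse_mem_collapseEdges (hk.cycle_source hpq) (fun h => hn ⟨h.2, h.1⟩)

end IsPrime

/-- `Reduces G ws`: contracting primes with the distinct sources `ws`, in this order, turns `G` into
a single vertex. -/
inductive Reduces : MarkedGraph V → List V → Prop
  | single (G : MarkedGraph V) : G.verts.card = 1 → G.edges = ∅ → Reduces G []
  | contract (G : MarkedGraph V) (H : FinDigraph V) (a t : V) (ws : List V) :
      G.IsPrime H a t → a ∉ ws → Reduces (G.contract H a) ws → Reduces G (a :: ws)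

theorem IsPrime.one_lt_card {G : MarkedGraph V} {H : FinDigraph V} {a t : V}
    (hp : G.IsPrime H a t) : 1 < G.verts.card :=
  lt_of_lt_of_le hp.statement.two_le_card (Finset.card_le_card hp.1.1)

theorem Reduces.nodup {G : MarkedGraph V} {ws : List V} (h : G.Reduces ws) : ws.Nodup := by
  induction h with
  | single => exact .nil
  | contract G H a t ws _ h1 _ ih => exact .cons h1 ih

theorem Reduces.subset {G : MarkedGraph V} {ws : List V} (h : G.Reduces ws) :
    ∀ w ∈ ws, w ∈ G.verts := by
  induction h with
  | single => simp
  | contract G H a t ws hp h1 _ ih =>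
    intro w hw
    rcases List.mem_cons.1 hw with rfl | hw
    · exact hp.1.1 hp.statement.source_mem
    · exact (hp.mem_contract_verts.1 (ih w hw)).1

/-- Every prime of a reducible graph has one of the contracted sources as its source. -/
theorem Reduces.source_mem {G : MarkedGraph V} {ws : List V} (h : G.Reduces ws) {s₀ : V}
    {pos : V → ℕ} (hG : G.Ordered s₀ pos) (hinj : Set.InjOn pos G.verts) {K : FinDigraph V}
    {v u : V} (hk : G.IsPrime K v u) : v ∈ ws := by
  induction h generalizing K v u with
  | single G h1 => exact absurd hk.one_lt_card (by omega)
  | contract G H a t ws hp h1 _ ih =>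
    by_cases hva : v = a
    · simp [hva]
    have hv := hk.1.1 hk.statement.source_mem
    have ha := hp.1.1 hp.statement.source_mem
    have hpos : pos a < pos v ∨ pos v < pos a :=
      lt_or_gt_of_ne fun e => hva (hinj hv ha e.symm)
    have := ih (hp.ordered_contract hG)
      (hinj.mono fun x hx => (hp.mem_contract_verts.1 hx).1) (hp.contract_prime hk hG hpos)
    by_cases hvH : v ∈ H.verts
    -- The image of `K` would be a prime with source `a`, but `a` is not used as a source again.
    · rw [collapse_inside hvH] at this
      exact absurd this h1
    · rw [collapse_outside hvH] at this
      exact List.mem_cons_of_mem _ this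

end MarkedGraph

end Contraction

/-! ### Confluence: the last source can be contracted first -/

section Confluence

variable {V : Type*} [DecidableEq V]

theorem mem_collapseEdges_of_notMem {S : Finset V} {s x y : V} {E : Finset (V × V)} (hs : s ∈ S)
    (hx : x ∉ S) (hy : y ∉ S) : (x, y) ∈ collapseEdges S s E ↔ (x, y) ∈ E := by
  rw [mem_collapseEdges]
  constructor
  · rintro ⟨p, q, h, -, e1, e2⟩
    rwa [← (collapse_eq_of_notMem hs hx).1 e1, ← (collapse_eq_of_notMem hs hy).1 e2]
  · exact fun h => ⟨x, y, h, fun h => hx h.1, collapse_outside hx, collapse_outside hy⟩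

theorem collapse_mem_iff {S T : Finset V} {t x : V} (hST : Disjoint S T) (ht : t ∈ T) :
    collapse T t x ∈ S ↔ x ∈ S := by
  by_cases h : x ∈ T
  · rw [collapse_inside h]
    exact ⟨fun h' => absurd ht (Finset.disjoint_left.1 hST h'),
      fun h' => absurd h (Finset.disjoint_left.1 hST h')⟩
  · rw [collapse_outside h]

theorem collapse_comm {S T : Finset V} {s t : V} (hST : Disjoint S T) (hs : s ∈ S) (ht : t ∈ T)
    (x : V) : collapse S s (collapse T t x) = collapse T t (collapse S s x) := by
  have hsT : s ∉ T := Finset.disjoint_left.1 hST hs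
  have htS : t ∉ S := Finset.disjoint_right.1 hST ht
  by_cases h : x ∈ S
  · have h' : x ∉ T := Finset.disjoint_left.1 hST h
    rw [collapse_outside h', collapse_inside h, collapse_outside hsT]
  · by_cases h' : x ∈ T
    · rw [collapse_inside h', collapse_outside h, collapse_outside htS, collapse_inside h']
    · rw [collapse_outside h', collapse_outside h, collapse_outside h']

theorem collapseEdges_comm_subset {S T : Finset V} {s t : V} (hST : Disjoint S T) (hs : s ∈ S)
    (ht : t ∈ T) (E : Finset (V × V)) :
    collapseEdges S s (collapseEdges T t E) ⊆ collapseEdges T t (collapseEdges S s E) := by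
  rintro ⟨x, y⟩ h
  obtain ⟨p', q', h', hn', rfl, rfl⟩ := mem_collapseEdges.1 h
  obtain ⟨p, q, hpq, hn, rfl, rfl⟩ := mem_collapseEdges.1 h'
  rw [collapse_mem_iff hST ht, collapse_mem_iff hST ht] at hn'
  rw [collapse_comm hST hs ht, collapse_comm hST hs ht]
  refine collapse_mem_collapseEdges (collapse_mem_collapseEdges hpq hn') ?_
  rwa [collapse_mem_iff hST.symm hs, collapse_mem_iff hST.symm hs]

theorem collapseEdges_comm {S T : Finset V} {s t : V} (hST : Disjoint S T) (hs : s ∈ S)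
    (ht : t ∈ T) (E : Finset (V × V)) :
    collapseEdges S s (collapseEdges T t E) = collapseEdges T t (collapseEdges S s E) :=
  (collapseEdges_comm_subset hST hs ht E).antisymm (collapseEdges_comm_subset hST.symm ht hs E)

namespace MarkedGraph

open Relation

variable {G : MarkedGraph V} {H K : FinDigraph V} {a t v u s₀ : V} {pos : V → ℕ} {ws : List V}

theorem contract_comm (hd : Disjoint H.verts K.verts) (ha : a ∈ H.verts) (hv : v ∈ K.verts) :
    (G.contract H a).contract K v = (G.contract K v).contract H a := by
  refine ext' ?_ (collapseEdges_comm hd.symm hv ha _) (collapseEdges_comm hd.symm hv ha _)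
  simp only [contract, Finset.image_image]
  exact Finset.image_congr fun x _ => collapse_comm hd.symm hv ha x

/-- The only vertex of `H` that remains is `a`, and it comes before all vertices of `K`. -/
theorem IsPrime.disjoint_of_contract (hp : G.IsPrime H a t) (hk : (G.contract H a).IsPrime K v u)
    (hG : G.Ordered s₀ pos) (hlt : pos a < pos v) : Disjoint H.verts K.verts := by
  rw [Finset.disjoint_left]
  intro x hx hxK
  have := (hp.mem_contract_verts.1 (hk.1.1 hxK)).2 hx
  subst this
  have := hk.pos_le (hp.ordered_contract hG) hxK
  omega

/-- Off `H` the contraction changes nothing, and an edge between `K` and `H` would become an edge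
between `K` and `a`, which is outside `K`. So all conditions on `K` can be read in either graph. -/
theorem IsPrime.of_contract (hp : G.IsPrime H a t) (hk : (G.contract H a).IsPrime K v u)
    (hd : Disjoint H.verts K.verts) : G.IsPrime K v u := by
  have ha := hp.statement.source_mem
  have hout : ∀ {x}, x ∈ K.verts → x ∉ H.verts := fun h => Finset.disjoint_right.1 hd h
  have haK : a ∉ K.verts := Finset.disjoint_left.1 hd ha
  have hcol : ∀ {x}, collapse H.verts a x ∈ K.verts → x ∈ K.verts := by
    intro x hx
    by_cases h : x ∈ H.verts
    · rw [collapse_inside h] at hx; contradiction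
    · rwa [collapse_outside h] at hx
  have hedge : ∀ {x y}, x ∈ K.verts → y ∈ K.verts →
      ((x, y) ∈ (G.contract H a).edges ↔ (x, y) ∈ G.edges) := fun hx hy =>
    mem_collapseEdges_of_notMem ha (hout hx) (hout hy)
  refine ⟨⟨fun x hx => (hp.mem_contract_verts.1 (hk.1.1 hx)).1, fun x y => ?_⟩, ?_, ?_, ?_, ?_⟩
  · rw [hk.1.2]
    constructor
    · rintro ⟨h, h1, h2⟩
      exact ⟨(hedge h1 h2).1 h, h1, h2⟩
    · rintro ⟨h, h1, h2⟩
      exact ⟨(hedge h1 h2).2 h, h1, h2⟩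
  · have e : K.edges ∩ G.cycleEdges = K.edges ∩ (G.contract H a).cycleEdges := by
      ext ⟨x, y⟩
      rw [Finset.mem_inter, Finset.mem_inter]
      refine and_congr_right fun h => ?_
      exact (mem_collapseEdges_of_notMem ha (hout (K.fst_mem h)) (hout (K.snd_mem h))).symm
    rw [e]
    exact hk.statement
  · intro x y hy hne h
    have := collapse_mem_collapseEdges (s := a) h (S := H.verts) (fun h => hout hy h.2)
    rw [collapse_outside (hout hy)] at this
    exact hcol (hk.in_closed this hy hne)
  · intro x y hx hne h
    have := collapse_mem_collapseEdges (s := a) h (S := H.verts) (fun h => hout hx h.1)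
    rw [collapse_outside (hout hx)] at this
    exact hcol (hk.out_closed this hx hne)
  · intro x h
    have hv := hk.statement.source_mem
    have := collapse_mem_collapseEdges (s := a) h (S := H.verts) (fun h => hout hv h.2)
    rw [collapse_outside (hout hv)] at this
    have hx := hcol (hk.cycle_source_mem this)
    have h2 := hk.cycle_source this
    rw [collapse_outside (hout hx)] at h2
    exact (hedge hv hx).1 h2

/-- In a reducible graph the last of the sources can be contracted first. -/
theorem Reduces.contract_last (h : G.Reduces ws) (hG : G.Ordered s₀ pos) (hv : v ∈ ws)
    (hmax : ∀ w ∈ ws, w ≠ v → pos w < pos v) :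
    ∃ K u, G.IsPrime K v u ∧ (G.contract K v).Reduces (ws.erase v) := by
  induction h with
  | single G h1 => simp at hv
  | contract G H a t ws hp h1 h2 ih =>
    by_cases hav : a = v
    · subst hav
      exact ⟨H, t, hp, by simpa using h2⟩
    have hv' : v ∈ ws := (List.mem_cons.1 hv).resolve_left (Ne.symm hav)
    obtain ⟨K, u, hk, hr⟩ := ih (hp.ordered_contract hG) hv'
      (fun w hw => hmax w (List.mem_cons_of_mem _ hw))
    have hlt := hmax a (by simp) hav
    -- The prime at `v` found after contracting `H` avoids `H`, so it is a prime of `G` already.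
    -- Contracting it first keeps `H` prime, and the two contractions commute.
    have hd := hp.disjoint_of_contract hk hG hlt
    have ha := hp.statement.source_mem
    have hk' := hp.of_contract hk hd
    refine ⟨K, u, hk', ?_⟩
    have hp' := hk'.contract_prime hp hG (.inr hlt)
    have hsame : ∀ x ∈ H.verts, collapse K.verts v x = x :=
      fun x hx => collapse_outside (Finset.disjoint_left.1 hd hx)
    rw [FinDigraph.map_eq_self hsame, hsame a ha, hsame t hp.statement.sink_mem] at hp'
    rw [List.erase_cons_tail (by simpa using hav)]
    refine .contract _ H a t _ hp' (fun h => h1 (List.mem_of_mem_erase h)) ?_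
    rwa [← contract_comm hd ha hk.statement.source_mem]

/-- Invariant: the current graph has a contraction sequence whose sources are all still to be
treated. The vertex `v` to be treated comes last. If the loop contracts a prime there, `v` belongs
to the sequence, and by uniqueness of the prime this is the contraction that `contract_last` moves
to the front. If there is no prime at `v`, then `v` is not in the sequence. When no vertices are
left, the sequence is empty and the graph is a single vertex. -/
theorem Reduces.greedy {vs tr : List V} {b : Bool} (h : GreedyRun vs G tr b)
    (hr : G.Reduces ws) (hG : G.Ordered s₀ pos) (hinj : Set.InjOn pos G.verts)
    (hvs : vs.Pairwise fun x y => pos y < pos x) (hsub : ∀ w ∈ ws, w ∈ vs) : b = true := by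
  induction h generalizing ws with
  | yes => rfl
  | no G h1 =>
    cases hr with
    | single _ h2 => exact absurd h2 h1
    | contract => exact absurd (hsub _ List.mem_cons_self) List.not_mem_nil
  | contract v t vs G H tr b h1 hp _ ih =>
    rw [List.pairwise_cons] at hvs
    have hv := hr.source_mem hG hinj hp
    obtain ⟨K, u, hk, hr'⟩ := hr.contract_last hG hv fun w hw hwv =>
      hvs.1 w ((List.mem_cons.1 (hsub w hw)).resolve_left hwv)
    rw [← hp.contract_eq hk] at hr'
    refine ih hr' (hp.ordered_contract hG)
      (hinj.mono fun x hx => (hp.mem_contract_verts.1 hx).1) hvs.2 fun w hw => ?_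
    have := (hr.nodup.mem_erase_iff).1 hw
    exact (List.mem_cons.1 (hsub w this.2)).resolve_left this.1
  | skip v vs G tr b h1 hno _ ih =>
    rw [List.pairwise_cons] at hvs
    have hmem : ∀ w ∈ ws, w ≠ v → w ∈ vs := fun w hw hwv =>
      (List.mem_cons.1 (hsub w hw)).resolve_left hwv
    refine ih hr hG hinj hvs.2 fun w hw => hmem w hw ?_
    rintro rfl
    obtain ⟨K, u, hk, -⟩ := hr.contract_last hG hw fun x hx hxw => hvs.1 x (hmem x hx hxw)
    exact hno ⟨K, u, hk⟩

/-- The trace of a successful run is itself a contraction sequence; its sources are distinct because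
each vertex is treated once. The last hypothesis excludes a loop at a single vertex. It persists,
since contracting a prime that is the whole graph leaves no edge. -/
theorem reduces_of_greedy {vs tr : List V} {b : Bool} (h : GreedyRun vs G tr b) (hb : b = true)
    (hvs : vs.Nodup) (h1 : G.verts.card = 1 → G.edges = ∅) :
    G.Reduces tr ∧ ∀ w ∈ tr, w ∈ vs := by
  induction h with
  | yes vs G h2 => exact ⟨.single G h2 (h1 h2), by simp⟩
  | no => simp at hb
  | contract v t vs G H tr b h2 hp _ ih =>
    rw [List.nodup_cons] at hvs
    obtain ⟨h3, h4⟩ := ih hb hvs.2 (by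
      intro hc
      have hcard := hp.card_contract
      have hverts : H.verts = G.verts := Finset.eq_of_subset_of_card_le hp.1.1 (by omega)
      refine Finset.eq_empty_of_forall_notMem ?_
      rintro ⟨x, y⟩ hxy
      obtain ⟨p, q, hpq, hn, -, -⟩ := mem_collapseEdges.1 hxy
      rw [hverts] at hn
      exact hn ⟨G.fst_mem hpq, G.snd_mem hpq⟩)
    refine ⟨.contract G H v t tr hp (fun h => hvs.1 (h4 v h)) h3, ?_⟩
    intro w hw
    rcases List.mem_cons.1 hw with rfl | hw
    · simp
    · exact List.mem_cons_of_mem _ (h4 w hw)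
  | skip v vs G tr b h2 hno _ ih =>
    rw [List.nodup_cons] at hvs
    obtain ⟨h3, h4⟩ := ih hb hvs.2 h1
    exact ⟨h3, fun w hw => List.mem_cons_of_mem _ (h4 w hw)⟩

theorem exists_greedy (vs : List V) (G : MarkedGraph V) : ∃ tr b, GreedyRun vs G tr b := by
  classical
  induction vs generalizing G with
  | nil =>
    by_cases h : G.verts.card = 1
    · exact ⟨_, _, .yes _ G h⟩
    · exact ⟨_, _, .no G h⟩
  | cons v vs ih =>
    by_cases h : G.verts.card = 1
    · exact ⟨_, _, .yes _ G h⟩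
    by_cases hp : ∃ H t, G.IsPrime H v t
    · obtain ⟨H, t, hp⟩ := hp
      obtain ⟨tr, b, hr⟩ := ih (G.contract H v)
      exact ⟨_, _, .contract v t vs G H tr b h hp hr⟩
    · obtain ⟨tr, b, hr⟩ := ih G
      exact ⟨_, _, .skip v vs G tr b h hp hr⟩

theorem IsPrime.card_edges_le (hp : G.IsPrime H a t) :
    G.edges.card ≤ (G.contract H a).edges.card + H.edges.card := by
  have h1 := Finset.card_filter_add_card_filter_not
    (s := G.edges) (fun e => e.1 ∈ H.verts ∧ e.2 ∈ H.verts)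
  have h2 : (G.edges.filter fun e => e.1 ∈ H.verts ∧ e.2 ∈ H.verts).card ≤ H.edges.card := by
    refine Finset.card_le_card ?_
    rintro ⟨x, y⟩ h
    rw [Finset.mem_filter] at h
    exact hp.edge_mem h.1 h.2.1 h.2.2
  have h3 : (G.contract H a).edges.card =
      (G.edges.filter fun e => ¬ (e.1 ∈ H.verts ∧ e.2 ∈ H.verts)).card := by
    simp only [contract, collapseEdges]
    refine Finset.card_image_of_injOn ?_
    rintro ⟨x, y⟩ h ⟨x', y'⟩ h' e
    simp only [Finset.coe_filter, Set.mem_ofPred_eq] at h h'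
    obtain ⟨rfl, rfl⟩ := hp.collapse_inj h.1 h.2 h'.1 h'.2 (Prod.mk.inj e).1 (Prod.mk.inj e).2
    rfl
  omega

theorem Reduces.card_edges_le (h : G.Reduces ws) : G.edges.card + 2 ≤ 2 * G.verts.card := by
  induction h with
  | single G h1 h2 => simp [h1, h2]
  | contract G H a t ws hp h1 h2 ih =>
    have := hp.card_edges_le
    have := hp.card_contract
    have := hp.statement.card_edges_le
    omega

/-- A prime is entered only through its source, which therefore separates `s₀` from the rest of it.
-/
theorem IsPrime.notMem_of_reach (hp : G.IsPrime H a t) {x : V} (hs : s₀ ∉ H.verts)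
    (h : ReflTransGen (fun x y => (x, y) ∈ G.edges ∧ x ≠ a ∧ y ≠ a) s₀ x) : x ∉ H.verts := by
  induction h with
  | refl => exact hs
  | tail _ h ih => exact fun h' => ih (hp.in_closed h.1 h' h.2.2)

/-- Every cycle edge of a reducible graph enters a vertex that dominates its tail. -/
theorem Reduces.separates (h : G.Reduces ws) (hG : G.Ordered s₀ pos) {x y : V}
    (hxy : (x, y) ∈ G.cycleEdges) : G.Separates y s₀ x := by
  induction h generalizing x y with
  | single G h1 h2 => simpa [h2] using hG.sub hxy
  | contract G H a t ws hp h1 h2 ih =>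
    rintro ⟨hs, hpath⟩
    have ha := hp.statement.source_mem
    by_cases hn : x ∈ H.verts ∧ y ∈ H.verts
    · have hya : y = a := by
        by_contra h
        exact (hp.fwd_of_edge (hp.edge_mem (hG.sub hxy) hn.1 hn.2) h).2 hxy
      subst hya
      exact hp.notMem_of_reach (fun h => hs (hp.source_eq_of_mem hG h)) hpath hn.1
    · have hc := collapse_mem_collapseEdges (s := a) hxy hn
      have hy := hp.collapse_snd (hG.sub hxy) hn
      rw [hy] at hc
      refine ih (hp.ordered_contract hG) hc ⟨hs, ?_⟩
      -- The projected path still avoids `y`: its vertices in `H` go to `a`, and `a = y` is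
      -- impossible, since a path that avoids `a` never enters `H`.
      have hne : ∀ {z}, ReflTransGen (fun x z => (x, z) ∈ G.edges ∧ x ≠ y ∧ z ≠ y) s₀ z → z ≠ y →
          collapse H.verts a z ≠ y := by
        intro z hz hzy
        by_cases hzH : z ∈ H.verts
        · rw [collapse_inside hzH]
          rintro rfl
          exact hp.notMem_of_reach (fun h => hs (hp.source_eq_of_mem hG h)) hz hzH
        · rwa [collapse_outside hzH]
      have key : ∀ {z}, ReflTransGen (fun x z => (x, z) ∈ G.edges ∧ x ≠ y ∧ z ≠ y) s₀ z →
          ReflTransGen (fun x z => (x, z) ∈ (G.contract H a).edges ∧ x ≠ y ∧ z ≠ y) s₀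
            (collapse H.verts a z) := by
        intro z hz
        induction hz with
        | refl => rw [hp.collapse_source hG]
        | @tail p q hp1 hpq ih' =>
          by_cases hn' : p ∈ H.verts ∧ q ∈ H.verts
          · rw [collapse_inside hn'.1] at ih'
            rwa [collapse_inside hn'.2]
          · exact ih'.tail ⟨collapse_mem_collapseEdges hpq.1 hn', hne hp1 hpq.2.1,
              hne (hp1.tail hpq) hpq.2.2⟩
      exact key hpath

/-- An edge that leaves the contracted vertex left the sink before, and inside the prime the source
reaches the sink by unmarked edges. -/
theorem IsPrime.reach_of_contract (hp : G.IsPrime H a t) {x y : V}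
    (h : ReflTransGen (G.contract H a).Fwd x y) : ReflTransGen G.Fwd x y := by
  induction h with
  | refl => exact .refl
  | @tail x' y' _ h ih =>
    refine ih.trans ?_
    obtain ⟨h, hc⟩ := h
    obtain ⟨p, q, hpq, hn, rfl, rfl⟩ := mem_collapseEdges.1 h
    have hf : G.Fwd p q := ⟨hpq, fun h => hc (collapse_mem_collapseEdges h hn)⟩
    rw [hp.collapse_snd hpq hn]
    by_cases hpH : p ∈ H.verts
    · rw [collapse_inside hpH]
      exact (hp.reach_mem hpH).tail hf
    · rw [collapse_outside hpH]
      exact .single hf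

/-- The vertices of `H` all inherit the position of `a` in the contracted graph, and the offsets 0,
1, 2 order them as source, middle, sink. The factor 3 keeps these offsets from disturbing the order
between different positions. -/
theorem IsPrime.ordered_of_contract (hp : G.IsPrime H a t) (hsub : G.cycleEdges ⊆ G.edges)
    (hG : (G.contract H a).Ordered s₀ pos) : ∃ pos', G.Ordered s₀ pos' := by
  have ha := hp.statement.source_mem
  have hta := hp.statement.source_ne_sink
  have hcol : ∀ x, ReflTransGen G.Fwd (collapse H.verts a x) x := by
    intro x
    by_cases h : x ∈ H.verts
    · rw [collapse_inside h]; exact hp.reach_mem h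
    · rw [collapse_outside h]
  refine ⟨fun x => 3 * pos (collapse H.verts a x) + (if x = a then 0 else if x = t then 2 else 1),
    hsub, (hp.mem_contract_verts.1 hG.src).1, ?_, ?_, ?_⟩
  · intro x y hxy
    by_cases hn : x ∈ H.verts ∧ y ∈ H.verts
    · simp only [collapse_inside hn.1, collapse_inside hn.2]
      rcases hp.statement.edge_cases (hp.edge_mem hxy.1 hn.1 hn.2) with h | h | h
      · rw [if_pos h.1, if_neg h.2.2.1]
        split_ifs <;> omega
      · rw [if_neg h.2.1, if_neg h.2.2.1, h.2.2.2.1, if_neg hta.symm, if_pos rfl]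
        omega
      · exact absurd (Finset.mem_inter.1 h.2.2.2.2).2 hxy.2
    · have : pos (collapse H.verts a x) < pos (collapse H.verts a y) := by
        refine hG.inc ⟨collapse_mem_collapseEdges hxy.1 hn, fun hc => hxy.2 ?_⟩
        obtain ⟨p, q, hpq, hn', e1, e2⟩ := mem_collapseEdges.1 hc
        obtain ⟨rfl, rfl⟩ := hp.collapse_inj (hsub hpq) hn' hxy.1 hn e1 e2
        exact hpq
      split_ifs <;> omega
  · intro x y hxy
    by_cases hn : x ∈ H.verts ∧ y ∈ H.verts
    · have hya : y = a := by
        by_contra h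
        exact (hp.fwd_of_edge (hp.edge_mem (hsub hxy) hn.1 hn.2) h).2 hxy
      rw [hya]
      exact hp.reach_mem hn.1
    · have := hG.back (collapse_mem_collapseEdges (s := a) hxy hn)
      rw [hp.collapse_snd (hsub hxy) hn] at this
      exact (hp.reach_of_contract this).trans (hcol x)
  · intro v hv
    exact (hp.reach_of_contract (hG.reach _ (Finset.mem_image_of_mem _ hv))).trans (hcol v)

end MarkedGraph

end Confluence

/-! ### Dijkstra graphs and contraction sequences -/

section Dijkstra

variable {V : Type*} [DecidableEq V]

/-- `f` is an isomorphism from `G` with source `s₀` to the labeled graph `L`. -/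
structure LabeledGraph.IsIso (L : LabeledGraph) (G : FinDigraph V) (s₀ : V) (f : V → ℕ) : Prop where
  bij : Set.BijOn f G.verts L.verts
  source : f s₀ = L.source
  edge : ∀ x ∈ G.verts, ∀ y ∈ G.verts, ((x, y) ∈ G.edges ↔ (f x, f y) ∈ L.edges)

namespace IsExpansion

variable {L L' : LabeledGraph} {v s t : ℕ} {H : FinDigraph ℕ}

theorem notMem (h : IsExpansion L v H s t L') {x : ℕ} (hx : x ∈ H.verts) : x ∉ L.verts :=
  Finset.disjoint_right.1 h.disjoint hx

theorem edge_inside (h : IsExpansion L v H s t L') {x y : ℕ} (hx : x ∈ H.verts)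
    (hy : y ∈ H.verts) : (x, y) ∈ L'.edges ↔ (x, y) ∈ H.edges := by
  rw [h.edges_iff]
  constructor
  · rintro (h' | h' | h' | h')
    · exact absurd (L.fst_mem h'.1) (h.notMem hx)
    · exact h'
    · exact absurd (L.fst_mem h'.1) (h.notMem hx)
    · exact absurd (L.snd_mem h'.2.1) (h.notMem hy)
  · exact fun h' => .inr (.inl h')

theorem edge_outside (h : IsExpansion L v H s t L') {x y : ℕ} (hx : x ∉ H.verts)
    (hy : y ∉ H.verts) (ht : t ∈ H.verts) (hs : s ∈ H.verts) :
    (x, y) ∈ L'.edges ↔ (x, y) ∈ L.edges ∧ x ≠ v ∧ y ≠ v := by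
  rw [h.edges_iff]
  constructor
  · rintro (h' | h' | h' | h')
    · exact h'
    · exact absurd (H.fst_mem h') hx
    · exact absurd (h'.2.2 ▸ hs) hy
    · exact absurd (h'.1 ▸ ht) hx
  · exact .inl

theorem edge_enter (h : IsExpansion L v H s t L') {x y : ℕ} (hx : x ∉ H.verts)
    (hy : y ∈ H.verts) (ht : t ∈ H.verts) :
    (x, y) ∈ L'.edges ↔ (x, v) ∈ L.edges ∧ x ≠ v ∧ y = s := by
  rw [h.edges_iff]
  constructor
  · rintro (h' | h' | h' | h')
    · exact absurd (L.snd_mem h'.1) (h.notMem hy)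
    · exact absurd (H.fst_mem h') hx
    · exact h'
    · exact absurd (h'.1 ▸ ht) hx
  · exact fun h' => .inr (.inr (.inl h'))

theorem edge_leave (h : IsExpansion L v H s t L') {x y : ℕ} (hx : x ∈ H.verts)
    (hy : y ∉ H.verts) (hs : s ∈ H.verts) :
    (x, y) ∈ L'.edges ↔ x = t ∧ (v, y) ∈ L.edges ∧ y ≠ v := by
  rw [h.edges_iff]
  constructor
  · rintro (h' | h' | h' | h')
    · exact absurd (L.fst_mem h'.1) (h.notMem hx)
    · exact absurd (H.snd_mem h') hy
    · exact absurd (h'.2.2 ▸ hs) hy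
    · exact h'
  · exact fun h' => .inr (.inr (.inr h'))

end IsExpansion

theorem IsStatement.loopless {H : FinDigraph V} {s t : V} {B : Finset (V × V)}
    (h : IsStatement H s t B) (x : V) : (x, x) ∉ H.edges := by
  intro hx
  rcases h.edge_cases hx with h | h | h
  · exact h.2.2.1 h.1
  · exact h.2.2.1 h.2.2.2.1
  · exact h.2.1 h.2.2.2.1

theorem IsLabeledDijkstra.basic {L : LabeledGraph} (h : IsLabeledDijkstra L) :
    (∀ x, (x, x) ∉ L.edges) ∧ L.expansible ⊆ L.verts ∧ L.source ∈ L.verts := by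
  induction h with
  | trivial G v h1 h2 h3 h4 => simp [h1, h2, h3, h4]
  | expand G G' v H s t B _ hv hH he ih =>
    obtain ⟨ih1, ih2, ih3⟩ := ih
    refine ⟨fun x hx => ?_, ?_, ?_⟩
    · rcases (he.edges_iff x x).1 hx with h | h | h | h
      · exact ih1 x h.1
      · exact hH.loopless x h
      · exact he.notMem hH.source_mem (h.2.2 ▸ G.fst_mem h.1)
      · exact he.notMem hH.sink_mem (h.1 ▸ G.snd_mem h.2.1)
    · rw [he.expansible_eq, he.verts_eq]
      exact Finset.union_subset_union (Finset.erase_subset_erase _ ih2) (Finset.erase_subset _ _)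
    · rw [he.source_eq, he.verts_eq]
      split_ifs with h
      · exact Finset.mem_union_right _ hH.source_mem
      · exact Finset.mem_union_left _ (Finset.mem_erase.2 ⟨h, ih3⟩)

/-- Induction on the expansions: the last expansion is undone by a contraction. The two clauses
about expansible vertices make the induction work. The vertex expanded last is expansible before, so
it is not yet a source of the sequence, which keeps the sources distinct, and no marked edge enters
it, which yields the condition on cycle edges in the definition of a prime. -/
theorem IsLabeledDijkstra.exists_reduces {L : LabeledGraph} (hL : IsLabeledDijkstra L)
    (G : FinDigraph V) (s₀ : V) (f : V → ℕ) (hs₀ : s₀ ∈ G.verts) (hf : L.IsIso G s₀ f) :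
    ∃ (C : Finset (V × V)) (ws : List V) (pos : V → ℕ),
      (MarkedGraph.mk G C).Reduces ws ∧ (MarkedGraph.mk G C).Ordered s₀ pos ∧
      (∀ w ∈ ws, f w ∉ L.expansible) ∧ ∀ x y, (x, y) ∈ C → f y ∉ L.expansible := by
  induction hL generalizing G s₀ f with
  | trivial L v h1 h2 h3 h4 =>
    have hcard : G.verts = {s₀} := by
      refine Finset.eq_singleton_iff_unique_mem.2 ⟨hs₀, fun x hx => ?_⟩
      have key : ∀ y ∈ G.verts, f y = v := by
        intro y hy
        simpa [h1] using hf.bij.mapsTo hy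
      exact hf.bij.injOn hx hs₀ ((key x hx).trans (key s₀ hs₀).symm)
    have hE : G.edges = ∅ := by
      refine Finset.eq_empty_of_forall_notMem ?_
      rintro ⟨x, y⟩ hxy
      have := (hf.edge x (G.fst_mem hxy) y (G.snd_mem hxy)).1 hxy
      simp [h2] at this
    refine ⟨∅, [], fun _ => 0, .single _ (by simp [hcard]) hE, ⟨by simp, hs₀, ?_, by simp, ?_⟩,
      by simp, by simp⟩
    · rintro x y ⟨h, -⟩
      simp [hE] at h
    · intro w hw
      have : w = s₀ := by simpa [hcard] using hw
      rw [this]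
  | expand L L' v H s t B hL hv hH he ih =>
    obtain ⟨hloop, hexp, hsrc⟩ := hL.basic
    have : Nonempty V := ⟨s₀⟩
    -- Inverse of the isomorphism; it carries the statement graph `H` into `G`.
    set g : ℕ → V := Function.invFunOn f G.verts with hg
    have hHs := hH.source_mem
    have hHt := hH.sink_mem
    have hL'H : H.verts ⊆ L'.verts := by rw [he.verts_eq]; exact Finset.subset_union_right
    have hgmem : ∀ {x}, x ∈ H.verts → g x ∈ G.verts ∧ f (g x) = x := fun hx =>
      Function.invFunOn_pos (hf.bij.surjOn (hL'H hx))
    have hginj : Set.InjOn g H.verts := by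
      intro x hx y hy e
      rw [← (hgmem hx).2, ← (hgmem hy).2, e]
    have hmemHG : ∀ {x}, x ∈ G.verts → (x ∈ (H.map g).verts ↔ f x ∈ H.verts) := by
      intro x hx
      rw [FinDigraph.mem_map_verts]
      constructor
      · rintro ⟨y, hy, rfl⟩
        rwa [(hgmem hy).2]
      · intro h
        exact ⟨f x, h, hf.bij.injOn (hgmem h).1 hx (hgmem h).2⟩
    have hsub : (H.map g).verts ⊆ G.verts := by
      intro x hx
      obtain ⟨y, hy, rfl⟩ := FinDigraph.mem_map_verts.1 hx
      exact (hgmem hy).1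
    have hgf : ∀ {x y}, x ∈ G.verts → y ∈ H.verts → (f x = y ↔ x = g y) := by
      intro x y hx hy
      constructor
      · rintro rfl
        exact hf.bij.injOn hx (hgmem hy).1 (hgmem hy).2.symm
      · rintro rfl
        exact (hgmem hy).2
    have hst := hH.map hginj
    have ha := hst.source_mem
    have hind : ∀ x y, (x, y) ∈ (H.map g).edges ↔
        (x, y) ∈ G.edges ∧ x ∈ (H.map g).verts ∧ y ∈ (H.map g).verts := by
      intro x y
      constructor
      · intro h
        refine ⟨?_, (H.map g).fst_mem h, (H.map g).snd_mem h⟩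
        obtain ⟨p, q, hpq, rfl, rfl⟩ := FinDigraph.mem_map_edges.1 h
        have hp := hgmem (H.fst_mem hpq)
        have hq := hgmem (H.snd_mem hpq)
        rw [hf.edge _ hp.1 _ hq.1, hp.2, hq.2, he.edge_inside (H.fst_mem hpq) (H.snd_mem hpq)]
        exact hpq
      · rintro ⟨h, hx, hy⟩
        have hx' := (hmemHG (hsub hx)).1 hx
        have hy' := (hmemHG (hsub hy)).1 hy
        rw [hf.edge _ (hsub hx) _ (hsub hy), he.edge_inside hx' hy'] at h
        exact FinDigraph.mem_map_edges.2 ⟨_, _, h, ((hgf (hsub hx) hx').1 rfl).symm,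
          ((hgf (hsub hy) hy').1 rfl).symm⟩
    have hout : ∀ {x}, x ∈ G.verts → x ∉ (H.map g).verts → f x ∈ L.verts ∧ f x ≠ v := by
      intro x hx h
      have := hf.bij.mapsTo hx
      rw [Finset.mem_coe, he.verts_eq, Finset.mem_union, Finset.mem_erase] at this
      rw [hmemHG hx] at h
      exact ⟨(this.resolve_right h).2, (this.resolve_right h).1⟩
    have hcross : ∀ {p q}, (p, q) ∈ G.edges → ¬ (p ∈ (H.map g).verts ∧ q ∈ (H.map g).verts) →
        (p ∉ (H.map g).verts ∧ q ∉ (H.map g).verts ∧ (f p, f q) ∈ L.edges) ∨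
        (p = g t ∧ q ∉ (H.map g).verts ∧ (v, f q) ∈ L.edges) ∨
        (p ∉ (H.map g).verts ∧ q = g s ∧ (f p, v) ∈ L.edges) := by
      intro p q hpq hn
      have hp := G.fst_mem hpq
      have hq := G.snd_mem hpq
      have hpq' := hpq
      rw [hf.edge p hp q hq] at hpq'
      by_cases h1 : p ∈ (H.map g).verts
      · have h2 : q ∉ (H.map g).verts := fun h2 => hn ⟨h1, h2⟩
        rw [he.edge_leave ((hmemHG hp).1 h1) (fun h => h2 ((hmemHG hq).2 h)) hHs] at hpq'
        exact .inr (.inl ⟨(hgf hp hHt).1 hpq'.1, h2, hpq'.2.1⟩)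
      · by_cases h2 : q ∈ (H.map g).verts
        · rw [he.edge_enter (fun h => h1 ((hmemHG hp).2 h)) ((hmemHG hq).1 h2) hHt] at hpq'
          exact .inr (.inr ⟨h1, (hgf hq hHs).1 hpq'.2.2, hpq'.1⟩)
        · rw [he.edge_outside (fun h => h1 ((hmemHG hp).2 h)) (fun h => h2 ((hmemHG hq).2 h))
            hHt hHs] at hpq'
          exact .inl ⟨h1, h2, hpq'.1⟩
    -- Only the underlying digraph of this contraction is used, so the marks are taken to be empty;
    -- the marks of `G₁` come from the induction hypothesis.
    set G₁ : FinDigraph V := ((MarkedGraph.mk G ∅).contract (H.map g) (g s)).toFinDigraph with hG₁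
    have hv₁ : ∀ {x}, x ∈ G₁.verts ↔ x = g s ∨ (x ∈ G.verts ∧ x ∉ (H.map g).verts) := by
      intro x
      simp only [hG₁, MarkedGraph.contract, Finset.mem_image]
      constructor
      · rintro ⟨y, hy, rfl⟩
        by_cases h : y ∈ (H.map g).verts
        · exact .inl (collapse_inside h)
        · rw [collapse_outside h]; exact .inr ⟨hy, h⟩
      · rintro (rfl | ⟨h1, h2⟩)
        · exact ⟨_, hsub ha, collapse_inside ha⟩
        · exact ⟨x, h1, collapse_outside h2⟩
    set f₁ : V → ℕ := fun x => if x = g s then v else f x with hf₁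
    have hf₁a : f₁ (g s) = v := if_pos rfl
    have hf₁o : ∀ {x}, x ∉ (H.map g).verts → f₁ x = f x := by
      intro x hx
      refine if_neg ?_
      rintro rfl
      exact hx ha
    have hvL := hexp hv
    have hs₁ : s₀ ∈ G₁.verts ∧ f₁ s₀ = L.source := by
      have h1 := hf.source
      rw [he.source_eq] at h1
      by_cases h : s₀ ∈ (H.map g).verts
      · have h2 := (hmemHG hs₀).1 h
        split_ifs at h1 with h3
        · have := (hgf hs₀ hHs).1 h1
          rw [this, hf₁a, h3]
          exact ⟨hv₁.2 (.inl rfl), rfl⟩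
        · exact absurd hsrc (h1 ▸ he.notMem h2)
      · rw [hf₁o h]
        refine ⟨hv₁.2 (.inr ⟨hs₀, h⟩), ?_⟩
        split_ifs at h1 with h3
        · exact absurd ((hmemHG hs₀).2 (h1 ▸ hHs)) h
        · exact h1
    have hiso : L.IsIso G₁ s₀ f₁ := by
      refine ⟨⟨?_, ?_, ?_⟩, hs₁.2, ?_⟩
      · intro x hx
        rcases hv₁.1 hx with rfl | ⟨h1, h2⟩
        · rw [hf₁a]; exact hvL
        · rw [hf₁o h2]; exact (hout h1 h2).1
      · intro x hx y hy e
        rcases hv₁.1 hx with rfl | ⟨h1, h2⟩ <;> rcases hv₁.1 hy with rfl | ⟨h3, h4⟩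
        · rfl
        · rw [hf₁a, hf₁o h4] at e
          exact absurd e.symm (hout h3 h4).2
        · rw [hf₁a, hf₁o h2] at e
          exact absurd e (hout h1 h2).2
        · rw [hf₁o h4, hf₁o h2] at e
          exact hf.bij.injOn h1 h3 e
      · intro y hy
        by_cases hyv : y = v
        · exact ⟨g s, hv₁.2 (.inl rfl), by rw [hf₁a, hyv]⟩
        · have hy' : y ∈ L'.verts := by
            rw [he.verts_eq]
            exact Finset.mem_union_left _ (Finset.mem_erase.2 ⟨hyv, hy⟩)
          obtain ⟨x, hx, rfl⟩ := hf.bij.surjOn hy'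
          have : x ∉ (H.map g).verts := fun h => he.notMem ((hmemHG hx).1 h) hy
          exact ⟨x, hv₁.2 (.inr ⟨hx, this⟩), hf₁o this⟩
      · intro x hx y hy
        constructor
        · intro h
          obtain ⟨p, q, hpq, hn, rfl, rfl⟩ := mem_collapseEdges.1 h
          rcases hcross hpq hn with ⟨h1, h2, h3⟩ | ⟨h1, h2, h3⟩ | ⟨h1, h2, h3⟩
          · rwa [collapse_outside h1, collapse_outside h2, hf₁o h1, hf₁o h2]
          · rwa [collapse_outside h2, hf₁o h2, h1, collapse_inside hst.sink_mem, hf₁a]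
          · rwa [collapse_outside h1, hf₁o h1, h2, collapse_inside ha, hf₁a]
        · intro h
          rcases hv₁.1 hx with rfl | ⟨h1, h2⟩ <;> rcases hv₁.1 hy with rfl | ⟨h3, h4⟩
          · rw [hf₁a] at h
            exact absurd h (hloop v)
          · rw [hf₁a, hf₁o h4] at h
            refine mem_collapseEdges.2 ⟨g t, y, ?_, fun h => h4 h.2,
              collapse_inside hst.sink_mem, collapse_outside h4⟩
            have : (g t, y) ∈ G.edges := by
              rw [hf.edge _ (hgmem hHt).1 _ h3, (hgmem hHt).2,
                he.edge_leave hHt (fun h => h4 ((hmemHG h3).2 h)) hHs]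
              exact ⟨rfl, h, (hout h3 h4).2⟩
            exact this
          · rw [hf₁a, hf₁o h2] at h
            refine mem_collapseEdges.2 ⟨x, g s, ?_, fun h => h2 h.1,
              collapse_outside h2, collapse_inside ha⟩
            have : (x, g s) ∈ G.edges := by
              rw [hf.edge _ h1 _ (hgmem hHs).1, (hgmem hHs).2,
                he.edge_enter (fun h => h2 ((hmemHG h1).2 h)) hHs hHt]
              exact ⟨h, (hout h1 h2).2, rfl⟩
            exact this
          · rw [hf₁o h2, hf₁o h4] at h
            refine (mem_collapseEdges_of_notMem ha h2 h4).2 ?_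
            have : (x, y) ∈ G.edges := by
              rw [hf.edge _ h1 _ h3, he.edge_outside (fun h => h2 ((hmemHG h1).2 h))
                (fun h => h4 ((hmemHG h3).2 h)) hHt hHs]
              exact ⟨h, (hout h1 h2).2, (hout h3 h4).2⟩
            exact this
    obtain ⟨C₁, ws₁, pos₁, hr, ho, hw, hC⟩ := ih G₁ s₀ f₁ hs₁.1 hiso
    set BG := B.image (Prod.map g g) with hBG
    set σ := collapse (H.map g).verts (g s) with hσ
    -- Marked are the cycle edges of the statement graph and the edges outside it whose images are
    -- marked in `G₁`.
    set C : Finset (V × V) := G.edges.filter fun e => e ∈ BG ∨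
      (¬ (e.1 ∈ (H.map g).verts ∧ e.2 ∈ (H.map g).verts) ∧ (σ e.1, σ e.2) ∈ C₁) with hCdef
    have hmemC : ∀ {x y}, (x, y) ∈ C ↔ (x, y) ∈ G.edges ∧ ((x, y) ∈ BG ∨
      (¬ (x ∈ (H.map g).verts ∧ y ∈ (H.map g).verts) ∧ (σ x, σ y) ∈ C₁)) := by
      intro x y
      simp only [hCdef, Finset.mem_filter]
    have hBsub := hst.marked_subset
    have hcontr : (MarkedGraph.mk G C).contract (H.map g) (g s) = MarkedGraph.mk G₁ C₁ := by
      refine MarkedGraph.ext' rfl rfl ?_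
      ext ⟨x, y⟩
      constructor
      · intro h
        obtain ⟨p, q, hpq, hn, rfl, rfl⟩ := mem_collapseEdges.1 h
        refine ((hmemC.1 hpq).2.resolve_left fun h => hn ?_).2
        exact ⟨(H.map g).fst_mem (hBsub h), (H.map g).snd_mem (hBsub h)⟩
      · intro h
        obtain ⟨p, q, hpq, hn, rfl, rfl⟩ := mem_collapseEdges.1 (ho.sub h)
        exact collapse_mem_collapseEdges (hmemC.2 ⟨hpq, .inr ⟨hn, h⟩⟩) hn
    have hfs : f (g s) ∉ L'.expansible := by
      rw [(hgmem hHs).2, he.expansible_eq]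
      simp only [Finset.mem_union, Finset.mem_erase, not_or, not_and]
      exact ⟨fun _ h => he.notMem hHs (hexp h), fun h => absurd rfl h⟩
    have hfo : ∀ {x}, x ∈ G.verts → x ∉ (H.map g).verts → f₁ x ∉ L.expansible →
        f x ∉ L'.expansible := by
      intro x hx h1 h2
      rw [hf₁o h1] at h2
      rw [he.expansible_eq]
      simp only [Finset.mem_union, Finset.mem_erase, not_or, not_and]
      exact ⟨fun _ => h2, fun _ h => h1 ((hmemHG hx).2 h)⟩
    have hprime : (MarkedGraph.mk G C).IsPrime (H.map g) (g s) (g t) := by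
      refine ⟨⟨hsub, hind⟩, ?_, ?_, ?_, ?_⟩
      · have e : (H.map g).edges ∩ C = BG := by
          ext ⟨x, y⟩
          rw [Finset.mem_inter, hmemC]
          constructor
          · rintro ⟨h, -, h' | h'⟩
            · exact h'
            · exact absurd ⟨(H.map g).fst_mem h, (H.map g).snd_mem h⟩ h'.1
          · intro h
            exact ⟨hBsub h, ((hind x y).1 (hBsub h)).1, .inl h⟩
        show IsStatement (H.map g) (g s) (g t) ((H.map g).edges ∩ C)
        rw [e]
        exact hst
      · intro x y hy hne h
        by_contra hx
        rcases hcross h (fun h => hx h.1) with h' | h' | h'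
        · exact h'.2.1 hy
        · exact h'.2.1 hy
        · exact hne h'.2.1
      · intro x y hx hne h
        by_contra hy
        rcases hcross h (fun h => hy h.2) with h' | h' | h'
        · exact h'.1 hx
        · exact hne h'.1
        · exact h'.1 hx
      · intro x hx
        obtain ⟨h1, h2⟩ := hmemC.1 hx
        rcases h2 with h2 | ⟨h2, h3⟩
        · have h3 := hBsub h2
          rcases hst.edge_cases h3 with h | h | h
          · exact absurd h2 h.2.2.2
          · exact absurd h2 h.2.2.2.2
          · exact ((hind _ _).1 (hst.source_edge h.1 h.2.1 h.2.2.1)).1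
        -- A marked edge from outside into the source would give a marked edge of `G₁` into the
        -- vertex named `v`, which is expansible; the induction hypothesis excludes this.
        · rw [hσ, collapse_inside ha] at h3
          exact absurd (hf₁a ▸ hv) (hC _ _ h3)
    rw [← hcontr] at hr ho
    obtain ⟨pos, ho'⟩ := hprime.ordered_of_contract (Finset.filter_subset _ _) ho
    refine ⟨C, g s :: ws₁, pos, .contract _ _ _ _ _ hprime ?_ hr, ho', ?_, ?_⟩
    · intro h
      exact hw _ h (hf₁a ▸ hv)
    · intro w hw'
      rcases List.mem_cons.1 hw' with rfl | hw'
      · exact hfs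
      · rcases hv₁.1 (hr.subset w hw') with rfl | ⟨h1, h2⟩
        · exact hfs
        · exact hfo h1 h2 (hw w hw')
    · intro x y hxy
      obtain ⟨h1, h2⟩ := hmemC.1 hxy
      rcases h2 with h2 | ⟨h2, h3⟩
      · have h3 := hBsub h2
        rcases hst.edge_cases h3 with h | h | h
        · exact absurd h2 h.2.2.2
        · exact absurd h2 h.2.2.2.2
        · rw [h.2.2.2.1]; exact hfs
      · have h4 := hC _ _ h3
        rcases hcross h1 h2 with h | h | h
        · rw [hσ, collapse_outside h.2.1] at h4
          exact hfo (G.snd_mem h1) h.2.1 h4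
        · rw [hσ, collapse_outside h.2.1] at h4
          exact hfo (G.snd_mem h1) h.2.1 h4
        · rw [h.2.1]; exact hfs

end Dijkstra

/-! ### From contraction sequences back to expansions -/

section Expansion

variable {V : Type*} [DecidableEq V]

/-- The labeled graph obtained from `L` by expanding `v` into `H` with source `s` and sink `t`. -/
def LabeledGraph.expandAt (L : LabeledGraph) (v : ℕ) (H : FinDigraph ℕ) (s t : ℕ)
    (hs : s ∈ H.verts) (ht : t ∈ H.verts) : LabeledGraph where
  verts := L.verts.erase v ∪ H.verts
  edges := (L.edges.filter fun e => e.1 ≠ v ∧ e.2 ≠ v) ∪ H.edges ∪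
    ((L.edges.filter fun e => e.2 = v ∧ e.1 ≠ v).image fun e => (e.1, s)) ∪
    ((L.edges.filter fun e => e.1 = v ∧ e.2 ≠ v).image fun e => (t, e.2))
  source := if L.source = v then s else L.source
  expansible := L.expansible.erase v ∪ H.verts.erase s
  fst_mem := by
    intro x y h
    simp only [Finset.mem_union, Finset.mem_filter, Finset.mem_image, Prod.exists,
      Prod.mk.injEq] at h
    rw [Finset.mem_union, Finset.mem_erase]
    rcases h with ((h | h) | ⟨p, q, h, rfl, -⟩) | ⟨p, q, h, rfl, -⟩
    · exact .inl ⟨h.2.1, L.fst_mem h.1⟩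
    · exact .inr (H.fst_mem h)
    · exact .inl ⟨h.2.2, L.fst_mem h.1⟩
    · exact .inr ht
  snd_mem := by
    intro x y h
    simp only [Finset.mem_union, Finset.mem_filter, Finset.mem_image, Prod.exists,
      Prod.mk.injEq] at h
    rw [Finset.mem_union, Finset.mem_erase]
    rcases h with ((h | h) | ⟨p, q, h, -, rfl⟩) | ⟨p, q, h, -, rfl⟩
    · exact .inl ⟨h.2.2, L.snd_mem h.1⟩
    · exact .inr (H.snd_mem h)
    · exact .inr hs
    · exact .inl ⟨h.2.2, L.snd_mem h.1⟩

theorem LabeledGraph.isExpansion_expandAt (L : LabeledGraph) (v : ℕ) (H : FinDigraph ℕ) (s t : ℕ)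
    (hs : s ∈ H.verts) (ht : t ∈ H.verts) (hd : Disjoint L.verts H.verts) :
    IsExpansion L v H s t (L.expandAt v H s t hs ht) where
  disjoint := hd
  verts_eq := rfl
  edges_iff := by
    intro x y
    simp only [expandAt, Finset.mem_union, Finset.mem_filter, Finset.mem_image, Prod.exists,
      Prod.mk.injEq]
    constructor
    · rintro (((h | h) | ⟨p, q, h, rfl, rfl⟩) | ⟨p, q, h, rfl, rfl⟩)
      · exact .inl h
      · exact .inr (.inl h)
      · exact .inr (.inr (.inl ⟨h.2.1 ▸ h.1, h.2.2, rfl⟩))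
      · exact .inr (.inr (.inr ⟨rfl, h.2.1 ▸ h.1, h.2.2⟩))
    · rintro (h | h | h | h)
      · exact .inl (.inl (.inl h))
      · exact .inl (.inl (.inr h))
      · exact .inl (.inr ⟨x, v, ⟨h.1, rfl, h.2.1⟩, rfl, h.2.2.symm⟩)
      · exact .inr ⟨v, y, ⟨h.2.1, rfl, h.2.2⟩, h.1.symm, rfl⟩
  source_eq := rfl
  expansible_eq := rfl

/-- Supplies fresh names: an expansion requires a copy of the statement graph that is disjoint from
the graph expanded so far. -/
theorem Finset.exists_injOn_disjoint (S : Finset V) (T : Finset ℕ) :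
    ∃ g : V → ℕ, Set.InjOn g S ∧ ∀ x ∈ S, g x ∉ T := by
  obtain ⟨g, hg⟩ := Set.countable_iff_exists_injOn.1 S.countable_toSet
  refine ⟨fun x => g x + (T.sup id + 1), fun x hx y hy e => hg hx hy (by simpa using e), ?_⟩
  intro x _ h
  have := Finset.le_sup (f := id) h
  simp only [id] at this
  omega

/-- Induction on the sequence: the graph after the first contraction is labeled already, and its
vertex `a` is expanded into a fresh copy of `H`. This is allowed because the sources are distinct:
`a` does not occur later, so the last clause makes it expansible. -/
theorem MarkedGraph.Reduces.exists_labeled {G : MarkedGraph V} {ws : List V} (h : G.Reduces ws)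
    {s₀ : V} {pos : V → ℕ} (hG : G.Ordered s₀ pos) :
    ∃ (L : LabeledGraph) (f : V → ℕ), IsLabeledDijkstra L ∧ L.IsIso G.toFinDigraph s₀ f ∧
      ∀ x ∈ G.verts, x ∉ ws → f x ∈ L.expansible := by
  induction h with
  | single G h1 h2 =>
    obtain ⟨w, hw⟩ := Finset.card_eq_one.1 h1
    refine ⟨⟨⟨{0}, ∅, by simp, by simp⟩, 0, {0}⟩, fun _ => 0, .trivial _ 0 rfl rfl rfl rfl,
      ⟨?_, rfl, by simp [h2]⟩, by simp⟩
    simp only [hw, Finset.coe_singleton]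
    exact ⟨by intro x; simp, by simp, by intro x; simp⟩
  | contract G H a t ws hp hna hr ih =>
    obtain ⟨L, f, hL, hf, hexp⟩ := ih (hp.ordered_contract hG)
    have ha := hp.statement.source_mem
    have ht := hp.statement.sink_mem
    obtain ⟨g, hg, hgT⟩ := Finset.exists_injOn_disjoint H.verts L.verts
    have hv₁ : ∀ {x}, x ∉ H.verts → x ∈ G.verts → x ∈ (G.contract H a).verts := fun h1 h2 =>
      hp.mem_contract_verts.2 ⟨h2, fun h => absurd h h1⟩
    have ha₁ : a ∈ (G.contract H a).verts := hp.mem_contract_verts.2 ⟨hp.1.1 ha, fun _ => rfl⟩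
    have hva := hexp a ha₁ hna
    have hgm : ∀ {x}, x ∈ H.verts → g x ∈ (H.map g).verts := fun h => Finset.mem_image_of_mem _ h
    have hd : Disjoint L.verts (H.map g).verts := by
      rw [Finset.disjoint_right]
      intro x hx
      obtain ⟨y, hy, rfl⟩ := FinDigraph.mem_map_verts.1 hx
      exact hgT y hy
    have he := L.isExpansion_expandAt (f a) (H.map g) (g a) (g t) (hgm ha) (hgm ht) hd
    set L' := L.expandAt (f a) (H.map g) (g a) (g t) (hgm ha) (hgm ht) with hL'
    set f' : V → ℕ := fun x => if x ∈ H.verts then g x else f x with hf'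
    have hf'i : ∀ {x}, x ∈ H.verts → f' x = g x := fun h => if_pos h
    have hf'o : ∀ {x}, x ∉ H.verts → f' x = f x := fun h => if_neg h
    have hfL : ∀ {x}, x ∉ H.verts → x ∈ G.verts →
        f x ∈ L.verts ∧ f x ≠ f a ∧ f x ∉ (H.map g).verts := by
      intro x h1 h2
      have h3 := hf.bij.mapsTo (hv₁ h1 h2)
      refine ⟨h3, fun e => h1 ?_, Finset.disjoint_left.1 hd h3⟩
      rw [hf.bij.injOn (hv₁ h1 h2) ha₁ e]
      exact ha
    refine ⟨L', f', .expand L L' (f a) (H.map g) (g a) (g t) _ hL hva (hp.statement.map hg) he,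
      ⟨⟨?_, ?_, ?_⟩, ?_, ?_⟩, ?_⟩
    · intro x hx
      rw [Finset.mem_coe, he.verts_eq]
      by_cases h : x ∈ H.verts
      · rw [hf'i h]; exact Finset.mem_union_right _ (hgm h)
      · rw [hf'o h]
        exact Finset.mem_union_left _ (Finset.mem_erase.2 ⟨(hfL h hx).2.1, (hfL h hx).1⟩)
    · intro x hx y hy e
      by_cases h : x ∈ H.verts <;> by_cases h' : y ∈ H.verts
      · rw [hf'i h, hf'i h'] at e
        exact hg h h' e
      · rw [hf'i h, hf'o h'] at e
        exact absurd (e ▸ hgm h) (hfL h' hy).2.2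
      · rw [hf'o h, hf'i h'] at e
        exact absurd (e ▸ hgm h') (hfL h hx).2.2
      · rw [hf'o h, hf'o h'] at e
        exact hf.bij.injOn (hv₁ h hx) (hv₁ h' hy) e
    · intro y hy
      rw [Finset.mem_coe, he.verts_eq, Finset.mem_union, Finset.mem_erase] at hy
      rcases hy with ⟨h1, h2⟩ | h
      · obtain ⟨x, hx, rfl⟩ := hf.bij.surjOn h2
        obtain ⟨h3, h4⟩ := hp.mem_contract_verts.1 hx
        have h5 : x ∉ H.verts := fun h => h1 (by rw [h4 h])
        exact ⟨x, h3, hf'o h5⟩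
      · obtain ⟨x, hx, rfl⟩ := FinDigraph.mem_map_verts.1 h
        exact ⟨x, hp.1.1 hx, hf'i hx⟩
    · rw [he.source_eq, ← hf.source]
      have hs₀ := (hp.ordered_contract hG).src
      by_cases h : s₀ ∈ H.verts
      · have := hp.source_eq_of_mem hG h
        subst this
        rw [if_pos rfl, hf'i h]
      · rw [if_neg (hfL h hG.src).2.1, hf'o h]
    · intro x hx y hy
      by_cases h : x ∈ H.verts <;> by_cases h' : y ∈ H.verts
      · rw [hf'i h, hf'i h', he.edge_inside (hgm h) (hgm h'), FinDigraph.mem_map_edges]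
        constructor
        · exact fun hxy => ⟨x, y, hp.edge_mem hxy h h', rfl, rfl⟩
        · rintro ⟨p, q, hpq, e1, e2⟩
          rw [← hg (H.fst_mem hpq) h e1, ← hg (H.snd_mem hpq) h' e2]
          exact hp.edge_of hpq
      · rw [hf'i h, hf'o h', he.edge_leave (hgm h) (hfL h' hy).2.2 (hgm ha),
          ← hf.edge a ha₁ y (hv₁ h' hy)]
        constructor
        · intro hxy
          have hxt : x = t := by
            by_contra hne; exact h' (hp.out_closed hxy h hne)
          refine ⟨by rw [hxt], ?_, (hfL h' hy).2.1⟩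
          exact mem_collapseEdges.2 ⟨x, y, hxy, fun h => h' h.2, collapse_inside h,
            collapse_outside h'⟩
        · rintro ⟨e, hay, -⟩
          obtain ⟨p, q, hpq, hn, e1, e2⟩ := mem_collapseEdges.1 hay
          have hqy := (collapse_eq_of_notMem ha h').1 e2
          subst hqy
          have hpH := (collapse_eq_source ha).1 e1
          have hpt : p = t := by
            by_contra hne; exact h' (hp.out_closed hpq hpH hne)
          rw [hg h ht e, ← hpt]
          exact hpq
      · rw [hf'o h, hf'i h', he.edge_enter (hfL h hx).2.2 (hgm h') (hgm ht),
          ← hf.edge x (hv₁ h hx) a ha₁]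
        constructor
        · intro hxy
          have hya : y = a := by
            by_contra hne; exact h (hp.in_closed hxy h' hne)
          refine ⟨?_, (hfL h hx).2.1, by rw [hya]⟩
          exact mem_collapseEdges.2 ⟨x, y, hxy, fun h' => h h'.1, collapse_outside h,
            collapse_inside h'⟩
        · rintro ⟨hxa, -, e⟩
          obtain ⟨p, q, hpq, hn, e1, e2⟩ := mem_collapseEdges.1 hxa
          have hpx := (collapse_eq_of_notMem ha h).1 e1
          subst hpx
          have hqH := (collapse_eq_source ha).1 e2
          have hqa : q = a := by
            by_contra hne; exact h (hp.in_closed hpq hqH hne)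
          rw [hg h' ha e, ← hqa]
          exact hpq
      · rw [hf'o h, hf'o h', he.edge_outside (hfL h hx).2.2 (hfL h' hy).2.2 (hgm ht) (hgm ha),
          ← hf.edge x (hv₁ h hx) y (hv₁ h' hy)]
        refine Iff.trans (mem_collapseEdges_of_notMem ha h h').symm ?_
        exact ⟨fun hxy => ⟨hxy, (hfL h hx).2.1, (hfL h' hy).2.1⟩, fun hxy => hxy.1⟩
    · intro x hx hxw
      rw [he.expansible_eq]
      rw [List.mem_cons, not_or] at hxw
      by_cases h : x ∈ H.verts
      · rw [hf'i h]
        refine Finset.mem_union_right _ (Finset.mem_erase.2 ⟨fun e => hxw.1 (hg h ha e), hgm h⟩)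
      · rw [hf'o h]
        exact Finset.mem_union_left _ (Finset.mem_erase.2 ⟨(hfL h hx).2.1,
          hexp x (hv₁ h hx) hxw.2⟩)

/-- A flow graph with suitably marked edges that can be contracted to a single vertex is a Dijkstra
graph. -/
theorem MarkedGraph.Reduces.isDijkstra {G : FlowGraph V} {C : Finset (V × V)} {ws : List V}
    (h : (MarkedGraph.mk G.toFinDigraph C).Reduces ws) {pos : V → ℕ}
    (hG : (MarkedGraph.mk G.toFinDigraph C).Ordered G.source pos) : G.IsDijkstra := by
  obtain ⟨L, f, hL, hf, -⟩ := h.exists_labeled hG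
  exact ⟨L, hL, f, hf.bij, hf.source, hf.edge⟩

theorem FlowGraph.IsDijkstra.exists_reduces {G : FlowGraph V} (h : G.IsDijkstra) :
    ∃ (C : Finset (V × V)) (ws : List V) (pos : V → ℕ),
      (MarkedGraph.mk G.toFinDigraph C).Reduces ws ∧
      (MarkedGraph.mk G.toFinDigraph C).Ordered G.source pos := by
  obtain ⟨L, hL, f, h1, h2, h3⟩ := h
  obtain ⟨C, ws, pos, h4, h5, -⟩ :=
    hL.exists_reduces G.toFinDigraph G.source f G.source_mem ⟨h1, h2, h3⟩
  exact ⟨C, ws, pos, h4, h5⟩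

end Expansion

/-! ### Depth-first search -/

section DepthFirstSearch

open Relation

variable {V : Type*} [DecidableEq V]

/-- The initial state of a depth-first search. -/
def FlowGraph.dfsInit (G : FlowGraph V) : DFSState V :=
  ⟨[G.source], {G.source}, G.edges.filter (fun e => e = (G.source, G.source))⟩

/-- A depth-first search together with the list of the removed vertices, the last one first. -/
inductive DFSTrace (G : FlowGraph V) : DFSState V → List V → Prop
  | init : DFSTrace G G.dfsInit []
  | insert (u w : V) (st : List V) (vis : Finset V) (C : Finset (V × V)) (fin : List V) :
      DFSTrace G ⟨u :: st, vis, C⟩ fin → (u, w) ∈ G.edges → w ∉ vis →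
      DFSTrace G ⟨w :: u :: st, insert w vis,
        C ∪ G.edges.filter (fun e => e.1 = w ∧ e.2 ∈ w :: u :: st)⟩ fin
  | remove (u : V) (st : List V) (vis : Finset V) (C : Finset (V × V)) (fin : List V) :
      DFSTrace G ⟨u :: st, vis, C⟩ fin → (∀ w, (u, w) ∈ G.edges → w ∈ vis) →
      DFSTrace G ⟨st, vis, C⟩ (u :: fin)

theorem DFSTrace.reflTransGen {G : FlowGraph V} {S : DFSState V} {fin : List V}
    (h : DFSTrace G S fin) : ReflTransGen (DFSStep G.toFinDigraph) G.dfsInit S := by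
  induction h with
  | init => exact .refl
  | insert u w st vis C fin _ h1 h2 ih => exact ih.tail (.insert u w st vis C h1 h2)
  | remove u st vis C fin _ h1 ih => exact ih.tail (.remove u st vis C h1)

theorem exists_dfsTrace {G : FlowGraph V} {S : DFSState V}
    (h : ReflTransGen (DFSStep G.toFinDigraph) G.dfsInit S) : ∃ fin, DFSTrace G S fin := by
  induction h with
  | refl => exact ⟨_, .init⟩
  | tail _ h ih =>
    obtain ⟨fin, ih⟩ := ih
    cases h with
    | insert u w st vis C h1 h2 => exact ⟨_, .insert u w st vis C fin ih h1 h2⟩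
    | remove u st vis C h1 => exact ⟨_, .remove u st vis C fin ih h1⟩

/-- The edges used so far that are not cycle edges. -/
def DFSState.Fwd (S : DFSState V) (G : FlowGraph V) (x y : V) : Prop :=
  (x, y) ∈ G.edges ∧ (x, y) ∉ S.cycleEdges ∧ x ∈ S.visited

/-- The invariant of a depth-first search. -/
structure DFSInvariant (G : FlowGraph V) (S : DFSState V) (fin : List V) : Prop where
  mem_iff : ∀ x, x ∈ S.visited ↔ x ∈ S.stack ∨ x ∈ fin
  nodup : (S.stack ++ fin).Nodup
  subset : S.visited ⊆ G.verts
  marked : ∀ x y, (x, y) ∈ S.cycleEdges → (x, y) ∈ G.edges ∧ x ∈ S.visited ∧ y ∈ S.visited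
  stack_marked : S.stack.Pairwise fun x y => (x, y) ∈ G.edges → (x, y) ∈ S.cycleEdges
  stack_loop : ∀ x ∈ S.stack, (x, x) ∈ G.edges → (x, x) ∈ S.cycleEdges
  sorted : ∀ l₁ x l₂, fin = l₁ ++ x :: l₂ → ∀ y, (x, y) ∈ G.edges → (x, y) ∉ S.cycleEdges → y ∈ l₂
  finished : ∀ x ∈ fin, ∀ y, (x, y) ∈ G.edges → y ∈ S.visited
  stack_path : S.stack.Pairwise fun x y => ReflTransGen (S.Fwd G) y x
  back : ∀ x y, (x, y) ∈ S.cycleEdges → ReflTransGen (S.Fwd G) y x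
  reach : ∀ x ∈ S.visited, ReflTransGen (S.Fwd G) G.source x
  chain : S.stack.IsChain fun x y => (y, x) ∈ G.edges
  last : ∀ h : S.stack ≠ [], S.stack.getLast h = G.source
  dominated : ∀ x y, (x, y) ∈ G.edges → x ∈ S.visited →
    (y = x ∨ G.Separates y G.source x) → (x, y) ∈ S.cycleEdges

/-- Read from bottom to top the stack is a path from the source, so a vertex that is not on the
stack does not separate the source from the top. -/
theorem reach_of_stack {G : FlowGraph V} {y : V} {x : V} {l : List V}
    (hc : (x :: l).IsChain fun x y => (y, x) ∈ G.edges)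
    (hl : (x :: l).getLast (List.cons_ne_nil _ _) = G.source) (hy : y ∉ x :: l) :
    G.source ≠ y ∧ ReflTransGen (fun a b => (a, b) ∈ G.edges ∧ a ≠ y ∧ b ≠ y) G.source x := by
  induction l generalizing x with
  | nil =>
    simp only [List.getLast_singleton] at hl
    subst hl
    exact ⟨fun h => hy (by simp [h]), .refl⟩
  | cons z l ih =>
    rw [List.isChain_cons_cons] at hc
    rw [List.getLast_cons (List.cons_ne_nil _ _)] at hl
    simp only [List.mem_cons, not_or] at hy
    obtain ⟨h1, h2⟩ := ih hc.2 hl (by simp [hy.2.1, hy.2.2])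
    exact ⟨h1, h2.tail ⟨hc.1, Ne.symm hy.2.1, Ne.symm hy.1⟩⟩

theorem DFSTrace.invariant {G : FlowGraph V} {S : DFSState V} {fin : List V}
    (h : DFSTrace G S fin) : DFSInvariant G S fin := by
  induction h with
  | init =>
    refine ⟨by simp [FlowGraph.dfsInit], by simp [FlowGraph.dfsInit],
      by simp [FlowGraph.dfsInit, G.source_mem], ?_, by simp [FlowGraph.dfsInit],
      by simp [FlowGraph.dfsInit], by simp, by simp, by simp [FlowGraph.dfsInit], ?_, ?_,
      by simp [FlowGraph.dfsInit], by simp [FlowGraph.dfsInit], ?_⟩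
    · intro x y h
      simp only [FlowGraph.dfsInit, Finset.mem_filter, Prod.mk.injEq] at h
      obtain ⟨h, rfl, rfl⟩ := h
      simp [FlowGraph.dfsInit, h]
    · intro x y h
      simp only [FlowGraph.dfsInit, Finset.mem_filter, Prod.mk.injEq] at h
      rw [h.2.1, h.2.2]
    · intro x h
      simp only [FlowGraph.dfsInit, Finset.mem_singleton] at h
      rw [h]
    · intro x y h hx hd
      simp only [FlowGraph.dfsInit, Finset.mem_singleton] at hx
      subst hx
      rcases hd with rfl | hd
      · simp [FlowGraph.dfsInit, h]
      · by_cases e : G.source = y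
        · simp only [FlowGraph.dfsInit, Finset.mem_filter]
          exact ⟨h, by rw [e]⟩
        · exact absurd ⟨e, .refl⟩ hd
  | insert u w st vis C fin _ huw hw ih =>
    set C' := C ∪ G.edges.filter (fun e => e.1 = w ∧ e.2 ∈ w :: u :: st) with hC'
    have hmC : ∀ {x y}, (x, y) ∈ C' ↔
        (x, y) ∈ C ∨ ((x, y) ∈ G.edges ∧ x = w ∧ y ∈ w :: u :: st) := by
      intro x y
      simp only [hC', Finset.mem_union, Finset.mem_filter]
    have hCC : ∀ {x y}, (x, y) ∈ C → (x, y) ∈ C' := fun h => hmC.2 (.inl h)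
    have hC0 : ∀ {x y}, (x, y) ∈ C' → x ≠ w → (x, y) ∈ C := by
      intro x y h hx
      exact (hmC.1 h).resolve_right fun h => hx h.2.1
    have hmono : ∀ {x y}, ReflTransGen (DFSState.Fwd ⟨u :: st, vis, C⟩ G) x y →
        ReflTransGen (DFSState.Fwd ⟨w :: u :: st, Insert.insert w vis, C'⟩ G) x y := by
      intro x y h
      refine ReflTransGen.mono ?_ _ _ h
      rintro p q ⟨h1, h2, h3⟩
      refine ⟨h1, fun h => h2 (hC0 h ?_), Finset.mem_insert_of_mem h3⟩
      rintro rfl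
      exact hw h3
    have huv : u ∈ vis := (ih.mem_iff u).2 (.inl (by simp))
    have hedge : DFSState.Fwd ⟨w :: u :: st, Insert.insert w vis, C'⟩ G u w := by
      refine ⟨huw, fun h => ?_, Finset.mem_insert_of_mem huv⟩
      have := hC0 h (by rintro rfl; exact hw huv)
      exact hw (ih.marked _ _ this).2.2
    have hpath : ∀ y ∈ u :: st,
        ReflTransGen (DFSState.Fwd ⟨w :: u :: st, Insert.insert w vis, C'⟩ G) y w := by
      intro y hy
      rcases List.mem_cons.1 hy with rfl | hy
      · exact .single hedge
      · exact (hmono ((List.pairwise_cons.1 ih.stack_path).1 y hy)).tail hedge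
    refine ⟨?_, ?_, ?_, ?_, ?_, ?_, ?_, ?_, ?_, ?_, ?_, ?_, ?_, ?_⟩
    · intro x
      have := ih.mem_iff x
      simp only [Finset.mem_insert, List.mem_cons] at this ⊢
      rw [this]
      tauto
    · have := ih.nodup
      simp only [List.cons_append] at this ⊢
      refine List.nodup_cons.2 ⟨fun h => hw ?_, this⟩
      rw [ih.mem_iff]
      simpa [or_assoc] using h
    · exact Finset.insert_subset (G.snd_mem huw) ih.subset
    · intro x y h
      rcases hmC.1 h with h | ⟨h1, rfl, h2⟩
      · obtain ⟨h1, h2, h3⟩ := ih.marked x y h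
        exact ⟨h1, Finset.mem_insert_of_mem h2, Finset.mem_insert_of_mem h3⟩
      · refine ⟨h1, Finset.mem_insert_self _ _, ?_⟩
        rcases List.mem_cons.1 h2 with rfl | h2
        · exact Finset.mem_insert_self _ _
        · exact Finset.mem_insert_of_mem ((ih.mem_iff y).2 (.inl h2))
    · refine List.pairwise_cons.2 ⟨fun y hy h => hmC.2 (.inr ⟨h, rfl, List.mem_cons_of_mem _ hy⟩),
        ih.stack_marked.imp fun h h' => hCC (h h')⟩
    · intro x hx h
      rcases List.mem_cons.1 hx with rfl | hx
      · exact hmC.2 (.inr ⟨h, rfl, by simp⟩)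
      · exact hCC (ih.stack_loop x hx h)
    · exact fun l₁ x l₂ e y h1 h2 => ih.sorted l₁ x l₂ e y h1 fun h => h2 (hCC h)
    · exact fun x hx y h => Finset.mem_insert_of_mem (ih.finished x hx y h)
    · exact List.pairwise_cons.2 ⟨hpath, ih.stack_path.imp fun h => hmono h⟩
    · intro x y h
      rcases hmC.1 h with h | ⟨h1, rfl, h2⟩
      · exact hmono (ih.back x y h)
      · rcases List.mem_cons.1 h2 with rfl | h2
        · exact .refl
        · exact hpath y h2
    · intro x hx
      rcases Finset.mem_insert.1 hx with rfl | hx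
      · exact (hmono (ih.reach u huv)).tail hedge
      · exact hmono (ih.reach x hx)
    · exact List.isChain_cons_cons.2 ⟨huw, ih.chain⟩
    · intro h
      rw [List.getLast_cons (List.cons_ne_nil _ _)]
      exact ih.last _
    · intro x y h hx hd
      rcases Finset.mem_insert.1 hx with rfl | hx
      · refine hmC.2 (.inr ⟨h, rfl, ?_⟩)
        -- If `y` is not on the stack, then the stack is a path to the new vertex that avoids `y`.
        -- So a vertex that separates the source from it is on the stack, and the edge gets marked.
        by_contra hy
        rcases hd with rfl | hd
        · exact hy (by simp)
        · refine hd (reach_of_stack (List.isChain_cons_cons.2 ⟨huw, ih.chain⟩) ?_ hy)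
          rw [List.getLast_cons (List.cons_ne_nil _ _)]
          exact ih.last _
      · exact hCC (ih.dominated x y h hx hd)
  | remove u st vis C fin _ hu ih =>
    have hnd := ih.nodup
    have hperm : (u :: st ++ fin).Perm (st ++ u :: fin) := by
      simpa using (List.perm_middle (l₁ := st) (a := u) (l₂ := fin)).symm
    refine ⟨?_, hperm.nodup_iff.1 hnd, ih.subset, ih.marked, (List.pairwise_cons.1 ih.stack_marked).2,
      fun x hx => ih.stack_loop x (List.mem_cons_of_mem _ hx), ?_, ?_,
      (List.pairwise_cons.1 ih.stack_path).2, ih.back, ih.reach, ih.chain.tail, ?_, ih.dominated⟩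
    · intro x
      have := ih.mem_iff x
      simp only [List.mem_cons] at this ⊢
      rw [this]
      tauto
    · intro l₁ x l₂ e y h1 h2
      cases l₁ with
      | nil =>
        simp only [List.nil_append, List.cons.injEq] at e
        obtain ⟨rfl, rfl⟩ := e
        -- All out-neighbors of the removed vertex are visited. Edges to those on the stack are
        -- marked, so an unmarked edge leads to a vertex removed before.
        rcases (ih.mem_iff y).1 (hu y h1) with h | h
        · rcases List.mem_cons.1 h with rfl | h
          · exact absurd (ih.stack_loop y (by simp) h1) h2
          · exact absurd ((List.pairwise_cons.1 ih.stack_marked).1 y h h1) h2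
        · exact h
      | cons z l₁ =>
        simp only [List.cons_append, List.cons.injEq] at e
        exact ih.sorted l₁ x l₂ e.2 y h1 h2
    · intro x hx y h
      rcases List.mem_cons.1 hx with rfl | hx
      · exact hu y h
      · exact ih.finished x hx y h
    · intro h
      have := ih.last (List.cons_ne_nil _ _)
      rwa [List.getLast_cons h] at this

/-- What is known about the cycle edges of a complete depth-first search. -/
structure FlowGraph.CycleEdgeProps (G : FlowGraph V) (C : Finset (V × V)) : Prop where
  sub : C ⊆ G.edges
  back : ∀ {x y}, (x, y) ∈ C →
    ReflTransGen (MarkedGraph.mk G.toFinDigraph C).Fwd y x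
  reach : ∀ v ∈ G.verts, ReflTransGen (MarkedGraph.mk G.toFinDigraph C).Fwd G.source v
  dominated : ∀ x y, (x, y) ∈ G.edges → G.Separates y G.source x → (x, y) ∈ C

/-- The reverse order of removal is a topological sorting: by `sorted` an unmarked edge leads from a
vertex to one removed earlier, which stands later in `fin`. -/
theorem DFSTrace.final {G : FlowGraph V} {vis : Finset V} {C : Finset (V × V)} {fin : List V}
    (h : DFSTrace G ⟨[], vis, C⟩ fin) :
    G.CycleEdgeProps C ∧ G.IsTopSort C fin ∧ vis = G.verts := by
  have hi := h.invariant
  have hvis : vis = G.verts := by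
    refine hi.subset.antisymm fun v hv => ?_
    have hmem : ∀ x, x ∈ vis ↔ x ∈ fin := fun x => by simpa using hi.mem_iff x
    have := G.reach v hv
    induction this with
    | refl =>
      rw [hmem]
      have : ∀ {S fin}, DFSTrace G S fin → G.source ∈ S.visited := by
        intro S fin h
        induction h with
        | init => simp [FlowGraph.dfsInit]
        | insert u w st vis C fin _ _ _ ih => exact Finset.mem_insert_of_mem ih
        | remove u st vis C fin _ _ ih => exact ih
      exact (hmem _).1 (this h)
    | @tail p q _ hpq ih =>
      exact hi.finished p ((hmem p).1 (ih (G.fst_mem hpq))) q hpq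
  have hmono : ∀ {x y}, ReflTransGen (DFSState.Fwd ⟨[], vis, C⟩ G) x y →
      ReflTransGen (MarkedGraph.mk G.toFinDigraph C).Fwd x y := fun h =>
    ReflTransGen.mono (fun p q h => ⟨h.1, h.2.1⟩) _ _ h
  refine ⟨⟨?_, fun h => hmono (hi.back _ _ h), fun v hv => hmono (hi.reach v (hvis ▸ hv)),
    fun x y h hd => hi.dominated x y h (hvis ▸ G.fst_mem h) (.inr hd)⟩, ⟨?_, ?_, ?_⟩, hvis⟩
  · rintro ⟨x, y⟩ h
    exact (hi.marked x y h).1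
  · simpa using hi.nodup
  · ext x
    have := hi.mem_iff x
    simp only [List.not_mem_nil, false_or] at this
    rw [List.mem_toFinset, ← this, hvis]
  · intro i j hi' hj h1 h2
    have hnd : fin.Nodup := by simpa using hi.nodup
    have e : fin = fin.take i ++ fin[i] :: fin.drop (i + 1) := by
      rw [List.getElem_cons_drop, List.take_append_drop]
    have := hi.sorted _ _ _ e _ h1 h2
    obtain ⟨k, hk, hk'⟩ := List.mem_iff_getElem.1 this
    rw [List.getElem_drop] at hk'
    have := (hnd.getElem_inj_iff).1 hk'
    omega

theorem FlowGraph.IsDFSCycleEdges.props {G : FlowGraph V} {C : Finset (V × V)}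
    (h : G.IsDFSCycleEdges C) : G.CycleEdgeProps C ∧ ∃ ord, G.IsTopSort C ord := by
  obtain ⟨vis, h⟩ := h
  obtain ⟨fin, h⟩ := exists_dfsTrace h
  exact ⟨h.final.1, fin, h.final.2.1⟩

/-- Termination: an insertion uses up an unvisited vertex, which counts twice, and adds one stack
entry; a removal deletes one stack entry. -/
theorem DFSTrace.complete {G : FlowGraph V} {st : List V} {vis : Finset V} {C : Finset (V × V)}
    {fin : List V} (h : DFSTrace G ⟨st, vis, C⟩ fin) :
    ∃ vis C fin', DFSTrace G ⟨[], vis, C⟩ fin' :=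
  match st, h with
  | [], h => ⟨vis, C, fin, h⟩
  | u :: st, h => by
    by_cases hw : ∀ w, (u, w) ∈ G.edges → w ∈ vis
    · exact (DFSTrace.remove u st vis C fin h hw).complete
    · push Not at hw
      obtain ⟨w, huw, hw⟩ := hw
      exact (DFSTrace.insert u w st vis C fin h huw hw).complete
termination_by 2 * (G.verts \ vis).card + st.length
decreasing_by
  · simp only [List.length_cons]
    omega
  · have : (G.verts \ Insert.insert w vis).card < (G.verts \ vis).card := by
      refine Finset.card_lt_card ⟨Finset.sdiff_subset_sdiff le_rfl (Finset.subset_insert _ _), ?_⟩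
      intro hsub
      have := hsub (Finset.mem_sdiff.2 ⟨G.snd_mem huw, hw⟩)
      simp at this
    simp only [List.length_cons]
    omega

theorem FlowGraph.exists_dfs (G : FlowGraph V) : ∃ C, G.IsDFSCycleEdges C := by
  obtain ⟨vis, C, fin, h⟩ := (DFSTrace.init (G := G)).complete
  exact ⟨C, vis, h.reflTransGen⟩

theorem FlowGraph.CycleEdgeProps.ordered {G : FlowGraph V} {C : Finset (V × V)}
    (h : G.CycleEdgeProps C) {ord : List V} (ho : G.IsTopSort C ord) :
    (MarkedGraph.mk G.toFinDigraph C).Ordered G.source (fun x => ord.idxOf x) where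
  sub := h.sub
  src := G.source_mem
  inc := by
    rintro x y ⟨h1, h2⟩
    have hx : x ∈ ord := by
      rw [← List.mem_toFinset, ho.2.1]; exact G.fst_mem h1
    have hy : y ∈ ord := by
      rw [← List.mem_toFinset, ho.2.1]; exact G.snd_mem h1
    refine ho.2.2 _ _ (List.idxOf_lt_length_of_mem hx) (List.idxOf_lt_length_of_mem hy) ?_ ?_
    · rwa [List.getElem_idxOf, List.getElem_idxOf]
    · rwa [List.getElem_idxOf, List.getElem_idxOf]
  back := h.back
  reach := h.reach

end DepthFirstSearch

/-! ### Correctness of the recognition algorithm -/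

section Correctness

open Relation

variable {V : Type*} [DecidableEq V]

/-- One inclusion: edges into a separating vertex are marked by every search. The other: if `C` had
an edge `xy` outside `C'`, it would increase the position for `C'`, whereas the path from `y` to `x`
without edges of `C`, hence without edges of `C'`, says that the position of `y` is at most that of
`x`. -/
theorem FlowGraph.CycleEdgeProps.eq_of_reduces {G : FlowGraph V} {C C' : Finset (V × V)}
    (h : G.CycleEdgeProps C) {ws : List V} {pos : V → ℕ}
    (hr : (MarkedGraph.mk G.toFinDigraph C').Reduces ws)
    (hG : (MarkedGraph.mk G.toFinDigraph C').Ordered G.source pos) : C' = C := by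
  have hsub : C' ⊆ C := by
    rintro ⟨x, y⟩ hxy
    exact h.dominated x y (hG.sub hxy) (hr.separates hG hxy)
  refine hsub.antisymm ?_
  rintro ⟨x, y⟩ hxy
  by_contra hc
  have h1 := hG.inc ⟨h.sub hxy, hc⟩
  have h2 := hG.pos_le (ReflTransGen.mono (fun p q h => ⟨h.1, fun h' => h.2 (hsub h')⟩) _ _
    (h.back hxy))
  omega

theorem reach_avoiding_of_chain {E : V → V → Prop} {y w : V} {l : List V} (h : (w :: l).IsChain E)
    (hy : y ∉ w :: l) : ReflTransGen (fun a b => E a b ∧ a ≠ y ∧ b ≠ y) w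
      ((w :: l).getLast (List.cons_ne_nil _ _)) := by
  induction l generalizing w with
  | nil => exact .refl
  | cons z l ih =>
    rw [List.isChain_cons_cons] at h
    simp only [List.mem_cons, not_or] at hy
    rw [List.getLast_cons (List.cons_ne_nil _ _)]
    exact (ih h.2 (by simp [hy.2.1, hy.2.2])).head ⟨h.1, Ne.symm hy.1, Ne.symm hy.2.1⟩

namespace MarkedGraph

variable {G : MarkedGraph V} {ws : List V} {s₀ : V} {pos : V → ℕ}

/-- A path from the source to `w` that avoids `y` can be continued along the cycle to the tail of
the marked edge that enters `y`, still avoiding `y`; this contradicts `Reduces.separates`. -/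
theorem Reduces.separates_of_cycle (hr : G.Reduces ws) (hG : G.Ordered s₀ pos) {y : V} {m : List V}
    (hc : (y :: m).IsChain fun a b => (a, b) ∈ G.edges) (hnd : (y :: m).Nodup)
    (hxy : ((y :: m).getLast (List.cons_ne_nil _ _), y) ∈ G.cycleEdges) {w : V} (hw : w ∈ y :: m)
    (hwy : w ≠ y) : G.Separates y s₀ w := by
  have hwm := (List.mem_cons.1 hw).resolve_left hwy
  obtain ⟨m₁, m₂, rfl⟩ := List.append_of_mem hwm
  rintro ⟨h1, h2⟩
  refine hr.separates hG hxy ⟨h1, h2.trans ?_⟩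
  have hc' : (w :: m₂).IsChain fun a b => (a, b) ∈ G.edges :=
    (List.isChain_append.1 (show ((y :: m₁) ++ w :: m₂).IsChain _ from hc)).2.1
  have hy : y ∉ w :: m₂ := fun h => (List.nodup_cons.1 hnd).1 (List.mem_append_right _ h)
  have := reach_avoiding_of_chain hc' hy
  have e : (y :: (m₁ ++ w :: m₂)).getLast (List.cons_ne_nil _ _) =
      (w :: m₂).getLast (List.cons_ne_nil _ _) := by
    rw [List.getLast_cons (by simp), List.getLast_append_of_ne_nil _ (List.cons_ne_nil _ _)]
  rw [e]
  exact this

/-- Unmarked edges increase the position. So either an edge of the path is marked, or the closing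
edge of the cycle does not increase the position and is itself marked. -/
theorem exists_marked_of_chain {l : List V} (hG : G.Ordered s₀ pos)
    (hc : l.IsChain fun a b => (a, b) ∈ G.edges) (hne : l ≠ []) :
    pos (l.head hne) ≤ pos (l.getLast hne) ∨
      ∃ l₁ x y l₂, l = l₁ ++ x :: y :: l₂ ∧ (x, y) ∈ G.cycleEdges := by
  induction l with
  | nil => exact absurd rfl hne
  | cons z l ih =>
    cases l with
    | nil => simp
    | cons z' l =>
      rw [List.isChain_cons_cons] at hc
      by_cases h : (z, z') ∈ G.cycleEdges
      · exact .inr ⟨[], z, z', l, rfl, h⟩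
      · have h1 := hG.inc ⟨hc.1, h⟩
        rcases ih hc.2 (List.cons_ne_nil _ _) with h2 | ⟨l₁, x, y, l₂, e, h2⟩
        · left
          rw [List.getLast_cons (List.cons_ne_nil _ _)]
          simp only [List.head_cons] at h2 ⊢
          omega
        · exact .inr ⟨z :: l₁, x, y, l₂, by rw [e]; rfl, h2⟩

theorem Reduces.exists_separator (hr : G.Reduces ws) (hG : G.Ordered s₀ pos) {l : List V}
    (hl : G.IsCycle l) : ∃ v ∈ l, ∀ w ∈ l, w ≠ v → G.Separates v s₀ w := by
  obtain ⟨hnd, hc, hne, hlast⟩ := hl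
  rcases exists_marked_of_chain hG hc hne with h | ⟨l₁, x, y, l₂, rfl, hxy⟩
  · have hm := hG.marked_of_le hlast h
    obtain ⟨y, m, rfl⟩ := List.exists_cons_of_ne_nil hne
    exact ⟨y, by simp, fun w hw hwy => hr.separates_of_cycle hG hc hnd hm hw hwy⟩
  -- The cycle is rotated so that it starts at the head of the marked edge and ends at its tail.
  · have hperm : (l₁ ++ x :: y :: l₂).Perm ((y :: l₂) ++ (l₁ ++ [x])) := by
      have : l₁ ++ x :: y :: l₂ = (l₁ ++ [x]) ++ (y :: l₂) := by simp
      rw [this]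
      exact List.perm_append_comm
    have hc1 : ((l₁ ++ [x]) ++ (y :: l₂)).IsChain fun a b => (a, b) ∈ G.edges := by
      simpa using hc
    rw [List.isChain_append] at hc1
    have hc2 : ((y :: l₂) ++ (l₁ ++ [x])).IsChain fun a b => (a, b) ∈ G.edges := by
      rw [List.isChain_append]
      refine ⟨hc1.2.1, hc1.1, ?_⟩
      intro p hp q hq
      have e1 : (l₁ ++ x :: y :: l₂).getLast hne = p := by
        rw [List.getLast_append_of_ne_nil _ (List.cons_ne_nil _ _),
          List.getLast_cons (List.cons_ne_nil _ _)]
        rw [List.getLast?_eq_some_getLast (List.cons_ne_nil _ _)] at hp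
        simpa using hp
      have e2 : (l₁ ++ x :: y :: l₂).head hne = q := by
        cases l₁ with
        | nil => simpa using hq
        | cons z l₁ => simpa using hq
      rwa [e1, e2] at hlast
    refine ⟨y, by simp, fun w hw hwy => hr.separates_of_cycle hG hc2 (hperm.nodup_iff.1 hnd) ?_
      (hperm.mem_iff.1 hw) hwy⟩
    have e : (y :: (l₂ ++ (l₁ ++ [x]))).getLast (List.cons_ne_nil _ _) = x := by
      rw [List.getLast_cons (by simp), List.getLast_append_of_ne_nil _ (by simp)]
      simp
    show ((y :: (l₂ ++ (l₁ ++ [x]))).getLast (List.cons_ne_nil _ _), y) ∈ G.cycleEdges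
    rwa [e]

end MarkedGraph

theorem FlowGraph.IsDijkstra.reducible {G : FlowGraph V} (h : G.IsDijkstra) : G.Reducible := by
  obtain ⟨C, ws, pos, hr, hG⟩ := h.exists_reduces
  exact fun l hl => hr.exists_separator hG hl

/-- The answer NO of step 1 rests on the edge count for contraction sequences. For the loop, the
sequence given by the Dijkstra structure applies to the marks of the search, because the two
markings agree; conversely the trace of a run that says YES is a contraction sequence. -/
theorem RecognitionRun.correct {G : FlowGraph V} {ord tr : List V} {b : Bool}
    (h : RecognitionRun G ord tr b) : b = true ↔ G.IsDijkstra := by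
  cases h with
  | tooManyEdges h =>
    refine ⟨by simp, fun hD => ?_⟩
    obtain ⟨C, ws, pos, hr, hG⟩ := hD.exists_reduces
    have h2 : G.edges.card + 2 ≤ 2 * G.verts.card := hr.card_edges_le
    omega
  | greedy C ord tr b hm hC ho hg =>
    have hprops := hC.props.1
    have hG := hprops.ordered ho
    constructor
    · intro hb
      have := (MarkedGraph.reduces_of_greedy hg hb (List.nodup_reverse.2 ho.1) ?_).1
      · exact this.isDijkstra hG
      -- For `n = 1` step 1 already rejects a loop, as then `m ≥ 1 = 2n - 1`.
      · intro hcard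
        have h1 : G.verts.card = 1 := hcard
        exact Finset.card_eq_zero.1 (show G.edges.card = 0 by omega)
    · intro hD
      obtain ⟨C', ws, pos, hr, hG'⟩ := hD.exists_reduces
      obtain rfl := hprops.eq_of_reduces hr hG'
      have hmem : ∀ x, x ∈ G.verts → x ∈ ord := fun x hx => by
        rwa [← List.mem_toFinset, ho.2.1]
      refine hr.greedy hg hG ?_ ?_ ?_
      · intro x hx y hy e
        exact (List.idxOf_inj (hmem x hx)).1 e
      · rw [List.pairwise_reverse, List.pairwise_iff_getElem]
        intro i j hi hj hij
        rwa [ho.1.idxOf_getElem, ho.1.idxOf_getElem]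
      · intro w hw
        rw [List.mem_reverse]
        exact hmem w (hr.subset w hw)

theorem recognition_correct (G : FlowGraph V) :
    (∃ C, G.IsDFSCycleEdges C) ∧
    (∀ C, G.IsDFSCycleEdges C → ∃ ord, G.IsTopSort C ord) ∧
    (∀ C ord, G.IsDFSCycleEdges C → G.IsTopSort C ord →
      ∃ tr b, GreedyRun ord.reverse ⟨G.toFinDigraph, C⟩ tr b) ∧
    (∀ ord tr b, RecognitionRun G ord tr b → (b = true ↔ G.IsDijkstra)) ∧
    (¬ G.Reducible → ∀ ord tr b, RecognitionRun G ord tr b → b = false) := by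
  refine ⟨G.exists_dfs, fun C hC => hC.props.2, fun C ord _ _ => MarkedGraph.exists_greedy _ _,
    fun ord tr b h => h.correct, fun hG ord tr b h => ?_⟩
  rw [← Bool.not_eq_true]
  exact fun hb => hG (h.correct.1 hb).reducible

end Correctness

/-! ### Running programs -/

section Running

/-- Started in `σ`, the program `p` halts after `t` steps in a store `σ'` such that `Q t σ'`. -/
def Prog.Halts (p : Prog) (σ : Store) (Q : ℕ → Store → Prop) : Prop :=
  ∃ t σ', Exec p σ t σ' ∧ Q t σ'

namespace Prog

variable {x y a k : ℕ} {p q : Prog} {σ : Store} {Q Q' : ℕ → Store → Prop}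

theorem Halts.mono (h : p.Halts σ Q) (hQ : ∀ t σ', Q t σ' → Q' t σ') : p.Halts σ Q' := by
  obtain ⟨t, σ', h1, h2⟩ := h
  exact ⟨t, σ', h1, hQ t σ' h2⟩

/-- This and the next rules compute weakest preconditions, including the time, so that loop-free
programs are executed symbolically by rewriting. -/
theorem halts_const : (const x k).Halts σ Q ↔ Q 1 (σ.setReg x k) := by
  constructor
  · rintro ⟨_, _, ⟨⟩, h⟩; exact h
  · exact fun h => ⟨_, _, .const x k σ, h⟩

theorem halts_copy : (copy x y).Halts σ Q ↔ Q 1 (σ.setReg x (σ.reg y)) := by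
  constructor
  · rintro ⟨_, _, ⟨⟩, h⟩; exact h
  · exact fun h => ⟨_, _, .copy x y σ, h⟩

theorem halts_incr : (incr x).Halts σ Q ↔ Q 1 (σ.setReg x (σ.reg x + 1)) := by
  constructor
  · rintro ⟨_, _, ⟨⟩, h⟩; exact h
  · exact fun h => ⟨_, _, .incr x σ, h⟩

theorem halts_decr : (decr x).Halts σ Q ↔ Q 1 (σ.setReg x (σ.reg x - 1)) := by
  constructor
  · rintro ⟨_, _, ⟨⟩, h⟩; exact h
  · exact fun h => ⟨_, _, .decr x σ, h⟩

theorem halts_load : (load x a y).Halts σ Q ↔ Q 1 (σ.setReg x (σ.arr a (σ.reg y))) := by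
  constructor
  · rintro ⟨_, _, ⟨⟩, h⟩; exact h
  · exact fun h => ⟨_, _, .load x a y σ, h⟩

theorem halts_store : (store a y x).Halts σ Q ↔ Q 1 (σ.setArr a (σ.reg y) (σ.reg x)) := by
  constructor
  · rintro ⟨_, _, ⟨⟩, h⟩; exact h
  · exact fun h => ⟨_, _, .store a y x σ, h⟩

theorem halts_seq : (seq p q).Halts σ Q ↔
    p.Halts σ fun t₁ σ₁ => q.Halts σ₁ fun t₂ σ₂ => Q (t₁ + t₂) σ₂ := by
  constructor
  · rintro ⟨_, _, h, hQ⟩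
    cases h with
    | seq _ _ _ σ₁ _ t₁ t₂ h1 h2 => exact ⟨t₁, σ₁, h1, t₂, _, h2, hQ⟩
  · rintro ⟨t₁, σ₁, h1, t₂, σ₂, h2, hQ⟩
    exact ⟨_, _, .seq p q σ σ₁ σ₂ t₁ t₂ h1 h2, hQ⟩

theorem halts_ifLt : (ifLt x y p q).Halts σ Q ↔
    if σ.reg x < σ.reg y then p.Halts σ fun t σ' => Q (t + 1) σ'
    else q.Halts σ fun t σ' => Q (t + 1) σ' := by
  split_ifs with hc
  · constructor
    · rintro ⟨_, _, h, hQ⟩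
      cases h with
      | ifLt_true _ _ _ _ _ _ t _ h => exact ⟨t, _, h, hQ⟩
      | ifLt_false _ _ _ _ _ _ t h => contradiction
    · rintro ⟨t, σ', h, hQ⟩
      exact ⟨_, _, .ifLt_true x y p q σ σ' t hc h, hQ⟩
  · constructor
    · rintro ⟨_, _, h, hQ⟩
      cases h with
      | ifLt_true _ _ _ _ _ _ t h => contradiction
      | ifLt_false _ _ _ _ _ _ t _ h => exact ⟨t, _, h, hQ⟩
    · rintro ⟨t, σ', h, hQ⟩
      exact ⟨_, _, .ifLt_false x y p q σ σ' t hc h, hQ⟩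

/-- The rule for loops: `I φ σ` is an invariant with a potential `φ` that pays for the steps. -/
theorem halts_whileLt (I : ℕ → Store → Prop)
    (hstep : ∀ φ σ, I φ σ → σ.reg x < σ.reg y →
      p.Halts σ fun t σ' => ∃ φ', I φ' σ' ∧ t + 1 + φ' ≤ φ) {φ : ℕ} (h : I φ σ) :
    (whileLt x y p).Halts σ fun t σ' =>
      ∃ φ', I φ' σ' ∧ ¬ σ'.reg x < σ'.reg y ∧ t + φ' ≤ φ + 1 := by
  induction φ using Nat.strong_induction_on generalizing σ with
  | _ φ ih =>
    by_cases hc : σ.reg x < σ.reg y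
    · obtain ⟨t₁, σ₁, h1, φ₁, hI, hle⟩ := hstep φ σ h hc
      obtain ⟨t₂, σ₂, h2, φ₂, hI2, hc2, hle2⟩ := ih φ₁ (by omega) hI
      exact ⟨_, _, .whileLt_true x y p σ σ₁ σ₂ t₁ t₂ hc h1 h2, φ₂, hI2, hc2, by omega⟩
    · exact ⟨1, σ, .whileLt_false x y p σ hc, φ, h, hc, by omega⟩

end Prog

namespace Store

variable (σ : Store) (x y k a b i : ℕ)

theorem reg_setReg : (σ.setReg x k).reg y = if y = x then k else σ.reg y := by
  simp [setReg, Function.update_apply]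

theorem arr_setReg : (σ.setReg x k).arr = σ.arr := rfl

theorem reg_setArr : (σ.setArr a i k).reg = σ.reg := rfl

theorem arr_setArr : (σ.setArr a i k).arr b =
    if b = a then Function.update (σ.arr a) i k else σ.arr b := by
  simp only [setArr, Function.update_apply]

end Store

/-- The out-neighbors of the vertices `u` of `G` are listed without repetition in the cells of `adj`
from `lo u` to `hi u`. -/
structure FinDigraph.Adjacency (G : FinDigraph ℕ) (lo hi adj : ℕ → ℕ) : Prop where
  iff : ∀ u ∈ G.verts, ∀ w, (u, w) ∈ G.edges ↔ ∃ i, lo u ≤ i ∧ i < hi u ∧ adj i = w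
  inj : ∀ u ∈ G.verts, ∀ i j, lo u ≤ i → i < hi u → lo u ≤ j → j < hi u → adj i = adj j → i = j

end Running

/-! ### Depth-first search on the machine -/

section Search

open Function

/-- What the memory holds during a depth-first search: the finished vertices (`done`, from index
`free`), the status of the vertices (`status`: 0 for new, 1 for on the stack, 2 for finished), the
stack (`stack`, of size `size`), the next adjacency cells (`next`), the numbers of scanned edges
that enter a vertex (`deg`, one more for the source) and of the cycle edges among them (`cyc`), and
the number of edges that may still be scanned (`budget`). `X` is the set of the scanned edges. -/
structure SearchState (G : FlowGraph ℕ) (lo hi adj : ℕ → ℕ) (st fin : List ℕ) (vis : Finset ℕ)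
    (C X : Finset (ℕ × ℕ)) (done status stack next deg cyc : ℕ → ℕ) (budget size free : ℕ) :
    Prop where
  trace : DFSTrace G ⟨st, vis, C⟩ fin
  size_eq : size = st.length
  free_add : free + fin.length = G.verts.card
  stack_eq : ∀ (i : ℕ) (h : i < st.reverse.length), stack i = st.reverse[i]
  done_eq : ∀ (i : ℕ) (h : i < fin.length), done (free + i) = fin[i]
  status_eq : ∀ w, status w = if w ∈ st then 1 else if w ∈ fin then 2 else 0
  lo_le : ∀ u ∈ vis, lo u ≤ next u
  next_le : ∀ u ∈ vis, next u ≤ hi u ∨ next u = lo u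
  scanned : ∀ x y, (x, y) ∈ X ↔ x ∈ vis ∧ ∃ i, lo x ≤ i ∧ i < next x ∧ adj i = y
  scanned_vis : ∀ x y, (x, y) ∈ X → y ∈ vis
  complete : ∀ u ∈ fin, hi u ≤ next u
  deg_eq : ∀ w, deg w = (X.filter fun e => e.2 = w).card + if w = G.source then 1 else 0
  cyc_eq : ∀ w, cyc w = ((X ∩ C).filter fun e => e.2 = w).card
  budget_add : budget + X.card + 1 = 2 * G.verts.card
  budget_pos : 0 < budget

theorem Finset.card_filter_insert_snd {X : Finset (ℕ × ℕ)} {u w : ℕ} (h : (u, w) ∉ X) (z : ℕ) :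
    ((insert (u, w) X).filter fun e => e.2 = z).card =
      update (fun z => (X.filter fun e => e.2 = z).card) w
        ((X.filter fun e => e.2 = w).card + 1) z := by
  rw [Finset.filter_insert]
  by_cases hz : z = w
  · subst hz
    rw [if_pos rfl, update_self, Finset.card_insert_of_notMem (by simp [h])]
  · rw [if_neg (Ne.symm hz), update_of_ne hz]

namespace SearchState

variable {G : FlowGraph ℕ} {lo hi adj : ℕ → ℕ} {st fin : List ℕ} {vis : Finset ℕ}
  {C X : Finset (ℕ × ℕ)} {done status stack next deg cyc : ℕ → ℕ} {budget size free u w : ℕ}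

theorem scanned_subset (hA : G.Adjacency lo hi adj)
    (h : SearchState G lo hi adj st fin vis C X done status stack next deg cyc budget size free) :
    X ⊆ G.edges := by
  rintro ⟨x, y⟩ hxy
  obtain ⟨hx, i, h1, h2, h3⟩ := (h.scanned x y).1 hxy
  refine (hA.iff x (h.trace.invariant.subset hx) y).2 ⟨i, h1, ?_, h3⟩
  rcases h.next_le x hx with h4 | h4 <;> omega

theorem top_mem (h : SearchState G lo hi adj (u :: st) fin vis C X done status stack next deg cyc
    budget size free) : u ∈ vis := (h.trace.invariant.mem_iff u).2 (.inl (by simp))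

theorem top_eq (h : SearchState G lo hi adj (u :: st) fin vis C X done status stack next deg cyc
    budget size free) : stack (size - 1) = u := by
  have := h.stack_eq (size - 1) (by rw [h.size_eq]; simp)
  rw [this]
  simp [h.size_eq]

theorem next_edge (hA : G.Adjacency lo hi adj)
    (h : SearchState G lo hi adj (u :: st) fin vis C X done status stack next deg cyc budget size
      free) (hlt : next u < hi u) : (u, adj (next u)) ∈ G.edges ∧ (u, adj (next u)) ∉ X := by
  have hu := h.top_mem
  have huG := h.trace.invariant.subset hu
  refine ⟨(hA.iff u huG _).2 ⟨_, h.lo_le u hu, hlt, rfl⟩, fun hX => ?_⟩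
  obtain ⟨-, i, h1, h2, h3⟩ := (h.scanned _ _).1 hX
  have := hA.inj u huG i (next u) h1 (by omega) (h.lo_le u hu) hlt h3
  omega

/-- The edge about to be scanned is new; together with the scanned ones it makes `2n - 1` edges,
which is the bound of step 1. -/
theorem exhausted (hA : G.Adjacency lo hi adj)
    (h : SearchState G lo hi adj (u :: st) fin vis C X done status stack next deg cyc budget size
      free) (hlt : next u < hi u) (hb : budget - 1 = 0) :
    2 * G.verts.card ≤ G.edges.card + 1 := by
  obtain ⟨h1, h2⟩ := h.next_edge hA hlt
  have := Finset.card_le_card (Finset.insert_subset h1 (h.scanned_subset hA))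
  rw [Finset.card_insert_of_notMem h2] at this
  have := h.budget_add
  have := h.budget_pos
  omega

/-- The abstract search marks all cycle edges of a vertex at its insertion, the machine discovers
them later, one by one. Both agree since `u` is on top: what is on the stack now was there when `u`
was inserted. -/
theorem scan (hA : G.Adjacency lo hi adj)
    (h : SearchState G lo hi adj (u :: st) fin vis C X done status stack next deg cyc budget size
      free) (hlt : next u < hi u) (hb : 0 < budget - 1) (hw : 0 < status (adj (next u))) :
    SearchState G lo hi adj (u :: st) fin vis C (insert (u, adj (next u)) X) done status stack
      (update next u (next u + 1)) (update deg (adj (next u)) (deg (adj (next u)) + 1))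
      (if status (adj (next u)) < 2 then update cyc (adj (next u)) (cyc (adj (next u)) + 1)
        else cyc) (budget - 1) size free := by
  obtain ⟨hE, hX⟩ := h.next_edge hA hlt
  have hi := h.trace.invariant
  have hu := h.top_mem
  set w := adj (next u) with hwdef
  have hwv : w ∈ vis := by
    rw [hi.mem_iff]
    by_contra hn
    rw [not_or] at hn
    rw [h.status_eq, if_neg hn.1, if_neg hn.2] at hw
    omega
  refine ⟨h.trace, h.size_eq, h.free_add, h.stack_eq, h.done_eq, h.status_eq, ?_, ?_, ?_, ?_, ?_,
    ?_, ?_, ?_, hb⟩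
  · intro z hz
    by_cases e : z = u
    · subst e; rw [update_self]; have := h.lo_le z hz; omega
    · rw [update_of_ne e]; exact h.lo_le z hz
  · intro z hz
    by_cases e : z = u
    · subst e; rw [update_self]; omega
    · rw [update_of_ne e]; exact h.next_le z hz
  · intro x y
    rw [Finset.mem_insert, h.scanned]
    by_cases e : x = u
    · subst e
      rw [update_self]
      constructor
      · rintro (e | ⟨h1, i, h2, h3, h4⟩)
        · exact ⟨hu, next x, h.lo_le x hu, by omega, (Prod.mk.inj e).2.symm⟩
        · exact ⟨h1, i, h2, by omega, h4⟩
      · rintro ⟨h1, i, h2, h3, h4⟩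
        by_cases e : i = next x
        · left; rw [← h4, e]
        · exact .inr ⟨h1, i, h2, by omega, h4⟩
    · rw [update_of_ne e]
      constructor
      · rintro (e' | h')
        · exact absurd (Prod.mk.inj e').1 e
        · exact h'
      · exact .inr
  · intro x y hxy
    rcases Finset.mem_insert.1 hxy with e | h'
    · rw [(Prod.mk.inj e).2]; exact hwv
    · exact h.scanned_vis x y h'
  · intro z hz
    by_cases e : z = u
    · subst e
      have := List.nodup_append.1 hi.nodup
      exact absurd rfl (this.2.2 z (by simp) z hz)
    · rw [update_of_ne e]; exact h.complete z hz
  · intro z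
    rw [Finset.card_filter_insert_snd hX]
    by_cases e : z = w
    · subst e
      rw [update_self, update_self, h.deg_eq]
      omega
    · rw [update_of_ne e, update_of_ne e, h.deg_eq]
  · intro z
    -- A marked edge into a finished vertex `w` would give an unmarked path from `w` to `u`.
    -- Unmarked edges from finished vertices lead to finished vertices only, but `u` is still on the
    -- stack.
    have hC : (u, w) ∈ C ↔ w ∈ u :: st := by
      constructor
      · intro hC
        by_contra hn
        have hfin : w ∈ fin := ((hi.mem_iff w).1 hwv).resolve_left hn
        have huf : ∀ y, Relation.ReflTransGen (DFSState.Fwd ⟨u :: st, vis, C⟩ G) w y → y ∈ fin := by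
          intro y hy
          induction hy with
          | refl => exact hfin
          | tail _ hpq ih =>
            obtain ⟨l₁, l₂, e⟩ := List.append_of_mem ih
            rw [e]
            exact List.mem_append_right _ (List.mem_cons_of_mem _
              (hi.sorted l₁ _ l₂ e _ hpq.1 hpq.2.1))
        have := List.nodup_append.1 hi.nodup
        exact absurd rfl (this.2.2 u (by simp) u (huf u (hi.back _ _ hC)))
      · intro hm
        rcases List.mem_cons.1 hm with e | hm
        · have h1 := hi.stack_loop u (by simp)
          have hE' := hE
          rw [e] at hE' ⊢
          exact h1 hE'
        · exact (List.pairwise_cons.1 hi.stack_marked).1 _ hm hE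
    by_cases hm : w ∈ u :: st
    · have hs : status w < 2 := by rw [h.status_eq, if_pos hm]; omega
      rw [if_pos hs, Finset.insert_inter_of_mem (hC.2 hm),
        Finset.card_filter_insert_snd (fun h => hX (Finset.mem_inter.1 h).1)]
      by_cases e : z = w
      · subst e
        rw [update_self, update_self, h.cyc_eq]
      · rw [update_of_ne e, update_of_ne e, h.cyc_eq]
    · have hs : ¬ status w < 2 := by
        have hfin : w ∈ fin := ((hi.mem_iff w).1 hwv).resolve_left hm
        rw [h.status_eq, if_neg hm, if_pos hfin]; omega
      rw [if_neg hs, Finset.insert_inter_of_notMem (fun h' => hm (hC.1 h')), h.cyc_eq]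
  · rw [Finset.card_insert_of_notMem hX]
    have := h.budget_add
    omega

/-- The counters of cycle edges stay: the scanned edge enters an unvisited vertex and is not marked,
and the edges that get marked now leave the new vertex and are not yet scanned. -/
theorem insert (hA : G.Adjacency lo hi adj)
    (h : SearchState G lo hi adj (u :: st) fin vis C X done status stack next deg cyc budget size
      free) (hlt : next u < hi u) (hb : 0 < budget - 1) (hw : ¬ 0 < status (adj (next u))) :
    ∃ vis' C' X', SearchState G lo hi adj (adj (next u) :: u :: st) fin vis' C' X' done
      (update status (adj (next u)) 1) (update stack size (adj (next u)))
      (update (update next u (next u + 1)) (adj (next u)) (lo (adj (next u))))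
      (update deg (adj (next u)) (deg (adj (next u)) + 1)) cyc (budget - 1) (size + 1) free := by
  obtain ⟨hE, hX⟩ := h.next_edge hA hlt
  have hi := h.trace.invariant
  have hu := h.top_mem
  set w := adj (next u) with hwdef
  have hwv : w ∉ vis := by
    rw [hi.mem_iff, not_or]
    constructor
    · intro hn
      rw [h.status_eq, if_pos hn] at hw
      omega
    · intro hn
      rw [h.status_eq] at hw
      split_ifs at hw <;> omega
  have huw : u ≠ w := by rintro e; exact hwv (e ▸ hu)
  have hvw : ∀ {z}, z ∈ vis → z ≠ w := by rintro z hz rfl; exact hwv hz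
  refine ⟨_, _, Insert.insert (u, w) X, .insert u w st vis C fin h.trace hE hwv, ?_, h.free_add,
    ?_, h.done_eq, ?_, ?_, ?_, ?_, ?_, ?_, ?_, ?_, ?_, hb⟩
  · simp [h.size_eq]
  · intro i hi'
    have hlen : (u :: st).reverse.length = size := by rw [List.length_reverse, h.size_eq]
    have e : (w :: u :: st).reverse = (u :: st).reverse ++ [w] := List.reverse_cons
    simp only [e, List.length_append, List.length_singleton] at hi' ⊢
    by_cases h1 : i < (u :: st).reverse.length
    · rw [List.getElem_append_left h1, update_of_ne (by omega), h.stack_eq i h1]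
    · have : i = size := by omega
      subst this
      rw [update_self, List.getElem_append_right (by omega)]
      simp
  · intro z
    by_cases e : z = w
    · subst e
      rw [update_self, if_pos (by simp)]
    · rw [update_of_ne e, h.status_eq]
      simp [e]
  · intro z hz
    rcases Finset.mem_insert.1 hz with hz' | hz'
    · rw [hz', update_self]
    · rw [update_of_ne (hvw hz')]
      by_cases e : z = u
      · rw [e, update_self]; have := h.lo_le u hu; omega
      · rw [update_of_ne e]; exact h.lo_le z hz'
  · intro z hz
    rcases Finset.mem_insert.1 hz with rfl | hz
    · rw [update_self]; exact .inr rfl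
    · rw [update_of_ne (hvw hz)]
      by_cases e : z = u
      · subst e; rw [update_self]; omega
      · rw [update_of_ne e]; exact h.next_le z hz
  · intro x y
    rw [Finset.mem_insert, h.scanned, Finset.mem_insert]
    by_cases exw : x = w
    · subst exw
      rw [update_self]
      constructor
      · rintro (e | ⟨h1, -⟩)
        · exact absurd (Prod.mk.inj e).1.symm huw
        · exact absurd h1 hwv
      · rintro ⟨-, i, h1, h2, -⟩
        omega
    · rw [update_of_ne exw]
      by_cases e : x = u
      · subst e
        rw [update_self]
        constructor
        · rintro (e | ⟨h1, i, h2, h3, h4⟩)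
          · exact ⟨.inr hu, next x, h.lo_le x hu, by omega, (Prod.mk.inj e).2.symm⟩
          · exact ⟨.inr h1, i, h2, by omega, h4⟩
        · rintro ⟨h1, i, h2, h3, h4⟩
          by_cases e : i = next x
          · left; rw [← h4, e]
          · exact .inr ⟨hu, i, h2, by omega, h4⟩
      · rw [update_of_ne e]
        constructor
        · rintro (e' | h')
          · exact absurd (Prod.mk.inj e').1 e
          · exact ⟨.inr h'.1, h'.2⟩
        · rintro ⟨h1, h2⟩
          exact .inr ⟨h1.resolve_left exw, h2⟩
  · intro x y hxy
    rcases Finset.mem_insert.1 hxy with e | h'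
    · rw [(Prod.mk.inj e).2]; exact Finset.mem_insert_self _ _
    · exact Finset.mem_insert_of_mem (h.scanned_vis x y h')
  · intro z hz
    have hzv : z ∈ vis := (hi.mem_iff z).2 (.inr hz)
    rw [update_of_ne (hvw hzv)]
    by_cases e : z = u
    · subst e
      have := List.nodup_append.1 hi.nodup
      exact absurd rfl (this.2.2 z (by simp) z hz)
    · rw [update_of_ne e]; exact h.complete z hz
  · intro z
    rw [Finset.card_filter_insert_snd hX]
    by_cases e : z = w
    · subst e
      rw [update_self, update_self, h.deg_eq]
      omega
    · rw [update_of_ne e, update_of_ne e, h.deg_eq]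
  · intro z
    rw [h.cyc_eq]
    congr 2
    ext ⟨x, y⟩
    simp only [Finset.mem_inter, Finset.mem_insert, Finset.mem_union, Finset.mem_filter,
      Prod.mk.injEq]
    constructor
    · rintro ⟨h1, h2⟩
      exact ⟨.inr h1, .inl h2⟩
    · rintro ⟨⟨rfl, rfl⟩ | h1, h2 | h2⟩
      · exact absurd (hi.marked _ _ h2).2.2 hwv
      · exact absurd h2.2.1 huw
      · exact ⟨h1, h2⟩
      · exact absurd h2.2.1 (hvw ((h.scanned _ _).1 h1).1)
  · rw [Finset.card_insert_of_notMem hX]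
    have := h.budget_add
    omega

/-- Array `done` is filled downwards, so that the vertices stand in it in topological order. There
is room, because `u` is a vertex not yet among the finished ones. -/
theorem remove (hA : G.Adjacency lo hi adj)
    (h : SearchState G lo hi adj (u :: st) fin vis C X done status stack next deg cyc budget size
      free) (hlt : ¬ next u < hi u) :
    0 < free ∧ SearchState G lo hi adj st (u :: fin) vis C X (update done (free - 1) u)
      (update status u 2) stack next deg cyc budget (size - 1) (free - 1) := by
  have hi := h.trace.invariant
  have hu := h.top_mem
  have huG := hi.subset hu
  have hnd := hi.nodup
  have hall : ∀ w, (u, w) ∈ G.edges → (u, w) ∈ X := by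
    intro w hw
    obtain ⟨i, h1, h2, h3⟩ := (hA.iff u huG w).1 hw
    exact (h.scanned u w).2 ⟨hu, i, h1, by omega, h3⟩
  have hlen : (u :: st ++ fin).length ≤ G.verts.card := by
    rw [← List.toFinset_card_of_nodup hnd]
    refine Finset.card_le_card fun x hx => hi.subset ((hi.mem_iff x).2 ?_)
    simpa [or_assoc] using hx
  simp only [List.length_append, List.length_cons] at hlen
  have hfree := h.free_add
  have hpos : 0 < free := by omega
  refine ⟨hpos, .remove u st vis C fin h.trace fun w hw => h.scanned_vis _ _ (hall w hw), ?_, ?_,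
    ?_, ?_, ?_, h.lo_le, h.next_le, h.scanned, h.scanned_vis, ?_, h.deg_eq, h.cyc_eq,
    h.budget_add, h.budget_pos⟩
  · simp [h.size_eq]
  · simp only [List.length_cons]
    omega
  · intro i hi'
    have := h.stack_eq i (by simp at hi' ⊢; omega)
    rw [this]
    have e : (u :: st).reverse = st.reverse ++ [u] := List.reverse_cons
    simp only [e]
    rw [List.getElem_append_left hi']
  · intro i hi'
    cases i with
    | zero => simp
    | succ i =>
      rw [update_of_ne (by omega), show free - 1 + (i + 1) = free + i by omega,
        h.done_eq i (by simpa using hi')]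
      simp
  · intro z
    by_cases e : z = u
    · subst e
      have h1 : z ∉ st := fun h => by
        simp only [List.cons_append, List.nodup_cons, List.mem_append, not_or] at hnd
        exact hnd.1.1 h
      rw [update_self, if_neg h1, if_pos (by simp)]
    · rw [update_of_ne e, h.status_eq]
      simp [e]
  · intro z hz
    rcases List.mem_cons.1 hz with rfl | hz
    · omega
    · exact h.complete z hz

/-- At the end of the search all edges are scanned. -/
theorem scanned_eq (hA : G.Adjacency lo hi adj)
    (h : SearchState G lo hi adj [] fin vis C X done status stack next deg cyc budget size
      free) : X = G.edges := by
  refine (h.scanned_subset hA).antisymm ?_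
  rintro ⟨x, y⟩ hxy
  have hx := G.fst_mem hxy
  obtain ⟨i, h1, h2, h3⟩ := (hA.iff x hx y).1 hxy
  have hxv : x ∈ vis := by rw [h.trace.final.2.2]; exact hx
  refine (h.scanned x y).2 ⟨hxv, i, h1, ?_, h3⟩
  have := h.complete x (by simpa using (h.trace.invariant.mem_iff x).1 hxv)
  omega

end SearchState

end Search

/-! ### The program for the depth-first search and its running time -/

section SearchProgram

open Prog Function

/-- Sets register 2 to `2n - 1`, the number of edges that the search may scan before giving up,
and starts the search at the source. -/
def searchInit : Prog :=
  .seq (.whileLt 11 0 (.seq (.incr 2) (.seq (.incr 2) (.incr 11)))) <|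
  .seq (.decr 2) <| .seq (.const 12 2) <| .seq (.copy 10 0) <| .seq (.const 8 1) <|
  .seq (.store 5 1 8) <| .seq (.store 6 3 1) <| .seq (.const 3 1) <| .seq (.load 5 0 1) <|
  .seq (.store 7 1 5) (.store 8 1 8)

/-- Scans the next edge that leaves the top of the stack, or removes the top of the stack. -/
def searchStep : Prog :=
  .seq (.copy 4 3) <| .seq (.decr 4) <| .seq (.load 4 6 4) <| .seq (.load 5 7 4) <|
  .seq (.load 6 1 4) <|
  .ifLt 5 6
    (.seq (.load 7 2 5) <| .seq (.decr 2) <|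
      .ifLt 9 2
        (.seq (.load 11 8 7) <| .seq (.incr 11) <| .seq (.store 8 7 11) <|
          .seq (.incr 5) <| .seq (.store 7 4 5) <| .seq (.load 8 5 7) <|
          .ifLt 9 8
            (.ifLt 8 12 (.seq (.load 11 9 7) <| .seq (.incr 11) (.store 9 7 11)) (.const 11 0))
            (.seq (.const 8 1) <| .seq (.store 5 7 8) <| .seq (.store 6 3 7) <| .seq (.incr 3) <|
              .seq (.load 5 0 7) (.store 7 7 5)))
        (.seq (.const 3 0) (.const 13 1)))
    (.seq (.store 5 4 12) <| .seq (.decr 3) <| .seq (.decr 10) (.store 3 10 4))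

def searchProgram : Prog := .seq searchInit (.whileLt 9 3 searchStep)

/-- The registers and arrays that the search does not change. -/
structure SearchFrame (G : FlowGraph ℕ) (lo hi adj : ℕ → ℕ) (σ : Store) : Prop where
  lo_eq : σ.arr 0 = lo
  hi_eq : σ.arr 1 = hi
  adj_eq : σ.arr 2 = adj
  card_eq : σ.reg 0 = G.verts.card
  zero_eq : σ.reg 9 = 0
  two_eq : σ.reg 12 = 2

/-- The memory holds a state of the search with the given stack and list of finished vertices. -/
def Searching (G : FlowGraph ℕ) (lo hi adj : ℕ → ℕ) (st fin : List ℕ) (vis : Finset ℕ)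
    (C X : Finset (ℕ × ℕ)) (σ : Store) : Prop :=
  SearchFrame G lo hi adj σ ∧ σ.reg 13 = 0 ∧
    SearchState G lo hi adj st fin vis C X (σ.arr 3) (σ.arr 5) (σ.arr 6) (σ.arr 7) (σ.arr 8)
      (σ.arr 9) (σ.reg 2) (σ.reg 3) (σ.reg 10)

/-- The search has given up because there are too many edges. -/
def GaveUp (G : FlowGraph ℕ) (σ : Store) : Prop :=
  σ.reg 9 = 0 ∧ σ.reg 13 = 1 ∧ σ.reg 3 = 0 ∧ 2 * G.verts.card ≤ G.edges.card + 1

theorem EncodesGraph.card_eq {G : FlowGraph ℕ} {n : ℕ} {σ : Store} (h : EncodesGraph G n σ) :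
    G.verts.card = n := by rw [h.verts_eq, Finset.card_range]

theorem EncodesGraph.adjacency {G : FlowGraph ℕ} {n : ℕ} {σ : Store} (h : EncodesGraph G n σ) :
    G.Adjacency (σ.arr 0) (σ.arr 1) (σ.arr 2) where
  iff := fun u hu => h.adj_iff u (by rwa [h.verts_eq, Finset.mem_range] at hu)
  inj := fun u hu => h.adj_inj u (by rwa [h.verts_eq, Finset.mem_range] at hu)

/-- The last bound is the initial potential of the search: `2n - 1` edges to scan and `n` vertices
to remove. Each of the `n` rounds that compute `2n` costs four steps. -/
theorem searchInit_halts {G : FlowGraph ℕ} {n : ℕ} {σ : Store} (h : EncodesGraph G n σ) :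
    searchInit.Halts σ fun t σ' => t ≤ 4 * n + 11 ∧ ∃ st fin vis C X,
      Searching G (σ.arr 0) (σ.arr 1) (σ.arr 2) st fin vis C X σ' ∧ σ'.reg 2 + σ'.reg 10 ≤ 3 * n := by
  have hn : 0 < n := by
    rw [← h.card_eq]
    exact Finset.card_pos.2 ⟨_, G.source_mem⟩
  rw [searchInit, halts_seq]
  refine Halts.mono (halts_whileLt (φ := 4 * n) (fun φ τ => τ.arr = σ.arr ∧ τ.reg 0 = n ∧
    τ.reg 1 = G.source ∧ τ.reg 3 = 0 ∧ τ.reg 9 = 0 ∧ τ.reg 13 = 0 ∧ τ.reg 11 ≤ n ∧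
    τ.reg 2 = 2 * τ.reg 11 ∧ φ = 4 * (n - τ.reg 11)) ?_ ?_) ?_
  · rintro φ τ ⟨h1, h2, h3, h4, h5, h6, h7, h8, h9⟩ hlt
    simp only [halts_seq, halts_incr, Store.reg_setReg, Store.arr_setReg]
    rw [h2] at hlt
    refine ⟨_, ⟨h1, h2, h3, h4, h5, h6, ?_, ?_, rfl⟩, ?_⟩ <;> simp <;> omega
  · exact ⟨rfl, h.reg_zero, h.reg_one, h.reg_rest 3 (by omega), h.reg_rest 9 (by omega),
      h.reg_rest 13 (by omega), by simp [h.reg_rest 11], by simp [h.reg_rest 11, h.reg_rest 2],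
      by simp [h.reg_rest 11]⟩
  · rintro t τ ⟨φ', ⟨h1, h2, h3, h4, h5, h6, h7, h8, h9⟩, hge, ht⟩
    simp only [halts_seq, halts_decr, halts_const, halts_copy, halts_store, halts_load,
      Store.reg_setReg, Store.arr_setReg, Store.reg_setArr, Store.arr_setArr]
    simp only [Nat.reduceEqDiff, if_true, if_false, h3, h4, h2]
    refine ⟨by omega, [G.source], [], {G.source}, G.dfsInit.cycleEdges, ∅, ⟨⟨?_, ?_, ?_, ?_, ?_, ?_⟩, ?_, ?_⟩, ?_⟩
    · simp [Store.arr_setReg, Store.arr_setArr, h1]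
    · simp [Store.arr_setReg, Store.arr_setArr, h1]
    · simp [Store.arr_setReg, Store.arr_setArr, h1]
    · simp [Store.reg_setReg, Store.reg_setArr, h2, h.card_eq]
    · simp [Store.reg_setReg, Store.reg_setArr, h5]
    · simp [Store.reg_setReg, Store.reg_setArr]
    · simp [Store.reg_setReg, Store.reg_setArr, h6]
    · have hz := h.arr_rest
      simp only [Store.reg_setReg, Store.arr_setReg, Store.reg_setArr, Store.arr_setArr,
        Nat.reduceEqDiff, if_true, if_false, h1]
      refine ⟨.init, rfl, by simp [h.card_eq], ?_, by simp, ?_, ?_, ?_, ?_, by simp, by simp, ?_,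
        ?_, ?_, ?_⟩
      · intro i hi
        have : i = 0 := by simpa using hi
        subst this
        simp
      · intro w
        by_cases e : w = G.source
        · subst e; simp
        · simp [e, hz]
      · intro u hu
        rw [Finset.mem_singleton] at hu
        subst hu
        simp
      · intro u hu
        rw [Finset.mem_singleton] at hu
        subst hu
        simp
      · intro x y
        simp only [Finset.notMem_empty, Finset.mem_singleton, false_iff, not_and, not_exists]
        rintro rfl i h1 h2
        rw [update_self] at h2
        omega
      · intro w
        by_cases e : w = G.source
        · subst e; simp
        · simp [e, hz]
      · intro w
        simp [hz]
      · simp [h.card_eq]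
        omega
      · omega
    · omega

/-- Every round scans an edge, which lowers the budget in register 2, or finishes a vertex, which
lowers the free cells counted in register 10. Their sum is the potential. -/
theorem searchStep_halts {G : FlowGraph ℕ} {lo hi adj : ℕ → ℕ} (hA : G.Adjacency lo hi adj)
    {st fin : List ℕ} {vis : Finset ℕ} {C X : Finset (ℕ × ℕ)} {σ : Store}
    (h : Searching G lo hi adj st fin vis C X σ) (hlt : σ.reg 9 < σ.reg 3) :
    searchStep.Halts σ fun t σ' => t ≤ 24 ∧ (GaveUp G σ' ∨ ∃ st fin vis C X,
      Searching G lo hi adj st fin vis C X σ' ∧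
        σ'.reg 2 + σ'.reg 10 + 1 = σ.reg 2 + σ.reg 10) := by
  obtain ⟨hF, h13, hS⟩ := h
  have h9 := hF.zero_eq
  cases st with
  | nil =>
    have := hS.size_eq
    simp only [List.length_nil] at this
    omega
  | cons u st =>
    have hfr : ∀ {σ' : Store}, σ'.arr 0 = σ.arr 0 → σ'.arr 1 = σ.arr 1 → σ'.arr 2 = σ.arr 2 →
        σ'.reg 0 = σ.reg 0 → σ'.reg 9 = σ.reg 9 → σ'.reg 12 = σ.reg 12 →
        SearchFrame G lo hi adj σ' := fun h0 h1 h2 h3 h4 h5 =>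
      ⟨h0.trans hF.lo_eq, h1.trans hF.hi_eq, h2.trans hF.adj_eq, h3.trans hF.card_eq,
        h4.trans hF.zero_eq, h5.trans hF.two_eq⟩
    simp only [searchStep, halts_seq, halts_decr, halts_incr, halts_const, halts_copy, halts_store,
      halts_load, halts_ifLt, Store.reg_setReg, Store.arr_setReg, Store.reg_setArr,
      Store.arr_setArr]
    simp only [Nat.reduceEqDiff, if_true, if_false, hS.top_eq, h9, hF.hi_eq, hF.adj_eq, hF.lo_eq,
      hF.two_eq, OfNat.zero_ne_ofNat]
    split_ifs with c1 c2 c3 c4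
    · have := hS.scan hA c1 c2 c3
      rw [if_pos c4] at this
      refine ⟨by omega, .inr ⟨u :: st, fin, vis, C, Insert.insert (u, adj (σ.arr 7 u)) X,
        ⟨hfr ?_ ?_ ?_ ?_ ?_ ?_, ?_, ?_⟩, ?_⟩⟩
      rotate_left 7
      · simpa [Store.reg_setReg, Store.arr_setReg, Store.reg_setArr, Store.arr_setArr] using this
      all_goals first
        | omega
        | simp [Store.reg_setReg, Store.arr_setReg, Store.reg_setArr, Store.arr_setArr, h13]
    · have := hS.scan hA c1 c2 c3
      rw [if_neg c4] at this
      refine ⟨by omega, .inr ⟨u :: st, fin, vis, C, Insert.insert (u, adj (σ.arr 7 u)) X,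
        ⟨hfr ?_ ?_ ?_ ?_ ?_ ?_, ?_, ?_⟩, ?_⟩⟩
      rotate_left 7
      · simpa [Store.reg_setReg, Store.arr_setReg, Store.reg_setArr, Store.arr_setArr] using this
      all_goals first
        | omega
        | simp [Store.reg_setReg, Store.arr_setReg, Store.reg_setArr, Store.arr_setArr, h13]
    · obtain ⟨vis', C', X', this⟩ := hS.insert hA c1 c2 c3
      refine ⟨by omega, .inr ⟨adj (σ.arr 7 u) :: u :: st, fin, vis', C', X',
        ⟨hfr ?_ ?_ ?_ ?_ ?_ ?_, ?_, ?_⟩, ?_⟩⟩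
      rotate_left 7
      · simpa [Store.reg_setReg, Store.arr_setReg, Store.reg_setArr, Store.arr_setArr] using this
      all_goals first
        | omega
        | simp [Store.reg_setReg, Store.arr_setReg, Store.reg_setArr, Store.arr_setArr, h13]
    · refine ⟨by omega, .inl ⟨?_, ?_, ?_, hS.exhausted hA c1 (by omega)⟩⟩
      all_goals simp [Store.reg_setReg, h9]
    · obtain ⟨hpos, this⟩ := hS.remove hA c1
      refine ⟨by omega, .inr ⟨st, u :: fin, vis, C, X,
        ⟨hfr ?_ ?_ ?_ ?_ ?_ ?_, ?_, ?_⟩, ?_⟩⟩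
      rotate_left 7
      · simpa [Store.reg_setReg, Store.arr_setReg, Store.reg_setArr, Store.arr_setArr] using this
      all_goals first
        | omega
        | simp [Store.reg_setReg, Store.arr_setReg, Store.reg_setArr, Store.arr_setArr, h13]

/-- There are at most `3n` rounds, each of at most 24 steps and one test. -/
theorem searchProgram_halts {G : FlowGraph ℕ} {n : ℕ} {σ : Store} (h : EncodesGraph G n σ) :
    searchProgram.Halts σ fun t σ' => t ≤ 79 * n + 12 ∧ (GaveUp G σ' ∨ ∃ fin vis C X,
      Searching G (σ.arr 0) (σ.arr 1) (σ.arr 2) [] fin vis C X σ') := by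
  rw [searchProgram, halts_seq]
  refine (searchInit_halts h).mono ?_
  rintro t₁ σ₁ ⟨ht₁, st, fin, vis, C, X, hS, hle⟩
  refine Halts.mono (halts_whileLt (φ := 25 * (σ₁.reg 2 + σ₁.reg 10)) (fun φ τ => GaveUp G τ ∨
    (φ = 25 * (τ.reg 2 + τ.reg 10) ∧ ∃ st fin vis C X,
      Searching G (σ.arr 0) (σ.arr 1) (σ.arr 2) st fin vis C X τ)) ?_ ?_) ?_
  · rintro φ τ (hG | ⟨hφ, st, fin, vis, C, X, hS⟩) hlt
    · rw [hG.1, hG.2.2.1] at hlt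
      omega
    · refine (searchStep_halts h.adjacency hS hlt).mono ?_
      rintro t τ' ⟨ht, hG | ⟨st', fin', vis', C', X', hS', hdec⟩⟩
      -- Giving up sets the stack size to zero, so the loop ends and no potential is needed any
      -- more.
      · refine ⟨0, .inl hG, ?_⟩
        have := hS.2.2.budget_pos
        omega
      · exact ⟨_, .inr ⟨rfl, _, _, _, _, _, hS'⟩, by omega⟩
  · exact .inr ⟨rfl, _, _, _, _, _, hS⟩
  · rintro t₂ σ₂ ⟨φ', hI, hge, ht⟩
    refine ⟨by omega, ?_⟩
    rcases hI with hG | ⟨-, st', fin', vis', C', X', hS'⟩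
    · exact .inl hG
    · right
      have h1 := hS'.2.2.size_eq
      have h2 := hS'.1.zero_eq
      have : st' = [] := List.eq_nil_of_length_eq_zero (by omega)
      subst this
      exact ⟨_, _, _, _, hS'⟩

end SearchProgram

/-! ### Recognizing primes by degrees -/

section Shapes

/-- The arrays `lo`, `hi`, `adj` hold the adjacency lists of `G`, the array `deg` the indegrees (one
more for the source `s₀`) and the array `cyc` the numbers of entering cycle edges. -/
structure MarkedGraph.Represents (G : MarkedGraph ℕ) (s₀ : ℕ) (lo hi adj deg cyc : ℕ → ℕ) :
    Prop where
  adjacency : G.Adjacency lo hi adj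
  deg_eq : ∀ x ∈ G.verts,
    deg x = (G.edges.filter fun e => e.2 = x).card + if x = s₀ then 1 else 0
  cyc_eq : ∀ x ∈ G.verts, cyc x = (G.cycleEdges.filter fun e => e.2 = x).card

/-- The test for a prime with source `v` that has the only out-neighbor `x`. -/
def OneShape (lo hi adj deg cyc : ℕ → ℕ) (v x t k : ℕ) : Prop :=
  deg x < 2 ∧ ((cyc v = 0 ∧ t = x ∧ k = 1) ∨
    (0 < cyc v ∧ lo x + 2 = hi x ∧ ((adj (lo x) = v ∧ t = adj (lo x + 1)) ∨
      (adj (lo x + 1) = v ∧ t = adj (lo x))) ∧ deg t < 2 ∧ k = 2))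

/-- The test for an if or while graph with source `v`, middle vertex `x` and sink `t`. -/
def PairShape (lo hi adj deg cyc : ℕ → ℕ) (v x t : ℕ) : Prop :=
  deg x < 2 ∧ lo x + 1 = hi x ∧ ((0 < cyc v ∧ adj (lo x) = v ∧ deg t < 2) ∨
    (cyc v = 0 ∧ adj (lo x) = t ∧ deg t ≤ 2))

/-- The test for a middle vertex `x` of a branching graph with sink `t`. -/
def MidShape (lo hi adj deg : ℕ → ℕ) (t x : ℕ) : Prop :=
  deg x < 2 ∧ lo x + 1 = hi x ∧ adj (lo x) = t

/-- The test for a prime with source `v`, sink `t` and `k + 1` vertices. -/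
def PrimeShape (lo hi adj deg cyc : ℕ → ℕ) (v t k : ℕ) : Prop :=
  cyc v < 2 ∧ ((lo v + 1 = hi v ∧ OneShape lo hi adj deg cyc v (adj (lo v)) t k) ∨
    (lo v + 2 = hi v ∧ k = 2 ∧
      ((t = adj (lo v + 1) ∧ PairShape lo hi adj deg cyc v (adj (lo v)) t) ∨
        (t = adj (lo v) ∧ PairShape lo hi adj deg cyc v (adj (lo v + 1)) t))) ∨
    (∃ d, 2 ≤ d ∧ lo v + d = hi v ∧ k = d + 1 ∧ cyc v = 0 ∧ deg t ≤ d ∧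
      ∀ i, lo v ≤ i → i < hi v → MidShape lo hi adj deg t (adj i)))

namespace MarkedGraph

variable {G : MarkedGraph ℕ} {s₀ : ℕ} {pos : ℕ → ℕ} {lo hi adj deg cyc : ℕ → ℕ}

namespace Represents

/-- An indegree that does not exceed the number of known in-neighbors leaves no room for others. The
extra unit in the degree of `s₀` makes the same comparison exclude `x = s₀`. -/
theorem in_subset (hR : G.Represents s₀ lo hi adj deg cyc) {x : ℕ} (hx : x ∈ G.verts)
    {S : Finset ℕ} (hS : ∀ z ∈ S, (z, x) ∈ G.edges) (hd : deg x ≤ S.card) :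
    x ≠ s₀ ∧ ∀ z, (z, x) ∈ G.edges → z ∈ S := by
  have hsub : S.image (fun z => (z, x)) ⊆ G.edges.filter fun e => e.2 = x := by
    intro e he
    obtain ⟨z, hz, rfl⟩ := Finset.mem_image.1 he
    exact Finset.mem_filter.2 ⟨hS z hz, rfl⟩
  have hcard : (S.image fun z => (z, x)).card = S.card :=
    Finset.card_image_of_injective _ fun a b h => (Prod.mk.inj h).1
  have hle := Finset.card_le_card hsub
  rw [hR.deg_eq x hx] at hd
  have hne : x ≠ s₀ := by
    rintro rfl
    rw [if_pos rfl] at hd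
    omega
  refine ⟨hne, fun z hz => ?_⟩
  rw [if_neg hne] at hd
  have heq := Finset.eq_of_subset_of_card_le hsub (by omega)
  have : (z, x) ∈ S.image fun z => (z, x) := by
    rw [heq]
    exact Finset.mem_filter.2 ⟨hz, rfl⟩
  obtain ⟨w, hw, e⟩ := Finset.mem_image.1 this
  rwa [← (Prod.mk.inj e).1]

theorem in_unique (hR : G.Represents s₀ lo hi adj deg cyc) {x y : ℕ} (h : (y, x) ∈ G.edges)
    (hd : deg x < 2) : x ≠ s₀ ∧ ∀ z, (z, x) ∈ G.edges → z = y := by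
  have := hR.in_subset (G.snd_mem h) (S := {y}) (by simpa using h) (by simp; omega)
  simpa using this

theorem deg_eq_card (hR : G.Represents s₀ lo hi adj deg cyc) {x : ℕ} (hx : x ∈ G.verts)
    (h0 : x ≠ s₀) {S : Finset ℕ} (hS : ∀ z, (z, x) ∈ G.edges ↔ z ∈ S) : deg x = S.card := by
  rw [hR.deg_eq x hx, if_neg h0, add_zero]
  have : (G.edges.filter fun e => e.2 = x) = S.image fun z => (z, x) := by
    ext ⟨p, q⟩
    simp only [Finset.mem_filter, Finset.mem_image, Prod.mk.injEq]
    constructor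
    · rintro ⟨h, rfl⟩
      exact ⟨p, (hS p).1 h, rfl, rfl⟩
    · rintro ⟨z, hz, rfl, rfl⟩
      exact ⟨(hS z).2 hz, rfl⟩
  rw [this]
  exact Finset.card_image_of_injective _ fun a b h => (Prod.mk.inj h).1

theorem cyc_eq_zero (hR : G.Represents s₀ lo hi adj deg cyc) {x : ℕ} (hx : x ∈ G.verts) :
    cyc x = 0 ↔ ∀ z, (z, x) ∉ G.cycleEdges := by
  rw [hR.cyc_eq x hx, Finset.card_eq_zero, Finset.filter_eq_empty_iff]
  exact ⟨fun h z hz => h hz rfl, fun h ⟨p, q⟩ hpq e => h p (e ▸ hpq)⟩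

theorem cyc_unique (hR : G.Represents s₀ lo hi adj deg cyc) {x y : ℕ} (hx : x ∈ G.verts)
    (h : (y, x) ∈ G.cycleEdges) (hd : cyc x < 2) {z : ℕ} (hz : (z, x) ∈ G.cycleEdges) : z = y := by
  rw [hR.cyc_eq x hx] at hd
  have := Finset.card_le_one.1 (Nat.lt_succ_iff.1 hd) (z, x) (Finset.mem_filter.2 ⟨hz, rfl⟩)
    (y, x) (Finset.mem_filter.2 ⟨h, rfl⟩)
  exact (Prod.mk.inj this).1

theorem cyc_eq_one (hR : G.Represents s₀ lo hi adj deg cyc) {x y : ℕ} (hx : x ∈ G.verts)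
    (h : ∀ z, (z, x) ∈ G.cycleEdges ↔ z = y) : cyc x = 1 := by
  rw [hR.cyc_eq x hx, Finset.card_eq_one]
  refine ⟨(y, x), ?_⟩
  ext ⟨p, q⟩
  simp only [Finset.mem_filter, Finset.mem_singleton, Prod.mk.injEq]
  constructor
  · rintro ⟨h1, rfl⟩
    exact ⟨(h p).1 h1, rfl⟩
  · rintro ⟨rfl, rfl⟩
    exact ⟨(h p).2 rfl, rfl⟩

theorem out_eq (hR : G.Represents s₀ lo hi adj deg cyc) {x : ℕ} (hx : x ∈ G.verts)
    {S : Finset ℕ} (hS : ∀ w, (x, w) ∈ G.edges ↔ w ∈ S) : S.card = hi x - lo x := by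
  have : S = (Finset.Ico (lo x) (hi x)).image adj := by
    ext w
    rw [← hS, hR.adjacency.iff x hx, Finset.mem_image]
    simp [and_assoc]
  rw [this, Finset.card_image_of_injOn, Nat.card_Ico]
  intro i hi' j hj e
  simp only [Finset.coe_Ico, Set.mem_Ico] at hi' hj
  exact hR.adjacency.inj x hx i j hi'.1 hi'.2 hj.1 hj.2 e

theorem out_adj (hR : G.Represents s₀ lo hi adj deg cyc) {x i : ℕ} (hx : x ∈ G.verts)
    (h1 : lo x ≤ i) (h2 : i < hi x) : (x, adj i) ∈ G.edges :=
  (hR.adjacency.iff x hx _).2 ⟨i, h1, h2, rfl⟩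

theorem out_one (hR : G.Represents s₀ lo hi adj deg cyc) {x : ℕ} (hx : x ∈ G.verts)
    (h : lo x + 1 = hi x) (w : ℕ) : (x, w) ∈ G.edges ↔ w = adj (lo x) := by
  rw [hR.adjacency.iff x hx]
  constructor
  · rintro ⟨i, h1, h2, rfl⟩
    rw [show i = lo x by omega]
  · rintro rfl
    exact ⟨lo x, le_rfl, by omega, rfl⟩

theorem out_two (hR : G.Represents s₀ lo hi adj deg cyc) {x : ℕ} (hx : x ∈ G.verts)
    (h : lo x + 2 = hi x) (w : ℕ) :
    (x, w) ∈ G.edges ↔ w = adj (lo x) ∨ w = adj (lo x + 1) := by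
  rw [hR.adjacency.iff x hx]
  constructor
  · rintro ⟨i, h1, h2, rfl⟩
    rcases (by omega : i = lo x ∨ i = lo x + 1) with rfl | rfl
    · exact .inl rfl
    · exact .inr rfl
  · rintro (rfl | rfl)
    · exact ⟨lo x, le_rfl, by omega, rfl⟩
    · exact ⟨lo x + 1, by omega, by omega, rfl⟩

theorem out_two_ne (hR : G.Represents s₀ lo hi adj deg cyc) {x : ℕ} (hx : x ∈ G.verts)
    (h : lo x + 2 = hi x) : adj (lo x) ≠ adj (lo x + 1) := by
  intro e
  have := hR.adjacency.inj x hx _ _ le_rfl (by omega) (by omega) (by omega) e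
  omega

theorem one_of_out (hR : G.Represents s₀ lo hi adj deg cyc) {x y : ℕ} (hx : x ∈ G.verts)
    (h : ∀ w, (x, w) ∈ G.edges ↔ w = y) : lo x + 1 = hi x ∧ adj (lo x) = y := by
  have hc := hR.out_eq hx (S := {y}) (by simpa using h)
  rw [Finset.card_singleton] at hc
  exact ⟨by omega, (h _).1 (hR.out_adj hx le_rfl (by omega))⟩

theorem two_of_out (hR : G.Represents s₀ lo hi adj deg cyc) {x y z : ℕ} (hx : x ∈ G.verts)
    (hyz : y ≠ z) (h : ∀ w, (x, w) ∈ G.edges ↔ w = y ∨ w = z) : lo x + 2 = hi x ∧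
      ((adj (lo x) = y ∧ adj (lo x + 1) = z) ∨ (adj (lo x) = z ∧ adj (lo x + 1) = y)) := by
  have hc := hR.out_eq hx (S := {y, z}) (by simpa using h)
  rw [Finset.card_pair hyz] at hc
  have h2 : lo x + 2 = hi x := by omega
  refine ⟨h2, ?_⟩
  have h3 := (h _).1 (hR.out_adj hx le_rfl (by omega))
  have h4 := (h _).1 (hR.out_adj (i := lo x + 1) hx (by omega) (by omega))
  have h5 := hR.out_two_ne hx h2
  rcases h3 with h3 | h3 <;> rcases h4 with h4 | h4
  · exact absurd (h3.trans h4.symm) h5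
  · exact .inl ⟨h3, h4⟩
  · exact .inr ⟨h3, h4⟩
  · exact absurd (h3.trans h4.symm) h5

end Represents

/-- The subgraph induced by the vertex set `S`. -/
def induce (G : MarkedGraph ℕ) (S : Finset ℕ) : FinDigraph ℕ where
  verts := S
  edges := G.edges.filter fun e => e.1 ∈ S ∧ e.2 ∈ S
  fst_mem := fun h => (Finset.mem_filter.1 h).2.1
  snd_mem := fun h => (Finset.mem_filter.1 h).2.2

theorem mem_induce_edges {S : Finset ℕ} {x y : ℕ} :
    (x, y) ∈ (G.induce S).edges ↔ (x, y) ∈ G.edges ∧ x ∈ S ∧ y ∈ S := by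
  simp [induce]

/-- A vertex set that is entered only through `v` is reached from `v`. -/
theorem Ordered.reach_of_closed (hG : G.Ordered s₀ pos) {S : Finset ℕ} {v : ℕ}
    (hin : ∀ y ∈ S, y ≠ v → y ≠ s₀ ∧ ∀ x, (x, y) ∈ G.edges → x ∈ S) {x : ℕ} (hx : x ∈ S)
    (hxG : x ∈ G.verts) : Relation.ReflTransGen G.Fwd v x := by
  have := hG.reach x hxG
  induction this with
  | refl =>
    by_cases h : s₀ = v
    · rw [h]
    · exact absurd rfl (hin s₀ hx h).1
  | @tail p q _ hpq ih =>
    by_cases h : q = v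
    · rw [h]
    · exact (ih ((hin q hx h).2 p hpq.1) (G.fst_mem hpq.1)).tail hpq

/-- The data of a closed vertex set `S` with source `v` and sink `t` whose other vertices are
entered only from `v`. -/
structure ClosedSet (G : MarkedGraph ℕ) (s₀ : ℕ) (S : Finset ℕ) (v t : ℕ) : Prop where
  source_mem : v ∈ S
  subset : S ⊆ G.verts
  ne_source : ∀ x ∈ S, x ≠ v → x ≠ s₀
  mid_in : ∀ x ∈ S, x ≠ v → x ≠ t → ∀ z, (z, x) ∈ G.edges → z = v
  sink_in : ∀ z, (z, t) ∈ G.edges → z ∈ S ∧ z ≠ t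
  out : ∀ x ∈ S, x ≠ t → ∀ w, (x, w) ∈ G.edges → w ∈ S

namespace ClosedSet

variable {S : Finset ℕ} {v t : ℕ}

theorem in_closed (h : G.ClosedSet s₀ S v t) {x y : ℕ} (hy : y ∈ S) (hne : y ≠ v)
    (hxy : (x, y) ∈ G.edges) : x ∈ S := by
  by_cases hyt : y = t
  · exact (h.sink_in x (hyt ▸ hxy)).1
  · rw [h.mid_in y hy hne hyt x hxy]
    exact h.source_mem

theorem reach (h : G.ClosedSet s₀ S v t) (hG : G.Ordered s₀ pos) {x : ℕ} (hx : x ∈ S) :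
    Relation.ReflTransGen G.Fwd v x :=
  hG.reach_of_closed (fun y hy hne => ⟨h.ne_source y hy hne, fun _ hxy => h.in_closed hy hne hxy⟩)
    hx (h.subset hx)

theorem marked_source (h : G.ClosedSet s₀ S v t) (hG : G.Ordered s₀ pos) {x : ℕ} (hx : x ∈ S)
    (hxv : (x, v) ∈ G.edges) : (x, v) ∈ G.cycleEdges :=
  hG.marked_of_le hxv (hG.pos_le (h.reach hG hx))

theorem pos_lt (h : G.ClosedSet s₀ S v t) (hG : G.Ordered s₀ pos) {x : ℕ} (hx : x ∈ S)
    (hne : x ≠ v) : pos v < pos x := by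
  obtain h' | ⟨y, h1, h2⟩ := (h.reach hG hx).cases_head
  · exact absurd h'.symm hne
  · exact (hG.inc h1).trans_le (hG.pos_le h2)

/-- The head of a marked edge reaches its tail by unmarked edges. Nothing other than `v` in `S`
reaches `v` in this way, and a middle vertex can be entered only through `v`, so such a path does
not exist. -/
theorem not_marked (h : G.ClosedSet s₀ S v t) (hG : G.Ordered s₀ pos) {x y : ℕ} (hx : x ∈ S)
    (hy : y ∈ S) (hyv : y ≠ v) (hxy : (x, y) ∈ G.edges) : (x, y) ∉ G.cycleEdges := by
  intro hc
  have hyx := hG.back hc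
  have hlt := h.pos_lt hG hy hyv
  by_cases hxv : x = v
  · have := hG.pos_le hyx
    rw [hxv] at this
    omega
  · by_cases hyt : y = t
    · subst hyt
      have hxt := (h.sink_in x hxy).2
      obtain e | ⟨z, h1, h2⟩ := hyx.cases_tail
      · exact hxt e
      · have e := h.mid_in x hx hxv hxt z h2.1
        rw [e] at h1
        have := hG.pos_le h1
        omega
    · exact hxv (h.mid_in y hy hyv hyt x hxy)

/-- The marks inside a closed set are thus determined: exactly the edges into `v` are marked. It
remains to compare plain digraphs with the statement graphs. -/
theorem isPrime (h : G.ClosedSet s₀ S v t) (hG : G.Ordered s₀ pos)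
    (hcyc : ∀ x, (x, v) ∈ G.cycleEdges → (v, x) ∈ G.edges) {B : Finset (ℕ × ℕ)}
    (hB : ∀ x y, (x, y) ∈ B ↔ (x, y) ∈ G.edges ∧ x ∈ S ∧ y = v)
    (hst : IsStatement (G.induce S) v t B) : G.IsPrime (G.induce S) v t := by
  refine ⟨⟨h.subset, fun x y => mem_induce_edges⟩, ?_,
    fun x y hy hne hxy => h.in_closed hy hne hxy, fun x y hx hne hxy => h.out x hx hne y hxy, hcyc⟩
  have : (G.induce S).edges ∩ G.cycleEdges = B := by
    ext ⟨x, y⟩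
    rw [Finset.mem_inter, mem_induce_edges, hB]
    constructor
    · rintro ⟨⟨h1, h2, h3⟩, h4⟩
      exact ⟨h1, h2, by_contra fun hne => h.not_marked hG h2 h3 hne h1 h4⟩
    · rintro ⟨h1, h2, rfl⟩
      exact ⟨⟨h1, h2, h.source_mem⟩, h.marked_source hG h2 h1⟩
  rw [this]
  exact hst

end ClosedSet

variable {v t k a b : ℕ}

theorem isPrime_sequence (hG : G.Ordered s₀ pos) (hv : v ∈ G.verts)
    (hvo : ∀ w, (v, w) ∈ G.edges ↔ w = t) (hti : t ≠ s₀ ∧ ∀ z, (z, t) ∈ G.edges → z = v)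
    (hc : ∀ z, (z, v) ∉ G.cycleEdges) : ∃ H, G.IsPrime H v t ∧ H.verts.card = 2 := by
  have hvt := (hvo t).2 rfl
  have hne : v ≠ t := by
    rintro rfl
    exact hc v (hG.marked_of_le hvt le_rfl)
  have hS : G.ClosedSet s₀ {v, t} v t := by
    refine ⟨by simp, ?_, ?_, ?_, ?_, ?_⟩
    · intro x hx
      simp only [Finset.mem_insert, Finset.mem_singleton] at hx
      rcases hx with rfl | rfl
      exacts [hv, G.snd_mem hvt]
    · intro x hx h1
      simp only [Finset.mem_insert, Finset.mem_singleton] at hx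
      rw [hx.resolve_left h1]; exact hti.1
    · intro x hx h1 h2
      simp only [Finset.mem_insert, Finset.mem_singleton] at hx
      tauto
    · intro z hz
      rw [hti.2 z hz]
      exact ⟨by simp, hne⟩
    · intro x hx h1 w hw
      simp only [Finset.mem_insert, Finset.mem_singleton] at hx
      rw [hx.resolve_right h1, hvo] at hw
      simp [hw]
  have hnv : ∀ z ∈ ({v, t} : Finset ℕ), (z, v) ∉ G.edges := fun z hz h =>
    hc z (hS.marked_source hG hz h)
  refine ⟨_, hS.isPrime hG (fun x hx => absurd hx (hc x)) (B := ∅) ?_ (.sequence hne rfl ?_),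
    Finset.card_pair hne⟩
  · intro x y
    simp only [Finset.notMem_empty, false_iff, not_and]
    rintro h1 h2 rfl
    exact hnv x h2 h1
  · ext ⟨x, y⟩
    rw [mem_induce_edges]
    simp only [Finset.mem_singleton, Prod.mk.injEq]
    constructor
    · rintro ⟨h1, h2, h3⟩
      have hyv : y ≠ v := by rintro rfl; exact hnv x h2 h1
      have hyt : y = t := by simpa [hyv] using h3
      rw [hyt] at h1
      exact ⟨hti.2 x h1, hyt⟩
    · rintro ⟨rfl, rfl⟩
      exact ⟨hvt, by simp, by simp⟩

theorem isPrime_ifThen (hG : G.Ordered s₀ pos) (hv : v ∈ G.verts) (hat : a ≠ t)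
    (hvo : ∀ w, (v, w) ∈ G.edges ↔ w = a ∨ w = t) (hao : ∀ w, (a, w) ∈ G.edges ↔ w = t)
    (hai : a ≠ s₀ ∧ ∀ z, (z, a) ∈ G.edges → z = v)
    (hti : t ≠ s₀ ∧ ∀ z, (z, t) ∈ G.edges → z = v ∨ z = a)
    (hc : ∀ z, (z, v) ∉ G.cycleEdges) : ∃ H, G.IsPrime H v t ∧ H.verts.card = 3 := by
  have hvt := (hvo t).2 (.inr rfl)
  have hva := (hvo a).2 (.inl rfl)
  have hloop : (v, v) ∉ G.edges := fun h => hc v (hG.marked_of_le h le_rfl)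
  have hnt : v ≠ t := by rintro rfl; exact hloop hvt
  have hna : v ≠ a := by rintro rfl; exact hloop hva
  have hS : G.ClosedSet s₀ {v, a, t} v t := by
    refine ⟨by simp, ?_, ?_, ?_, ?_, ?_⟩
    · intro x hx
      simp only [Finset.mem_insert, Finset.mem_singleton] at hx
      rcases hx with rfl | rfl | rfl
      exacts [hv, G.snd_mem hva, G.snd_mem hvt]
    · intro x hx h1
      simp only [Finset.mem_insert, Finset.mem_singleton] at hx
      rcases hx with rfl | rfl | rfl
      exacts [absurd rfl h1, hai.1, hti.1]
    · intro x hx h1 h2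
      simp only [Finset.mem_insert, Finset.mem_singleton] at hx
      rcases hx with rfl | rfl | rfl
      exacts [absurd rfl h1, hai.2, absurd rfl h2]
    · intro z hz
      rcases hti.2 z hz with rfl | rfl
      exacts [⟨by simp, hnt⟩, ⟨by simp, hat⟩]
    · intro x hx h1 w hw
      simp only [Finset.mem_insert, Finset.mem_singleton] at hx ⊢
      rcases hx with rfl | rfl | rfl
      · exact .inr ((hvo w).1 hw)
      · exact .inr (.inr ((hao w).1 hw))
      · exact absurd rfl h1
  have hnv : ∀ z ∈ ({v, a, t} : Finset ℕ), (z, v) ∉ G.edges := fun z hz h =>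
    hc z (hS.marked_source hG hz h)
  refine ⟨_, hS.isPrime hG (fun x hx => absurd hx (hc x)) (B := ∅) ?_
    (.ifThen a hna hat hnt rfl ?_), ?_⟩
  · intro x y
    simp only [Finset.notMem_empty, false_iff, not_and]
    rintro h1 h2 rfl
    exact hnv x h2 h1
  · ext ⟨x, y⟩
    rw [mem_induce_edges]
    simp only [Finset.mem_insert, Finset.mem_singleton, Prod.mk.injEq]
    constructor
    · rintro ⟨h1, h2, rfl | rfl | rfl⟩
      · exact absurd h1 (hnv x (by simpa using h2))
      · exact .inl ⟨hai.2 x h1, rfl⟩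
      · rcases hti.2 x h1 with rfl | rfl <;> simp
    · rintro (⟨rfl, rfl⟩ | ⟨rfl, rfl⟩ | ⟨rfl, rfl⟩)
      · exact ⟨hva, by simp, by simp⟩
      · exact ⟨(hao _).2 rfl, by simp, by simp⟩
      · exact ⟨hvt, by simp, by simp⟩
  · show ({v, a, t} : Finset ℕ).card = 3
    rw [Finset.card_insert_of_notMem (by simp [hna, hnt]), Finset.card_pair hat]

theorem isPrime_whileLoop (hG : G.Ordered s₀ pos) (hv : v ∈ G.verts) (hat : a ≠ t)
    (hvo : ∀ w, (v, w) ∈ G.edges ↔ w = a ∨ w = t) (hao : ∀ w, (a, w) ∈ G.edges ↔ w = v)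
    (hai : a ≠ s₀ ∧ ∀ z, (z, a) ∈ G.edges → z = v) (hti : t ≠ s₀ ∧ ∀ z, (z, t) ∈ G.edges → z = v)
    (hc : ∀ z y, (z, v) ∈ G.cycleEdges → (y, v) ∈ G.cycleEdges → z = y) :
    ∃ H, G.IsPrime H v t ∧ H.verts.card = 3 := by
  have hvt := (hvo t).2 (.inr rfl)
  have hva := (hvo a).2 (.inl rfl)
  have hav := (hao v).2 rfl
  have hna : v ≠ a := by
    rintro rfl
    exact hat ((hao t).1 hvt).symm
  have hac : (a, v) ∈ G.cycleEdges := by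
    -- Otherwise `a` comes before `v` and the edge `va` is marked. But `a` is not the source and has
    -- the only in-neighbor `v`, so it is reached by this edge, unmarked.
    by_contra h
    have h1 := hG.inc ⟨hav, h⟩
    have h2 : G.Fwd v a := by
      by_contra hf
      have : (v, a) ∈ G.cycleEdges := by
        by_contra hc'
        exact hf ⟨hva, hc'⟩
      have := hG.marked_of_le hva h1.le
      obtain e | ⟨z, h3, h4⟩ := (hG.reach a (G.snd_mem hva)).cases_tail
      · exact hai.1 e
      · have := hai.2 z h4.1
        rw [this] at h4
        exact h4.2 ‹_›
    have := hG.inc h2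
    omega
  -- A loop at `v` would be a second marked edge into `v`.
  have hnt : v ≠ t := by
    rintro rfl
    exact hna (hc v a (hG.marked_of_le hvt le_rfl) hac)
  have hS : G.ClosedSet s₀ {v, a, t} v t := by
    refine ⟨by simp, ?_, ?_, ?_, ?_, ?_⟩
    · intro x hx
      simp only [Finset.mem_insert, Finset.mem_singleton] at hx
      rcases hx with rfl | rfl | rfl
      exacts [hv, G.snd_mem hva, G.snd_mem hvt]
    · intro x hx h1
      simp only [Finset.mem_insert, Finset.mem_singleton] at hx
      rcases hx with rfl | rfl | rfl
      exacts [absurd rfl h1, hai.1, hti.1]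
    · intro x hx h1 h2
      simp only [Finset.mem_insert, Finset.mem_singleton] at hx
      rcases hx with rfl | rfl | rfl
      exacts [absurd rfl h1, hai.2, absurd rfl h2]
    · intro z hz
      rw [hti.2 z hz]
      exact ⟨by simp, hnt⟩
    · intro x hx h1 w hw
      simp only [Finset.mem_insert, Finset.mem_singleton] at hx ⊢
      rcases hx with rfl | rfl | rfl
      · exact .inr ((hvo w).1 hw)
      · exact .inl ((hao w).1 hw)
      · exact absurd rfl h1
  have hxa : ∀ x, (x, v) ∈ G.cycleEdges → x = a := fun x hx => hc x a hx hac
  refine ⟨_, hS.isPrime hG (fun x hx => by rwa [hxa x hx]) (B := {(a, v)}) ?_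
    (.whileLoop a hna hat hnt rfl ?_), ?_⟩
  · intro x y
    simp only [Finset.mem_singleton, Prod.mk.injEq]
    constructor
    · rintro ⟨rfl, rfl⟩
      exact ⟨hav, by simp, rfl⟩
    · rintro ⟨h1, h2, rfl⟩
      exact ⟨hxa x (hS.marked_source hG h2 h1), rfl⟩
  · ext ⟨x, y⟩
    rw [mem_induce_edges]
    simp only [Finset.mem_insert, Finset.mem_singleton, Prod.mk.injEq]
    constructor
    · rintro ⟨h1, h2, rfl | rfl | rfl⟩
      · exact .inr (.inl ⟨hxa x (hS.marked_source hG (by simpa using h2) h1), rfl⟩)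
      · exact .inl ⟨hai.2 x h1, rfl⟩
      · exact .inr (.inr ⟨hti.2 x h1, rfl⟩)
    · rintro (⟨rfl, rfl⟩ | ⟨rfl, rfl⟩ | ⟨rfl, rfl⟩)
      · exact ⟨hva, by simp, by simp⟩
      · exact ⟨hav, by simp, by simp⟩
      · exact ⟨hvt, by simp, by simp⟩
  · show ({v, a, t} : Finset ℕ).card = 3
    rw [Finset.card_insert_of_notMem (by simp [hna, hnt]), Finset.card_pair hat]

theorem isPrime_repeatLoop (hG : G.Ordered s₀ pos) (hv : v ∈ G.verts) (hnt : v ≠ t)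
    (hvo : ∀ w, (v, w) ∈ G.edges ↔ w = a) (hao : ∀ w, (a, w) ∈ G.edges ↔ w = v ∨ w = t)
    (hai : a ≠ s₀ ∧ ∀ z, (z, a) ∈ G.edges → z = v) (hti : t ≠ s₀ ∧ ∀ z, (z, t) ∈ G.edges → z = a)
    (hc : ∀ z y, (z, v) ∈ G.cycleEdges → (y, v) ∈ G.cycleEdges → z = y) :
    ∃ H, G.IsPrime H v t ∧ H.verts.card = 3 := by
  have hva := (hvo a).2 rfl
  have hav := (hao v).2 (.inl rfl)
  have hat' := (hao t).2 (.inr rfl)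
  have hna : v ≠ a := by
    rintro rfl
    exact hnt ((hvo t).1 hat').symm
  have hat : a ≠ t := by
    rintro rfl
    exact hna (hai.2 _ hat').symm
  have hS : G.ClosedSet s₀ {v, a, t} v t := by
    refine ⟨by simp, ?_, ?_, ?_, ?_, ?_⟩
    · intro x hx
      simp only [Finset.mem_insert, Finset.mem_singleton] at hx
      rcases hx with rfl | rfl | rfl
      exacts [hv, G.snd_mem hva, G.snd_mem hat']
    · intro x hx h1
      simp only [Finset.mem_insert, Finset.mem_singleton] at hx
      rcases hx with rfl | rfl | rfl
      exacts [absurd rfl h1, hai.1, hti.1]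
    · intro x hx h1 h2
      simp only [Finset.mem_insert, Finset.mem_singleton] at hx
      rcases hx with rfl | rfl | rfl
      exacts [absurd rfl h1, hai.2, absurd rfl h2]
    · intro z hz
      rw [hti.2 z hz]
      exact ⟨by simp, hat⟩
    · intro x hx h1 w hw
      simp only [Finset.mem_insert, Finset.mem_singleton] at hx ⊢
      rcases hx with rfl | rfl | rfl
      · exact .inr (.inl ((hvo w).1 hw))
      · have := (hao w).1 hw
        tauto
      · exact absurd rfl h1
  have hac : (a, v) ∈ G.cycleEdges := hS.marked_source hG (by simp) hav
  have hxa : ∀ x, (x, v) ∈ G.cycleEdges → x = a := fun x hx => hc x a hx hac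
  refine ⟨_, hS.isPrime hG (fun x hx => by rwa [hxa x hx]) (B := {(a, v)}) ?_
    (.repeatLoop a hna hat hnt rfl ?_), ?_⟩
  · intro x y
    simp only [Finset.mem_singleton, Prod.mk.injEq]
    constructor
    · rintro ⟨rfl, rfl⟩
      exact ⟨hav, by simp, rfl⟩
    · rintro ⟨h1, h2, rfl⟩
      exact ⟨hxa x (hS.marked_source hG h2 h1), rfl⟩
  · ext ⟨x, y⟩
    rw [mem_induce_edges]
    simp only [Finset.mem_insert, Finset.mem_singleton, Prod.mk.injEq]
    constructor
    · rintro ⟨h1, h2, rfl | rfl | rfl⟩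
      · exact .inr (.inl ⟨hxa x (hS.marked_source hG (by simpa using h2) h1), rfl⟩)
      · exact .inl ⟨hai.2 x h1, rfl⟩
      · exact .inr (.inr ⟨hti.2 x h1, rfl⟩)
    · rintro (⟨rfl, rfl⟩ | ⟨rfl, rfl⟩ | ⟨rfl, rfl⟩)
      · exact ⟨hva, by simp, by simp⟩
      · exact ⟨hav, by simp, by simp⟩
      · exact ⟨hat', by simp, by simp⟩
  · show ({v, a, t} : Finset ℕ).card = 3
    rw [Finset.card_insert_of_notMem (by simp [hna, hnt]), Finset.card_pair hat]

theorem isPrime_branch (hG : G.Ordered s₀ pos) (hv : v ∈ G.verts) {A : Finset ℕ}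
    (hA : 2 ≤ A.card) (hvo : ∀ w, (v, w) ∈ G.edges ↔ w ∈ A)
    (hao : ∀ a ∈ A, ∀ w, (a, w) ∈ G.edges ↔ w = t)
    (hai : ∀ a ∈ A, a ≠ s₀ ∧ ∀ z, (z, a) ∈ G.edges → z = v)
    (hti : t ≠ s₀ ∧ ∀ z, (z, t) ∈ G.edges → z ∈ A)
    (hc : ∀ z, (z, v) ∉ G.cycleEdges) : ∃ H, G.IsPrime H v t ∧ H.verts.card = A.card + 2 := by
  obtain ⟨a, ha, b, hb, hab⟩ := Finset.one_lt_card.1 hA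
  have hloop : (v, v) ∉ G.edges := fun h => hc v (hG.marked_of_le h le_rfl)
  have hvA : v ∉ A := fun h => hloop ((hvo v).2 h)
  have htA : t ∉ A := by
    intro h
    have h1 := (hai t h).2 a ((hao a ha t).2 rfl)
    exact hvA (h1 ▸ ha)
  have hat := (hao a ha t).2 rfl
  have hva := (hvo a).2 ha
  -- If `t = v`, then the edge `av` goes back, since `a` is reached by the unmarked edge `va`; so it
  -- is marked, against `hc`.
  have hnt : v ≠ t := by
    rintro rfl
    refine hc a (hG.marked_of_le hat ?_)
    obtain e | ⟨z, h3, h4⟩ := (hG.reach a (G.snd_mem hva)).cases_tail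
    · exact absurd e (hai a ha).1
    · have := (hai a ha).2 z h4.1
      rw [this] at h4
      exact (hG.inc h4).le
  have hS : G.ClosedSet s₀ (insert v (insert t A)) v t := by
    refine ⟨by simp, ?_, ?_, ?_, ?_, ?_⟩
    · intro x hx
      simp only [Finset.mem_insert] at hx
      rcases hx with rfl | rfl | hx
      exacts [hv, G.snd_mem hat, G.snd_mem ((hvo x).2 hx)]
    · intro x hx h1
      simp only [Finset.mem_insert] at hx
      rcases hx with rfl | rfl | hx
      exacts [absurd rfl h1, hti.1, (hai x hx).1]
    · intro x hx h1 h2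
      simp only [Finset.mem_insert] at hx
      rcases hx with rfl | rfl | hx
      exacts [absurd rfl h1, absurd rfl h2, (hai x hx).2]
    · intro z hz
      have h := hti.2 z hz
      exact ⟨by simp [h], by rintro rfl; exact htA h⟩
    · intro x hx h1 w hw
      simp only [Finset.mem_insert] at hx ⊢
      rcases hx with rfl | rfl | hx
      · exact .inr (.inr ((hvo w).1 hw))
      · exact absurd rfl h1
      · exact .inr (.inl ((hao x hx w).1 hw))
  have hnv : ∀ z ∈ insert v (insert t A), (z, v) ∉ G.edges := fun z hz h =>
    hc z (hS.marked_source hG hz h)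
  refine ⟨_, hS.isPrime hG (fun x hx => absurd hx (hc x)) (B := ∅) ?_
    (.branch A hA hvA htA hnt rfl ?_), ?_⟩
  · intro x y
    simp only [Finset.notMem_empty, false_iff, not_and]
    rintro h1 h2 rfl
    exact hnv x h2 h1
  · ext ⟨x, y⟩
    rw [mem_induce_edges]
    simp only [Finset.mem_union, Finset.mem_image, Prod.mk.injEq]
    constructor
    · rintro ⟨h1, h2, h3⟩
      simp only [Finset.mem_insert] at h3
      rcases h3 with rfl | rfl | h3
      · exact absurd h1 (hnv x h2)
      · exact .inr ⟨x, hti.2 x h1, rfl, rfl⟩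
      · exact .inl ⟨y, h3, ((hai y h3).2 x h1).symm, rfl⟩
    · rintro (⟨z, hz, rfl, rfl⟩ | ⟨z, hz, rfl, rfl⟩)
      · exact ⟨(hvo z).2 hz, by simp, by simp [hz]⟩
      · exact ⟨(hao z hz _).2 rfl, by simp [hz], by simp⟩
  · show (insert v (insert t A)).card = A.card + 2
    rw [Finset.card_insert_of_notMem (by simp [hvA, hnt]), Finset.card_insert_of_notMem htA]

end MarkedGraph

end Shapes

/-! ### Primes and degree conditions -/

section ShapePrime

namespace MarkedGraph

variable {G : MarkedGraph ℕ} {s₀ : ℕ} {pos : ℕ → ℕ} {lo hi adj deg cyc : ℕ → ℕ} {v x t k : ℕ}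

namespace Represents

theorem not_marked (hR : G.Represents s₀ lo hi adj deg cyc) (hx : x ∈ G.verts) (h : cyc x = 0)
    (z : ℕ) : (z, x) ∉ G.cycleEdges := (hR.cyc_eq_zero hx).1 h z

theorem isPrime_of_oneShape (hR : G.Represents s₀ lo hi adj deg cyc) (hG : G.Ordered s₀ pos)
    (hv : v ∈ G.verts) (hcv : cyc v < 2) (ho : lo v + 1 = hi v)
    (h : OneShape lo hi adj deg cyc v (adj (lo v)) t k) :
    ∃ H, G.IsPrime H v t ∧ H.verts.card = k + 1 := by
  have hvo := hR.out_one hv ho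
  have hvx := (hvo _).2 rfl
  obtain ⟨hd, ⟨h0, rfl, rfl⟩ | ⟨h0, hx, hadj, hdt, rfl⟩⟩ := h
  · exact isPrime_sequence hG hv hvo (hR.in_unique hvx hd) (hR.not_marked hv h0)
  · generalize adj (lo v) = x at *
    have hxm := G.snd_mem hvx
    have hne := hR.out_two_ne hxm hx
    have hxo : ∀ w, (x, w) ∈ G.edges ↔ w = v ∨ w = t := by
      intro w
      rw [hR.out_two hxm hx]
      rcases hadj with ⟨rfl, rfl⟩ | ⟨rfl, rfl⟩
      · rfl
      · exact or_comm
    have hvt : v ≠ t := by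
      rcases hadj with ⟨rfl, rfl⟩ | ⟨rfl, rfl⟩
      exacts [hne, hne.symm]
    exact isPrime_repeatLoop hG hv hvt hvo hxo (hR.in_unique hvx hd)
      (hR.in_unique ((hxo t).2 (.inr rfl)) hdt) fun z y hz hy => hR.cyc_unique hv hy hcv hz

theorem isPrime_of_pairShape (hR : G.Represents s₀ lo hi adj deg cyc) (hG : G.Ordered s₀ pos)
    (hv : v ∈ G.verts) (hcv : cyc v < 2) (ho : lo v + 2 = hi v) (hxt : x ≠ t)
    (hvo : ∀ w, (v, w) ∈ G.edges ↔ w = x ∨ w = t) (h : PairShape lo hi adj deg cyc v x t) :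
    ∃ H, G.IsPrime H v t ∧ H.verts.card = 3 := by
  have hvx := (hvo x).2 (.inl rfl)
  have hvt := (hvo t).2 (.inr rfl)
  obtain ⟨hd, hx, ⟨h0, rfl, hdt⟩ | ⟨h0, rfl, hdt⟩⟩ := h
  · exact isPrime_whileLoop hG hv hxt hvo (hR.out_one (G.snd_mem hvx) hx) (hR.in_unique hvx hd)
      (hR.in_unique hvt hdt) fun z y hz hy => hR.cyc_unique hv hy hcv hz
  · have hxo := hR.out_one (G.snd_mem hvx) hx
    have hne : v ≠ x := by rintro rfl; omega
    have := hR.in_subset (G.snd_mem hvt) (S := {v, x}) (by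
      intro z hz
      simp only [Finset.mem_insert, Finset.mem_singleton] at hz
      rcases hz with rfl | rfl
      exacts [hvt, (hxo _).2 rfl]) (by rwa [Finset.card_pair hne])
    exact isPrime_ifThen hG hv hxt hvo hxo (hR.in_unique hvx hd) (by simpa using this)
      (hR.not_marked hv h0)

/-- The lists show all out-neighbors, and the bounds on `deg` turn the in-neighbors seen there into
all in-neighbors. Closedness is thereby checked without lists of in-neighbors. -/
theorem isPrime_of_primeShape (hR : G.Represents s₀ lo hi adj deg cyc) (hG : G.Ordered s₀ pos)
    (hv : v ∈ G.verts) (h : PrimeShape lo hi adj deg cyc v t k) :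
    ∃ H, G.IsPrime H v t ∧ H.verts.card = k + 1 := by
  obtain ⟨hcv, ⟨ho, h⟩ | ⟨ho, rfl, ⟨rfl, h⟩ | ⟨rfl, h⟩⟩ | ⟨d, hd, ho, rfl, h0, hdt, hmid⟩⟩ := h
  · exact hR.isPrime_of_oneShape hG hv hcv ho h
  · exact hR.isPrime_of_pairShape hG hv hcv ho (hR.out_two_ne hv ho) (hR.out_two hv ho) h
  · exact hR.isPrime_of_pairShape hG hv hcv ho (hR.out_two_ne hv ho).symm
      (fun w => (hR.out_two hv ho w).trans or_comm) h
  · have hvo : ∀ w, (v, w) ∈ G.edges ↔ w ∈ (Finset.Ico (lo v) (hi v)).image adj := by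
      intro w
      rw [hR.adjacency.iff v hv, Finset.mem_image]
      simp [and_assoc]
    have hcard := hR.out_eq hv hvo
    generalize hA : (Finset.Ico (lo v) (hi v)).image adj = A at hvo hcard
    have hAm : ∀ a ∈ A, MidShape lo hi adj deg t a := by
      intro a ha
      rw [← hA] at ha
      obtain ⟨i, hi', rfl⟩ := Finset.mem_image.1 ha
      rw [Finset.mem_Ico] at hi'
      exact hmid i hi'.1 hi'.2
    have hao : ∀ a ∈ A, ∀ w, (a, w) ∈ G.edges ↔ w = t := by
      intro a ha w
      rw [hR.out_one (G.snd_mem ((hvo a).2 ha)) (hAm a ha).2.1, (hAm a ha).2.2]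
    obtain ⟨a, ha⟩ := Finset.card_pos.1 (by omega : 0 < A.card)
    obtain ⟨H, h1, h2⟩ := isPrime_branch hG hv (by omega) hvo hao
      (fun a ha => hR.in_unique ((hvo a).2 ha) (hAm a ha).1)
      (hR.in_subset (G.snd_mem ((hao a ha t).2 rfl)) (fun a ha => (hao a ha t).2 rfl) (by omega))
      (hR.not_marked hv h0)
    exact ⟨H, h1, by omega⟩

end Represents

variable {H : FinDigraph ℕ}

namespace IsPrime

theorem out_iff (hp : G.IsPrime H v t) (hx : x ∈ H.verts) (hne : x ≠ t) (w : ℕ) :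
    (x, w) ∈ G.edges ↔ (x, w) ∈ H.edges :=
  ⟨fun h => hp.edge_mem h hx (hp.out_closed h hx hne), hp.edge_of⟩

theorem in_iff (hp : G.IsPrime H v t) (hx : x ∈ H.verts) (hne : x ≠ v) (w : ℕ) :
    (w, x) ∈ G.edges ↔ (w, x) ∈ H.edges :=
  ⟨fun h => hp.edge_mem h (hp.in_closed h hx hne) hx, hp.edge_of⟩

theorem deg_eq (hp : G.IsPrime H v t) (hR : G.Represents s₀ lo hi adj deg cyc)
    (hG : G.Ordered s₀ pos) (hx : x ∈ H.verts) (hne : x ≠ v) {S : Finset ℕ}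
    (hS : ∀ z, (z, x) ∈ H.edges ↔ z ∈ S) : deg x = S.card := by
  refine hR.deg_eq_card (hp.1.1 hx) ?_ fun z => (hp.in_iff hx hne z).trans (hS z)
  rintro rfl
  exact hne (hp.source_eq_of_mem hG hx)

theorem marked_iff (hp : G.IsPrime H v t) (hG : G.Ordered s₀ pos) (z : ℕ) :
    (z, v) ∈ G.cycleEdges ↔ (z, v) ∈ H.edges ∩ G.cycleEdges := by
  rw [Finset.mem_inter]
  exact ⟨fun h => ⟨hp.edge_mem (hG.sub h) (hp.cycle_source_mem h) hp.statement.source_mem, h⟩,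
    fun h => h.2⟩

/-- The completeness of the test, which allows the machine to skip a vertex. In a prime all
in-neighbors of a vertex other than the source and all out-neighbors of a vertex other than the sink
are those inside the prime, so the degrees are those of the statement graph. -/
theorem primeShape (hp : G.IsPrime H v t) (hR : G.Represents s₀ lo hi adj deg cyc)
    (hG : G.Ordered s₀ pos) : ∃ k, PrimeShape lo hi adj deg cyc v t k := by
  have hst := hp.statement
  have hvH := hst.source_mem
  have htH := hst.sink_mem
  have hne := hst.source_ne_sink
  have hvG := hp.1.1 hvH
  have hm := fun z => hp.marked_iff hG z
  have hout := fun {x} => @out_iff G v x t H hp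
  have hdeg := fun {x} => @deg_eq G s₀ pos lo hi adj deg cyc v x t H hp hR hG
  have hmem := hp.1.1
  generalize H.edges ∩ G.cycleEdges = B at hst hm
  have hc0 : B = ∅ → cyc v = 0 := by
    rintro rfl
    rw [hR.cyc_eq_zero hvG]
    simpa using hm
  have hc1 : ∀ a, B = {(a, v)} → cyc v = 1 := by
    rintro a rfl
    exact hR.cyc_eq_one hvG (y := a) (by simpa using hm)
  cases hst with
  | sequence h1 h2 h3 =>
    have hc := hc0 rfl
    have ho := hR.one_of_out hvG (y := t) fun w => by rw [hout hvH hne, h3]; simp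
    have hd := hdeg (S := {v}) htH hne.symm fun z => by rw [h3]; simp
    rw [Finset.card_singleton] at hd
    refine ⟨1, by omega, .inl ⟨ho.1, by rw [ho.2]; omega, .inl ⟨hc, ho.2.symm, rfl⟩⟩⟩
  | ifThen a h1 h2 h3 h4 h5 =>
    have hc := hc0 rfl
    have haH : a ∈ H.verts := by simp [h4]
    have hvo := hR.two_of_out hvG h2 fun w => by
      rw [hout hvH hne, h5]; simp [h1]
    have hao := hR.one_of_out (hmem haH) (y := t) fun w => by
      rw [hout haH h2, h5]; simp [h1.symm]
    have hda := hdeg (S := {v}) haH h1.symm fun z => by rw [h5]; simp [h2]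
    have hdt := hdeg (S := {v, a}) htH hne.symm fun z => by
      rw [h5]; simp [h2.symm, or_comm]
    rw [Finset.card_singleton] at hda
    rw [Finset.card_pair h1] at hdt
    have hps : PairShape lo hi adj deg cyc v a t :=
      ⟨by omega, hao.1, .inr ⟨hc, hao.2, by omega⟩⟩
    refine ⟨2, by omega, .inr (.inl ⟨hvo.1, rfl, ?_⟩)⟩
    rcases hvo.2 with ⟨e1, e2⟩ | ⟨e1, e2⟩
    · exact .inl ⟨e2.symm, by rw [e1]; exact hps⟩
    · exact .inr ⟨e1.symm, by rw [e2]; exact hps⟩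
  | branch A h1 h2 h3 h4 h5 h6 =>
    have hc := hc0 rfl
    have hvo : ∀ w, (v, w) ∈ G.edges ↔ w ∈ A := fun w => by
      rw [hout hvH hne, h6]
      simp only [Finset.mem_union, Finset.mem_image, Prod.mk.injEq]
      constructor
      · rintro (⟨a, ha, -, rfl⟩ | ⟨a, ha, rfl, -⟩)
        exacts [ha, absurd ha h2]
      · exact fun h => .inl ⟨w, h, trivial, rfl⟩
    have hcard := hR.out_eq hvG hvo
    have hdt := hdeg (S := A) htH hne.symm fun z => by
      rw [h6]
      simp only [Finset.mem_union, Finset.mem_image, Prod.mk.injEq]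
      constructor
      · rintro (⟨a, ha, -, rfl⟩ | ⟨a, ha, rfl, -⟩)
        exacts [absurd ha h3, ha]
      · exact fun h => .inr ⟨z, h, rfl, trivial⟩
    refine ⟨A.card + 1, by omega, .inr (.inr ⟨A.card, h1, by omega, rfl, hc, hdt.le, ?_⟩)⟩
    intro i hi1 hi2
    have ha := (hvo _).1 (hR.out_adj hvG hi1 hi2)
    generalize adj i = a at ha ⊢
    have hav : a ≠ v := by rintro rfl; exact h2 ha
    have hat : a ≠ t := by rintro rfl; exact h3 ha
    have haH : a ∈ H.verts := by simp [h5, ha]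
    have hda := hdeg (S := {v}) haH hav fun z => by
      rw [h6]
      simp only [Finset.mem_union, Finset.mem_image, Prod.mk.injEq, Finset.mem_singleton]
      constructor
      · rintro (⟨b, -, rfl, -⟩ | ⟨b, -, -, e⟩)
        exacts [rfl, absurd e.symm hat]
      · exact fun h => .inl ⟨a, ha, h.symm, rfl⟩
    have hao := hR.one_of_out (hmem haH) (y := t) fun w => by
      rw [hout haH hat, h6]
      simp only [Finset.mem_union, Finset.mem_image, Prod.mk.injEq]
      constructor
      · rintro (⟨b, -, e, -⟩ | ⟨b, -, -, e⟩)
        exacts [absurd e.symm hav, e.symm]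
      · exact fun h => .inr ⟨a, ha, rfl, h.symm⟩
    rw [Finset.card_singleton] at hda
    exact ⟨by omega, hao⟩
  | whileLoop a h1 h2 h3 h4 h5 =>
    have hc := hc1 a rfl
    have haH : a ∈ H.verts := by simp [h4]
    have hvo := hR.two_of_out hvG h2 fun w => by
      rw [hout hvH hne, h5]; simp [h1]
    have hao := hR.one_of_out (hmem haH) (y := v) fun w => by
      rw [hout haH h2, h5]; simp [h1.symm]
    have hda := hdeg (S := {v}) haH h1.symm fun z => by rw [h5]; simp [h2, h1.symm]
    have hdt := hdeg (S := {v}) htH hne.symm fun z => by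
      rw [h5]; simp [h2.symm, hne.symm]
    rw [Finset.card_singleton] at hda hdt
    have hps : PairShape lo hi adj deg cyc v a t :=
      ⟨by omega, hao.1, .inl ⟨by omega, hao.2, by omega⟩⟩
    refine ⟨2, by omega, .inr (.inl ⟨hvo.1, rfl, ?_⟩)⟩
    rcases hvo.2 with ⟨e1, e2⟩ | ⟨e1, e2⟩
    · exact .inl ⟨e2.symm, by rw [e1]; exact hps⟩
    · exact .inr ⟨e1.symm, by rw [e2]; exact hps⟩
  | repeatLoop a h1 h2 h3 h4 h5 =>
    have hc := hc1 a rfl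
    have haH : a ∈ H.verts := by simp [h4]
    have hvo := hR.one_of_out hvG (y := a) fun w => by
      rw [hout hvH hne, h5]; simp [h1]
    have hao := hR.two_of_out (hmem haH) hne fun w => by
      rw [hout haH h2, h5]; simp [h1.symm]
    have hda := hdeg (S := {v}) haH h1.symm fun z => by rw [h5]; simp [h2, h1.symm]
    have hdt := hdeg (S := {a}) htH hne.symm fun z => by
      rw [h5]; simp [h2.symm, hne.symm]
    rw [Finset.card_singleton] at hda hdt
    refine ⟨2, by omega, .inl ⟨hvo.1, ?_⟩⟩
    rw [hvo.2]
    refine ⟨by omega, .inr ⟨by omega, hao.1, ?_, by omega, rfl⟩⟩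
    rcases hao.2 with ⟨e1, e2⟩ | ⟨e1, e2⟩
    · exact .inl ⟨e1, e2.symm⟩
    · exact .inr ⟨e2, e1.symm⟩

end IsPrime

end MarkedGraph

end ShapePrime

/-! ### Contraction in the representation -/

section ContractRepresents

namespace MarkedGraph

variable {G : MarkedGraph ℕ} {H : FinDigraph ℕ} {s₀ : ℕ} {pos : ℕ → ℕ}
  {lo hi adj deg cyc : ℕ → ℕ} {v t x w : ℕ} {E : Finset (ℕ × ℕ)}

namespace IsPrime

theorem mem_collapseEdges_sink (hp : G.IsPrime H v t) (hE : E ⊆ G.edges) :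
    (v, w) ∈ collapseEdges H.verts v E ↔ (t, w) ∈ E := by
  have hv := hp.statement.source_mem
  have ht := hp.statement.sink_mem
  constructor
  · intro h
    obtain ⟨p, q, hpq, hn, e1, e2⟩ := mem_collapseEdges.1 h
    have hpH := (collapse_eq_source hv).1 e1
    rw [hp.collapse_snd (hE hpq) hn] at e2
    rcases hp.cross (hE hpq) hn with h' | ⟨rfl, -⟩ | h'
    · exact absurd hpH h'.1
    · rwa [← e2]
    · exact absurd hpH h'.1
  · intro h
    have hw := hp.no_sink_out (hE h)
    exact mem_collapseEdges.2 ⟨t, w, h, fun h => hw h.2, collapse_inside ht, collapse_outside hw⟩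

theorem mem_collapseEdges_left (hp : G.IsPrime H v t) (hE : E ⊆ G.edges) (hx : x ∉ H.verts) :
    (x, w) ∈ collapseEdges H.verts v E ↔ (x, w) ∈ E := by
  have hv := hp.statement.source_mem
  constructor
  · intro h
    obtain ⟨p, q, hpq, hn, e1, e2⟩ := mem_collapseEdges.1 h
    rw [hp.collapse_snd (hE hpq) hn] at e2
    rw [collapse_eq_of_notMem hv hx] at e1
    rwa [← e1, ← e2]
  · intro h
    have hn : ¬ (x ∈ H.verts ∧ w ∈ H.verts) := fun h => hx h.1
    exact mem_collapseEdges.2 ⟨x, w, h, hn, collapse_outside hx, hp.collapse_snd (hE h) hn⟩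

theorem mem_collapseEdges_source (hp : G.IsPrime H v t) (hE : E ⊆ G.edges) :
    (x, v) ∈ collapseEdges H.verts v E ↔ (x, v) ∈ E ∧ x ∉ H.verts := by
  have hv := hp.statement.source_mem
  constructor
  · intro h
    obtain ⟨p, q, hpq, hn, e1, e2⟩ := mem_collapseEdges.1 h
    rw [hp.collapse_snd (hE hpq) hn] at e2
    subst e2
    have hpH : p ∉ H.verts := fun h => hn ⟨h, hv⟩
    rw [collapse_outside hpH] at e1
    subst e1
    exact ⟨hpq, hpH⟩
  · exact fun h => (hp.mem_collapseEdges_left hE h.2).2 h.1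

theorem card_collapseEdges (hp : G.IsPrime H v t) (hE : E ⊆ G.edges) (hx : x ∉ H.verts) :
    ((collapseEdges H.verts v E).filter fun e => e.2 = x).card =
      (E.filter fun e => e.2 = x).card := by
  have hv := hp.statement.source_mem
  have : (collapseEdges H.verts v E).filter (fun e => e.2 = x) =
      (E.filter fun e => e.2 = x).image fun e => (collapse H.verts v e.1, e.2) := by
    ext ⟨p, q⟩
    simp only [Finset.mem_filter, Finset.mem_image, Prod.exists, Prod.mk.injEq]
    constructor
    · rintro ⟨h, rfl⟩
      obtain ⟨a, b, hab, hn, e1, e2⟩ := mem_collapseEdges.1 h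
      rw [hp.collapse_snd (hE hab) hn] at e2
      exact ⟨a, b, ⟨hab, e2⟩, e1, e2⟩
    · rintro ⟨a, b, ⟨hab, rfl⟩, e1, rfl⟩
      exact ⟨mem_collapseEdges.2 ⟨a, b, hab, fun h => hx h.2, e1, collapse_outside hx⟩, rfl⟩
  rw [this, Finset.card_image_of_injOn]
  rintro ⟨a, b⟩ h ⟨c, d⟩ h' e
  simp only [Finset.coe_filter, Set.mem_ofPred_eq] at h h'
  obtain ⟨h1, rfl⟩ := h
  obtain ⟨h2, rfl⟩ := h'
  exact Prod.ext (hp.collapse_inj (hE h1) (fun h => hx h.2) (hE h2) (fun h => hx h.2)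
    (Prod.mk.inj e).1 rfl).1 rfl

theorem marked_source_iff (hp : G.IsPrime H v t) (hG : G.Ordered s₀ pos) (h : (x, v) ∈ G.edges) :
    (x, v) ∈ G.cycleEdges ↔ x ∈ H.verts :=
  ⟨hp.cycle_source_mem, fun hx => hG.marked_of_le h (hp.pos_le hG hx)⟩

end IsPrime

/-- The out-edges of the contracted vertex are those of the sink, so it takes over the segment of
the sink. Heads do not move and no edges merge, so the counters of all other remaining vertices are
unchanged. -/
theorem Represents.contract (hR : G.Represents s₀ lo hi adj deg cyc) (hG : G.Ordered s₀ pos)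
    (hp : G.IsPrime H v t) :
    (G.contract H v).Represents s₀ (Function.update lo v (lo t)) (Function.update hi v (hi t)) adj
      (Function.update deg v (deg v - cyc v)) (Function.update cyc v 0) := by
  have hvH := hp.statement.source_mem
  have hvG := hp.1.1 hvH
  have htG := hp.1.1 hp.statement.sink_mem
  have hout : ∀ {x}, x ∈ (G.contract H v).verts → x ≠ v → x ∈ G.verts ∧ x ∉ H.verts := by
    intro x hx hne
    have := hp.mem_contract_verts.1 hx
    exact ⟨this.1, fun h => hne (this.2 h)⟩
  refine ⟨⟨?_, ?_⟩, ?_, ?_⟩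
  · intro u hu w
    by_cases huv : u = v
    · subst huv
      simp only [Function.update_self]
      rw [← hR.adjacency.iff t htG]
      exact hp.mem_collapseEdges_sink subset_rfl
    · obtain ⟨h1, h2⟩ := hout hu huv
      simp only [Function.update_of_ne huv]
      rw [← hR.adjacency.iff u h1]
      exact hp.mem_collapseEdges_left subset_rfl h2
  · intro u hu
    by_cases huv : u = v
    · subst huv
      simp only [Function.update_self]
      exact hR.adjacency.inj t htG
    · simp only [Function.update_of_ne huv]
      exact hR.adjacency.inj u (hout hu huv).1
  · intro x hx
    by_cases hxv : x = v
    · subst hxv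
      rw [Function.update_self, hR.deg_eq x hvG, hR.cyc_eq x hvG]
      have hsub : (G.cycleEdges.filter fun e => e.2 = x) ⊆ G.edges.filter fun e => e.2 = x :=
        Finset.filter_subset_filter _ hG.sub
      -- The in-edges lost by the source are those from inside the prime, and these are exactly its
      -- marked in-edges.
      have : (G.contract H x).edges.filter (fun e => e.2 = x) =
          (G.edges.filter fun e => e.2 = x) \ G.cycleEdges.filter fun e => e.2 = x := by
        ext ⟨p, q⟩
        simp only [Finset.mem_filter, Finset.mem_sdiff]
        constructor
        · rintro ⟨h, rfl⟩
          obtain ⟨h1, h2⟩ := (hp.mem_collapseEdges_source subset_rfl).1 h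
          exact ⟨⟨h1, rfl⟩, fun h => h2 (hp.cycle_source_mem h.1)⟩
        · rintro ⟨⟨h, rfl⟩, h2⟩
          refine ⟨(hp.mem_collapseEdges_source subset_rfl).2 ⟨h, fun h3 => h2 ⟨?_, rfl⟩⟩, rfl⟩
          exact (hp.marked_source_iff hG h).2 h3
      rw [this, Finset.card_sdiff_of_subset hsub]
      have := Finset.card_le_card hsub
      omega
    · obtain ⟨h1, h2⟩ := hout hx hxv
      rw [Function.update_of_ne hxv, hR.deg_eq x h1]
      congr 1
      exact (hp.card_collapseEdges subset_rfl h2).symm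
  · intro x hx
    by_cases hxv : x = v
    · subst hxv
      rw [Function.update_self, eq_comm, Finset.card_eq_zero, Finset.filter_eq_empty_iff]
      rintro ⟨p, q⟩ h rfl
      obtain ⟨h1, h2⟩ := (hp.mem_collapseEdges_source hG.sub).1 h
      exact h2 (hp.cycle_source_mem h1)
    · obtain ⟨h1, h2⟩ := hout hx hxv
      rw [Function.update_of_ne hxv, hR.cyc_eq x h1]
      exact (hp.card_collapseEdges hG.sub h2).symm

end MarkedGraph

end ContractRepresents

/-! ### The search for a prime -/

section Detection

namespace Prog

/-- An instruction without effect on the registers in use. -/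
def skip : Prog := const 32 0

/-- If `x = y` then `p` else `q`. -/
def ifEq (x y : ℕ) (p q : Prog) : Prog := ifLt x y q (ifLt y x q p)

theorem halts_ifEq {x y : ℕ} {p q : Prog} {σ : Store} {Q : ℕ → Store → Prop} :
    (ifEq x y p q).Halts σ Q ↔
      if σ.reg x = σ.reg y then p.Halts σ fun t σ' => Q (t + 2) σ'
      else q.Halts σ fun t σ' => Q (t + if σ.reg x < σ.reg y then 1 else 2) σ' := by
  simp only [ifEq, halts_ifLt]
  rcases lt_trichotomy (σ.reg x) (σ.reg y) with h | h | h
  · simp [h, h.ne]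
  · simp [h]
  · simp [h, h.not_gt, h.ne']

/-- With a variable as postcondition, symbolic execution rewrites the program only, and each branch
ends in one application of the hypothesis. -/
theorem Halts.intro {p : Prog} {σ : Store} {Q : ℕ → Store → Prop}
    (h : ∀ Q' : ℕ → Store → Prop, (∀ t σ', Q t σ' → Q' t σ') → p.Halts σ Q') : p.Halts σ Q :=
  h Q fun _ _ => id

end Prog

open Prog

/-- The sink is in register `t`, and `k + 1` vertices are merged into one. -/
def accept (t : ℕ) (rest : Prog) : Prog :=
  .seq (const 18 1) (.seq (copy 19 t) (.seq (copy 20 35) (.seq (decr 20) rest)))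

/-- Tests `OneShape` for the vertices in the registers 14 and 21. -/
def testOne : Prog :=
  .seq (load 25 8 21) <| .ifLt 25 12
    (.ifLt 9 17
      (.seq (load 26 0 21) <| .seq (load 27 1 21) <| .seq (load 28 2 26) <| .seq (incr 26) <|
        .seq (load 29 2 26) <| .seq (incr 26) <| ifEq 26 27
          (ifEq 28 14
            (.seq (load 30 8 29) (.ifLt 30 12 (accept 29 (decr 20)) skip))
            (ifEq 29 14 (.seq (load 30 8 28) (.ifLt 30 12 (accept 28 (decr 20)) skip)) skip))
          skip)
      (accept 21 skip))
    skip

/-- Tests `PairShape` for the vertices in the registers 14, `x` and `y`. -/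
def testPair (x y : ℕ) : Prog :=
  .seq (load 25 8 x) <| .seq (load 26 0 x) <| .seq (load 27 1 x) <| .seq (load 28 2 26) <|
    .seq (incr 26) <| .seq (load 29 8 y) <| .ifLt 25 12
      (ifEq 26 27
        (.ifLt 9 17
          (ifEq 28 14 (.ifLt 29 12 (accept y (decr 20)) skip) skip)
          (ifEq 28 y (.ifLt 12 29 skip (accept y (decr 20))) skip))
        skip)
      skip

/-- Tests the middle vertices that are listed between the registers 30 and 16. -/
def scanBranch : Prog :=
  .whileLt 30 16 <|
    .seq (load 21 2 30) <| .seq (load 25 8 21) <| .seq (load 26 0 21) <| .seq (load 27 1 21) <|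
    .seq (load 28 2 26) <| .seq (incr 26) <| .seq (incr 30) <| .seq (decr 29) <| .seq (decr 20) <|
      .ifLt 25 12 (ifEq 26 27 (ifEq 28 19 skip (const 18 0)) (const 18 0)) (const 18 0)

/-- Tests for a branching graph whose first middle vertex is in register 21. -/
def testBranch : Prog :=
  .ifLt 9 17 skip <| .seq (load 22 0 21) <| .seq (load 22 2 22) <| .seq (load 29 8 22) <|
    .seq (copy 30 15) <| .seq (accept 22 skip) <| .seq scanBranch <|
      .ifLt 9 29 (const 18 0) skip

/-- Runs `p` unless the previous test has succeeded. -/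
def orElse (p : Prog) : Prog := .ifLt 9 18 skip p

/-- Searches for a prime with the source in register 14. -/
def findPrime : Prog :=
  .seq (const 18 0) <| .seq (load 15 0 14) <| .seq (load 16 1 14) <| .seq (load 17 9 14) <|
    .ifLt 15 16
      (.ifLt 17 12
        (.seq (load 21 2 15) <| .seq (copy 22 15) <| .seq (incr 22) <| .seq (load 24 2 22) <|
          .ifLt 22 16
            (.seq (incr 22) <|
              .seq (.ifLt 22 16 skip (.seq (testPair 21 24) (orElse (testPair 24 21)))) <|
                orElse testBranch)
            testOne)
        skip)
      skip

/-- The stores `σ` and `σ'` agree except for the temporary registers of the search. -/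
structure Store.AgreesWith (σ σ' : Store) : Prop where
  arr : σ'.arr = σ.arr
  reg : ∀ x, x < 15 ∨ 32 < x → σ'.reg x = σ.reg x

theorem Store.AgreesWith.trans {σ σ₁ σ₂ : Store} (h : σ.AgreesWith σ₁) (h' : σ₁.AgreesWith σ₂) :
    σ.AgreesWith σ₂ :=
  ⟨h'.arr.trans h.arr, fun x hx => (h'.reg x hx).trans (h.reg x hx)⟩

theorem Store.AgreesWith.refl (σ : Store) : σ.AgreesWith σ := ⟨rfl, fun _ _ => rfl⟩

theorem Store.AgreesWith.setReg {σ σ' : Store} (h : σ.AgreesWith σ') {x k : ℕ} (h1 : 15 ≤ x)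
    (h2 : x ≤ 32) : σ.AgreesWith (σ'.setReg x k) := by
  refine ⟨h.arr, fun y hy => ?_⟩
  rw [Store.reg_setReg, if_neg (by omega)]
  exact h.reg y hy

/-- The answer of a test: register 18 tells whether `P t k` holds for some `t` and `k`; if so, then
`t` is in register 19 and the number of vertices that remain is in register 20. -/
def Store.Answers (σ : Store) (P : ℕ → ℕ → Prop) : Prop :=
  (σ.reg 18 = 1 ∧ ∃ k, P (σ.reg 19) k ∧ σ.reg 20 = σ.reg 35 - k) ∨
    (σ.reg 18 = 0 ∧ ∀ t k, ¬ P t k)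

variable {σ : Store}

theorem testOne_halts (h9 : σ.reg 9 = 0) (h12 : σ.reg 12 = 2) (h18 : σ.reg 18 = 0)
    (h17 : σ.reg 17 = σ.arr 9 (σ.reg 14)) :
    testOne.Halts σ fun n σ' => n ≤ 30 ∧ σ.AgreesWith σ' ∧ σ'.Answers
      (OneShape (σ.arr 0) (σ.arr 1) (σ.arr 2) (σ.arr 8) (σ.arr 9) (σ.reg 14) (σ.reg 21)) := by
  refine Halts.intro fun Q hQ => ?_
  simp only [testOne, accept, skip, halts_seq, halts_load, halts_ifLt, halts_ifEq, halts_const,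
    halts_copy, halts_incr, halts_decr, Store.reg_setReg, Store.arr_setReg]
  simp only [Nat.reduceEqDiff, if_true, if_false, h9, h12, h17]
  split_ifs
  all_goals
    refine hQ _ _ ⟨by omega, ?_, ?_⟩
    · repeat' first | exact .refl σ | refine Store.AgreesWith.setReg ?_ (by norm_num) (by norm_num)
    · simp only [Store.Answers, Store.reg_setReg, Nat.reduceEqDiff, if_true, if_false, OneShape,
        h18]
      first
      | left
        exact ⟨trivial, 1, ⟨by omega, .inl ⟨by omega, by trivial, rfl⟩⟩, rfl⟩
      | left
        exact ⟨trivial, 2, ⟨by omega, .inr ⟨by omega, by omega, .inl ⟨by omega, by trivial⟩,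
          by omega, rfl⟩⟩, by omega⟩
      | left
        exact ⟨trivial, 2, ⟨by omega, .inr ⟨by omega, by omega, .inr ⟨by omega, by trivial⟩,
          by omega, rfl⟩⟩, by omega⟩
      | right
        refine ⟨trivial, ?_⟩
        rintro t k ⟨h1, ⟨h2, rfl, rfl⟩ | ⟨h2, h3, ⟨h4, rfl⟩ | ⟨h4, rfl⟩, h5, rfl⟩⟩ <;>
          first | omega | grind

/-- The listed registers are temporary, hence not covered by `AgreesWith`, but the tests that follow
a failure still read them. -/
theorem testPair_halts {x y : ℕ} (hxy : x = 21 ∧ y = 24 ∨ x = 24 ∧ y = 21) (h9 : σ.reg 9 = 0)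
    (h12 : σ.reg 12 = 2) (h18 : σ.reg 18 = 0) (h17 : σ.reg 17 = σ.arr 9 (σ.reg 14)) :
    (testPair x y).Halts σ fun n σ' => n ≤ 30 ∧ σ.AgreesWith σ' ∧
      (∀ z ∈ [15, 16, 17, 21, 22, 24], σ'.reg z = σ.reg z) ∧
      σ'.Answers fun t k => k = 2 ∧ t = σ.reg y ∧
        PairShape (σ.arr 0) (σ.arr 1) (σ.arr 2) (σ.arr 8) (σ.arr 9) (σ.reg 14) (σ.reg x) t := by
  rcases hxy with ⟨rfl, rfl⟩ | ⟨rfl, rfl⟩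
  all_goals
    refine Halts.intro fun Q hQ => ?_
    simp only [testPair, accept, skip, halts_seq, halts_load, halts_ifLt, halts_ifEq, halts_const,
      halts_copy, halts_incr, halts_decr, Store.reg_setReg, Store.arr_setReg]
    simp only [Nat.reduceEqDiff, if_true, if_false, h9, h12, h17]
    split_ifs
  all_goals
    refine hQ _ _ ⟨by omega, ?_, by simp [Store.reg_setReg], ?_⟩
    · repeat' first | exact .refl σ | refine Store.AgreesWith.setReg ?_ (by norm_num) (by norm_num)
    · simp only [Store.Answers, Store.reg_setReg, Nat.reduceEqDiff, if_true, if_false, PairShape,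
        h18]
      first
      | left; exact ⟨trivial, 2, ⟨rfl, by trivial, by omega⟩, by omega⟩
      | right; refine ⟨trivial, ?_⟩; rintro t k ⟨-, rfl, h⟩; omega

/-- The condition `PrimeShape` for a branching graph. -/
def BranchShape (lo hi adj deg cyc : ℕ → ℕ) (v t k : ℕ) : Prop :=
  k = hi v - lo v + 1 ∧ cyc v = 0 ∧ deg t ≤ hi v - lo v ∧
    ∀ i, lo v ≤ i → i < hi v → MidShape lo hi adj deg t (adj i)

/-- The scan continues after a failure, so the counters in the registers 20 and 29 always drop by
the length of the list. -/
theorem scanBranch_halts {l h : ℕ} (hh : σ.reg 16 = h) (h12 : σ.reg 12 = 2)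
    (hlh : l ≤ h) (h30 : σ.reg 30 = l) (h18 : σ.reg 18 = 1) {P : ℕ → Prop}
    (hP : ∀ i, P i ↔ MidShape (σ.arr 0) (σ.arr 1) (σ.arr 2) (σ.arr 8) (σ.reg 19) (σ.arr 2 i)) :
    scanBranch.Halts σ fun n σ' => n ≤ 20 * (h - l) + 1 ∧ σ.AgreesWith σ' ∧
      σ'.reg 19 = σ.reg 19 ∧ σ'.reg 20 = σ.reg 20 - (h - l) ∧ σ'.reg 29 = σ.reg 29 - (h - l) ∧
      ((σ'.reg 18 = 1 ∧ ∀ i, l ≤ i → i < h → P i) ∨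
        (σ'.reg 18 = 0 ∧ ∃ i, l ≤ i ∧ i < h ∧ ¬ P i)) := by
  refine Prog.Halts.mono (halts_whileLt
    (fun φ σ' => σ.AgreesWith σ' ∧ σ'.reg 16 = h ∧ l ≤ σ'.reg 30 ∧ σ'.reg 30 ≤ h ∧
      φ = 20 * (h - σ'.reg 30) ∧ σ'.reg 19 = σ.reg 19 ∧
      σ'.reg 20 = σ.reg 20 - (σ'.reg 30 - l) ∧ σ'.reg 29 = σ.reg 29 - (σ'.reg 30 - l) ∧
      ((σ'.reg 18 = 1 ∧ ∀ i, l ≤ i → i < σ'.reg 30 → P i) ∨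
        (σ'.reg 18 = 0 ∧ ∃ i, l ≤ i ∧ i < σ'.reg 30 ∧ ¬ P i))) ?_
    (φ := 20 * (h - l)) ?_) ?_
  · rintro φ τ ⟨ha, h16, h1, h2, rfl, h19, h20, h29, hor⟩ hlt
    refine Halts.intro fun Q hQ => ?_
    have h12' := (ha.reg 12 (.inl (by norm_num))).trans h12
    have hPi := hP (τ.reg 30)
    simp only [MidShape] at hPi
    simp only [skip, halts_seq, halts_load, halts_ifLt, halts_ifEq, halts_const, halts_incr, halts_decr, Store.reg_setReg, Store.arr_setReg]
    simp only [Nat.reduceEqDiff, if_true, if_false, h12', h19, ha.arr]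
    rw [h16] at hlt
    split_ifs
    all_goals
      refine hQ _ _ ⟨20 * (h - (τ.reg 30 + 1)), ⟨?_, ?_⟩, by omega⟩
      · repeat' first | exact ha | refine Store.AgreesWith.setReg ?_ (by norm_num) (by norm_num)
      · simp only [Store.reg_setReg, Nat.reduceEqDiff, if_true, if_false, h19, h20, h29, h16]
        refine ⟨trivial, by omega, by omega, trivial, trivial, by omega, by omega, ?_⟩
        first
        | right
          exact ⟨trivial, τ.reg 30, h1, by omega, fun hh => by rw [hPi] at hh; omega⟩
        | rcases hor with ⟨e, hall⟩ | ⟨e, i, hi1, hi2, hi3⟩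
          · left
            refine ⟨e, fun i hi1 hi2 => ?_⟩
            rcases Nat.lt_succ_iff_lt_or_eq.1 hi2 with hi3 | rfl
            · exact hall i hi1 hi3
            · exact hPi.2 (by omega)
          · exact .inr ⟨e, i, hi1, by omega, hi3⟩
  · exact ⟨.refl σ, hh, h30.ge, h30.trans_le hlh, by rw [h30], rfl, by omega, by omega,
      .inl ⟨h18, by omega⟩⟩
  · rintro n τ ⟨φ, ⟨ha, h16, h1, h2, rfl, h19, h20, h29, hor⟩, hlt, hn⟩
    have : τ.reg 30 = h := by omega
    rw [this] at h20 h29 hor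
    exact ⟨by omega, ha, h19, h20, h29, hor⟩

/-- The only candidate for the sink is the first out-neighbor of the first middle vertex. Register
29 starts with the degree of this candidate and drops by one for each middle vertex; it ends
positive exactly if the degree is too large. -/
theorem testBranch_halts (h9 : σ.reg 9 = 0) (h12 : σ.reg 12 = 2) (h18 : σ.reg 18 = 0)
    (h15 : σ.reg 15 = σ.arr 0 (σ.reg 14)) (h16 : σ.reg 16 = σ.arr 1 (σ.reg 14))
    (h17 : σ.reg 17 = σ.arr 9 (σ.reg 14)) (hlt : σ.reg 15 < σ.reg 16)
    (h21 : σ.reg 21 = σ.arr 2 (σ.reg 15)) :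
    testBranch.Halts σ fun n σ' =>
      n ≤ 20 * (σ.arr 1 (σ.reg 14) - σ.arr 0 (σ.reg 14)) + 20 ∧ σ.AgreesWith σ' ∧ σ'.Answers
      (BranchShape (σ.arr 0) (σ.arr 1) (σ.arr 2) (σ.arr 8) (σ.arr 9) (σ.reg 14)) := by
  refine Halts.intro fun Q hQ => ?_
  simp only [testBranch, accept, skip, halts_seq, halts_load, halts_ifLt, halts_const,
    halts_copy, halts_decr, Store.reg_setReg, Store.arr_setReg]
  simp only [Nat.reduceEqDiff, if_true, if_false, h9, h17]
  split_ifs with hc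
  · refine hQ _ _ ⟨by omega, (Store.AgreesWith.refl σ).setReg (by norm_num) (by norm_num),
      .inr ⟨?_, ?_⟩⟩
    · rw [Store.reg_setReg, if_neg (by norm_num), h18]
    · rintro t k ⟨-, h, -⟩
      omega
  · refine Halts.mono (scanBranch_halts (l := σ.arr 0 (σ.reg 14)) (h := σ.arr 1 (σ.reg 14))
      (P := fun i => MidShape (σ.arr 0) (σ.arr 1) (σ.arr 2) (σ.arr 8)
        (σ.arr 2 (σ.arr 0 (σ.reg 21))) (σ.arr 2 i)) ?_ ?_ (by omega) ?_ ?_ ?_) ?_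
    · simpa [Store.reg_setReg] using h16
    · simpa [Store.reg_setReg] using h12
    · simpa [Store.reg_setReg] using h15
    · simp [Store.reg_setReg]
    · simp [Store.reg_setReg, Store.arr_setReg]
    · rintro n τ ⟨hn, ha, h19, h20, h29, hor⟩
      simp only [Store.reg_setReg, Nat.reduceEqDiff, if_true, if_false] at h19 h20 h29
      have ha' : σ.AgreesWith τ := by
        refine Store.AgreesWith.trans ?_ ha
        repeat' first | exact .refl σ | refine Store.AgreesWith.setReg ?_ (by norm_num) (by norm_num)
      have h9' := (ha'.reg 9 (.inl (by norm_num))).trans h9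
      have h35 := ha'.reg 35 (.inr (by norm_num))
      have ht : ∀ t k, BranchShape (σ.arr 0) (σ.arr 1) (σ.arr 2) (σ.arr 8) (σ.arr 9) (σ.reg 14) t k →
          t = σ.arr 2 (σ.arr 0 (σ.reg 21)) := by
        rintro t k ⟨-, -, -, h⟩
        have := (h (σ.reg 15) (by omega) (by omega)).2.2
        rw [← this, h21]
      rw [h9']
      split_ifs with hd
      · refine hQ _ _ ⟨by omega, ha'.setReg (by norm_num) (by norm_num), .inr ⟨?_, ?_⟩⟩
        · simp [Store.reg_setReg]
        · intro t k h
          obtain rfl := ht t k h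
          have := h.2.2.1
          omega
      · refine hQ _ _ ⟨by omega, ha'.setReg (by norm_num) (by norm_num), ?_⟩
        simp only [Store.Answers, Store.reg_setReg, Nat.reduceEqDiff, if_false]
        rcases hor with ⟨e, hall⟩ | ⟨e, i, hi1, hi2, hi3⟩
        · refine .inl ⟨e, _, ⟨rfl, by omega, ?_, ?_⟩, by omega⟩
          · rw [h19]; omega
          · rw [h19]; exact hall
        · refine .inr ⟨e, fun t k h => ?_⟩
          obtain rfl := ht t k h
          exact hi3 (h.2.2.2 i hi1 hi2)

end Detection

/-! ### Correctness of the search for a prime -/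

section DetectionCorrect

open Prog

variable {σ : Store}

theorem primeShape_iff_branchShape {lo hi adj deg cyc : ℕ → ℕ} {v : ℕ} (hc : cyc v < 2)
    (h : lo v + 2 < hi v) (t k : ℕ) :
    PrimeShape lo hi adj deg cyc v t k ↔ BranchShape lo hi adj deg cyc v t k := by
  constructor
  · rintro ⟨-, ⟨h1, -⟩ | ⟨h1, -⟩ | ⟨d, hd, h1, h2, h3, h4, h5⟩⟩
    · omega
    · omega
    · exact ⟨by omega, h3, by omega, h5⟩
  · rintro ⟨h1, h2, h3, h4⟩
    exact ⟨hc, .inr (.inr ⟨hi v - lo v, by omega, by omega, h1, h2, h3, h4⟩)⟩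

theorem primeShape_iff_pairShape {lo hi adj deg cyc : ℕ → ℕ} {v : ℕ} (hc : cyc v < 2)
    (h : lo v + 2 = hi v) (t k : ℕ) :
    PrimeShape lo hi adj deg cyc v t k ↔
      (k = 2 ∧ t = adj (lo v + 1) ∧ PairShape lo hi adj deg cyc v (adj (lo v)) t) ∨
      (k = 2 ∧ t = adj (lo v) ∧ PairShape lo hi adj deg cyc v (adj (lo v + 1)) t) ∨
      BranchShape lo hi adj deg cyc v t k := by
  constructor
  · rintro ⟨-, ⟨h1, -⟩ | ⟨h1, h2, ⟨h3, h4⟩ | ⟨h3, h4⟩⟩ | ⟨d, hd, h1, h2, h3, h4, h5⟩⟩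
    · omega
    · exact .inl ⟨h2, h3, h4⟩
    · exact .inr (.inl ⟨h2, h3, h4⟩)
    · exact .inr (.inr ⟨by omega, h3, by omega, h5⟩)
  · rintro (⟨h1, h2, h3⟩ | ⟨h1, h2, h3⟩ | ⟨h1, h2, h3, h4⟩)
    · exact ⟨hc, .inr (.inl ⟨h, h1, .inl ⟨h2, h3⟩⟩)⟩
    · exact ⟨hc, .inr (.inl ⟨h, h1, .inr ⟨h2, h3⟩⟩)⟩
    · exact ⟨hc, .inr (.inr ⟨hi v - lo v, by omega, by omega, h1, h2, h3, h4⟩)⟩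

theorem primeShape_iff_oneShape {lo hi adj deg cyc : ℕ → ℕ} {v : ℕ} (hc : cyc v < 2)
    (h : lo v + 1 = hi v) (t k : ℕ) :
    PrimeShape lo hi adj deg cyc v t k ↔ OneShape lo hi adj deg cyc v (adj (lo v)) t k := by
  constructor
  · rintro ⟨-, ⟨-, h1⟩ | ⟨h1, -⟩ | ⟨d, hd, h1, -⟩⟩
    · exact h1
    · omega
    · omega
  · exact fun h1 => ⟨hc, .inl ⟨h, h1⟩⟩

theorem Store.Answers.congr {P P' : ℕ → ℕ → Prop} (h : σ.Answers P) (hP : ∀ t k, P t k ↔ P' t k) :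
    σ.Answers P' := by
  rwa [show P' = P by ext t k; exact (hP t k).symm]

theorem Store.Answers.or_right {P P' : ℕ → ℕ → Prop} (h : σ.Answers P) (h18 : σ.reg 18 ≠ 0) :
    σ.Answers fun t k => P t k ∨ P' t k := by
  rcases h with ⟨h1, k, h2, h3⟩ | ⟨h1, -⟩
  · exact .inl ⟨h1, k, .inl h2, h3⟩
  · exact absurd h1 h18

theorem Store.Answers.or_left {P P' : ℕ → ℕ → Prop} (h : σ.Answers P') (hP : ∀ t k, ¬ P t k) :
    σ.Answers fun t k => P t k ∨ P' t k :=
  h.congr fun t k => by simp [hP t k]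

theorem Store.Answers.not_of_eq_zero {P : ℕ → ℕ → Prop} (h : σ.Answers P) (h18 : σ.reg 18 = 0) :
    ∀ t k, ¬ P t k := by
  rcases h with ⟨h1, -⟩ | ⟨-, h2⟩
  · omega
  · exact h2

theorem Store.Answers.setReg {P : ℕ → ℕ → Prop} (h : σ.Answers P) {x k : ℕ} (hx : 20 < x)
    (hx' : x < 35) : (σ.setReg x k).Answers P := by
  simp only [Store.Answers, Store.reg_setReg]
  rw [if_neg (by omega), if_neg (by omega), if_neg (by omega), if_neg (by omega)]
  exact h

/-- A second test is run only if the first one has failed. -/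
theorem halts_orElse {p : Prog} {P P' : ℕ → ℕ → Prop} {c : ℕ} {K : Store → Prop}
    (h9 : σ.reg 9 = 0) (hP : σ.Answers P) (hK : K (σ.setReg 32 0))
    (hp : σ.reg 18 = 0 →
      p.Halts σ fun n σ' => n ≤ c ∧ σ.AgreesWith σ' ∧ K σ' ∧ σ'.Answers P') :
    (orElse p).Halts σ fun n σ' => n ≤ c + 2 ∧ σ.AgreesWith σ' ∧ K σ' ∧
      σ'.Answers fun t k => P t k ∨ P' t k := by
  rw [orElse, halts_ifLt, h9]
  split_ifs with h
  · rw [skip, halts_const]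
    exact ⟨by omega, (Store.AgreesWith.refl σ).setReg (by norm_num) (by norm_num), hK,
      (hP.or_right h.ne').setReg (by norm_num) (by norm_num)⟩
  · refine (hp (by omega)).mono fun n σ' ⟨h1, h2, hK, h3⟩ => ⟨by omega, h2, hK, h3.or_left ?_⟩
    exact hP.not_of_eq_zero (by omega)

/-- All tests take constant time except the one for branching graphs, which is linear in the length
of the list of the vertex. -/
theorem findPrime_halts (h9 : σ.reg 9 = 0) (h12 : σ.reg 12 = 2) :
    findPrime.Halts σ fun n σ' =>
      n ≤ 20 * (σ.arr 1 (σ.reg 14) - σ.arr 0 (σ.reg 14)) + 130 ∧ σ.AgreesWith σ' ∧ σ'.Answers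
      (PrimeShape (σ.arr 0) (σ.arr 1) (σ.arr 2) (σ.arr 8) (σ.arr 9) (σ.reg 14)) := by
  refine Halts.intro fun Q hQ => ?_
  simp only [findPrime, halts_seq, halts_load, halts_ifLt, halts_const, halts_copy, halts_incr,
    Store.reg_setReg, Store.arr_setReg]
  simp only [Nat.reduceEqDiff, if_true, if_false, h12]
  have hno : ∀ {τ : Store} {n : ℕ}, n ≤ 130 → σ.AgreesWith τ → τ.reg 18 = 0 →
      (∀ t k, ¬ PrimeShape (σ.arr 0) (σ.arr 1) (σ.arr 2) (σ.arr 8) (σ.arr 9) (σ.reg 14) t k) →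
      Q n τ := fun hn ha h18 hP => hQ _ _ ⟨by omega, ha, .inr ⟨h18, hP⟩⟩
  split_ifs with h1 h2 h3 h4
  -- At least three out-neighbors: the pair tests are passed over, and the empty predicate takes
  -- their place.
  · rw [skip, halts_const]
    refine Halts.mono (halts_orElse (P := fun _ _ => False) (K := fun _ => True)
      (P' := BranchShape (σ.arr 0) (σ.arr 1) (σ.arr 2) (σ.arr 8) (σ.arr 9) (σ.reg 14))
      (c := 20 * (σ.arr 1 (σ.reg 14) - σ.arr 0 (σ.reg 14)) + 20) ?_ ?_ trivial fun _ => ?_) ?_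
    · simpa [Store.reg_setReg] using h9
    · exact .inr ⟨by simp [Store.reg_setReg], by simp⟩
    · refine Halts.mono (testBranch_halts ?_ ?_ ?_ ?_ ?_ ?_ ?_ ?_) ?_
      iterate 8 simp [Store.reg_setReg, Store.arr_setReg, h9, h12, h1]
      rintro n τ ⟨hn, ha, hA⟩
      simp only [Store.reg_setReg, Store.arr_setReg, Nat.reduceEqDiff, if_false] at hn hA
      exact ⟨hn, ha, trivial, hA⟩
    · rintro n τ ⟨hn, ha, -, hA⟩
      refine hQ _ _ ⟨by omega, Store.AgreesWith.trans ?_ ha, hA.congr fun t k => ?_⟩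
      · repeat' first | exact .refl σ | refine Store.AgreesWith.setReg ?_ (by norm_num) (by norm_num)
      · rw [primeShape_iff_branchShape h2 (by omega), false_or]
  -- Two out-neighbors: either of them may be the middle vertex of an if or while graph, or both may
  -- be the branches of an if-then-else graph.
  · have hlh : σ.arr 0 (σ.reg 14) + 2 = σ.arr 1 (σ.reg 14) := by omega
    refine Halts.mono (testPair_halts (.inl ⟨rfl, rfl⟩) ?_ ?_ ?_ ?_) ?_
    iterate 4 simp [Store.reg_setReg, Store.arr_setReg, h9, h12]
    rintro n₁ τ₁ ⟨hn₁, ha₁, hz₁, hA₁⟩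
    replace ha₁ : σ.AgreesWith τ₁ := by
      refine Store.AgreesWith.trans ?_ ha₁
      repeat' first | exact .refl σ | refine Store.AgreesWith.setReg ?_ (by norm_num) (by norm_num)
    simp only [List.mem_cons, List.not_mem_nil, or_false, forall_eq_or_imp, forall_eq,
      Store.reg_setReg, Store.arr_setReg, Nat.reduceEqDiff, if_true, if_false] at hz₁ hA₁
    obtain ⟨z15, z16, z17, z21, z22, z24⟩ := hz₁
    have a9 := ha₁.reg 9 (.inl (by norm_num))
    have a12 := ha₁.reg 12 (.inl (by norm_num))
    have a14 := ha₁.reg 14 (.inl (by norm_num))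
    refine Halts.mono (halts_orElse (K := fun τ => τ.reg 15 = τ₁.reg 15 ∧ τ.reg 16 = τ₁.reg 16 ∧
      τ.reg 17 = τ₁.reg 17 ∧ τ.reg 21 = τ₁.reg 21) (by omega) hA₁ (by simp [Store.reg_setReg])
      (fun h18 => ?_) (c := 30)
      (P' := fun t k => k = 2 ∧ t = σ.arr 2 (σ.arr 0 (σ.reg 14)) ∧ PairShape (σ.arr 0) (σ.arr 1)
        (σ.arr 2) (σ.arr 8) (σ.arr 9) (σ.reg 14) (σ.arr 2 (σ.arr 0 (σ.reg 14) + 1)) t)) ?_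
    · refine Halts.mono (testPair_halts (.inr ⟨rfl, rfl⟩) (by omega) (by omega) h18 ?_) ?_
      · rw [z17, ha₁.arr, a14]
      · rintro n τ ⟨hn, ha, hz, hA⟩
        simp only [List.mem_cons, List.not_mem_nil, or_false, forall_eq_or_imp, forall_eq] at hz
        rw [ha₁.arr, z21, a14, z24] at hA
        exact ⟨hn, ha, ⟨hz.1, hz.2.1, hz.2.2.1, hz.2.2.2.1⟩, hA⟩
    · rintro n₂ τ₂ ⟨hn₂, ha₂, ⟨y15, y16, y17, y21⟩, hA₂⟩
      replace ha₂ := ha₁.trans ha₂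
      have b9 := ha₂.reg 9 (.inl (by norm_num))
      have b12 := ha₂.reg 12 (.inl (by norm_num))
      have b14 := ha₂.reg 14 (.inl (by norm_num))
      refine Halts.mono (halts_orElse (K := fun _ => True) (by omega) hA₂ trivial (fun h18 => ?_)
        (P' := BranchShape (σ.arr 0) (σ.arr 1) (σ.arr 2) (σ.arr 8) (σ.arr 9) (σ.reg 14))
        (c := 20 * (σ.arr 1 (σ.reg 14) - σ.arr 0 (σ.reg 14)) + 20)) ?_
      · refine Halts.mono (testBranch_halts (by omega) (by omega) h18 ?_ ?_ ?_ ?_ ?_) ?_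
        · rw [y15, z15, ha₂.arr, b14]
        · rw [y16, z16, ha₂.arr, b14]
        · rw [y17, z17, ha₂.arr, b14]
        · omega
        · rw [y21, z21, y15, z15, ha₂.arr]
        · rintro n τ ⟨hn, ha, hA⟩
          rw [ha₂.arr, b14] at hn hA
          exact ⟨hn, ha, trivial, hA⟩
      · rintro n₃ τ₃ ⟨hn₃, ha₃, -, hA₃⟩
        refine hQ _ _ ⟨by omega, ha₂.trans ha₃, hA₃.congr fun t k => ?_⟩
        rw [primeShape_iff_pairShape h2 hlh, or_assoc]
  · refine Halts.mono (testOne_halts ?_ ?_ ?_ ?_) ?_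
    iterate 4 simp [Store.reg_setReg, Store.arr_setReg, h9, h12]
    rintro n τ ⟨hn, ha, hA⟩
    simp only [Store.reg_setReg, Store.arr_setReg, Nat.reduceEqDiff, if_true, if_false] at hA
    refine hQ _ _ ⟨by omega, Store.AgreesWith.trans ?_ ha, hA.congr fun t k => ?_⟩
    · repeat' first | exact .refl σ | refine Store.AgreesWith.setReg ?_ (by norm_num) (by norm_num)
    · rw [primeShape_iff_oneShape h2 (by omega)]
  · rw [skip, halts_const]
    refine hno (by norm_num) ?_ (by simp [Store.reg_setReg]) fun t k h => ?_
    · repeat' first | exact .refl σ | refine Store.AgreesWith.setReg ?_ (by norm_num) (by norm_num)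
    · have := h.1
      omega
  · rw [skip, halts_const]
    refine hno (by norm_num) ?_ (by simp [Store.reg_setReg]) fun t k h => ?_
    · repeat' first | exact .refl σ | refine Store.AgreesWith.setReg ?_ (by norm_num) (by norm_num)
    · obtain ⟨-, ⟨h, -⟩ | ⟨h, -⟩ | ⟨d, hd, h, -⟩⟩ := h <;> omega

end DetectionCorrect

/-! ### The main loop -/

section MainLoop

open Prog

/-- A state of the main loop: `k` vertices are still to be treated, `K` is the current graph and
`tr` lists the sources of the primes that are already contracted. -/
structure LoopState (G : MarkedGraph ℕ) (s₀ : ℕ) (ord : List ℕ) (lo₀ hi₀ adj : ℕ → ℕ) (k : ℕ)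
    (K : MarkedGraph ℕ) (tr : List ℕ) (lo hi deg cyc : ℕ → ℕ) : Prop where
  nodup : ord.Nodup
  le : k ≤ ord.length
  ordered : K.Ordered s₀ fun x => ord.idxOf x
  represents : K.Represents s₀ lo hi adj deg cyc
  rest : ∀ x ∈ ord.take k, x ∈ K.verts ∧ lo x = lo₀ x ∧ hi x = hi₀ x
  run : ∀ tr' b, GreedyRun (ord.take k).reverse K tr' b → GreedyRun ord.reverse G (tr ++ tr') b

namespace LoopState

variable {G K : MarkedGraph ℕ} {s₀ : ℕ} {ord tr : List ℕ} {lo₀ hi₀ adj : ℕ → ℕ} {k : ℕ}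
  {lo hi deg cyc : ℕ → ℕ}

theorem take_succ (h : k < ord.length) : ord.take (k + 1) = ord.take k ++ [ord[k]] := by
  rw [List.take_succ_eq_append_getElem h]

theorem current (hL : LoopState G s₀ ord lo₀ hi₀ adj (k + 1) K tr lo hi deg cyc)
    (h : k < ord.length) : ord[k] ∈ K.verts ∧ lo ord[k] = lo₀ ord[k] ∧ hi ord[k] = hi₀ ord[k] :=
  hL.rest _ (by rw [take_succ h]; exact List.mem_append_right _ (List.mem_singleton_self _))

/-- The machine does not stop at a single vertex but goes through the remaining ones. This does no
harm: a single vertex has no prime, and the run of the algorithm ends there with the same trace and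
answer. -/
theorem skip (hL : LoopState G s₀ ord lo₀ hi₀ adj (k + 1) K tr lo hi deg cyc)
    (h : k < ord.length) (hno : ∀ t j, ¬ PrimeShape lo hi adj deg cyc ord[k] t j) :
    LoopState G s₀ ord lo₀ hi₀ adj k K tr lo hi deg cyc := by
  refine ⟨hL.nodup, h.le, hL.ordered, hL.represents, fun x hx => hL.rest x ?_, fun tr' b hr => ?_⟩
  · rw [take_succ h]
    exact List.mem_append_left _ hx
  · refine hL.run tr' b ?_
    rw [take_succ h, List.reverse_append]
    by_cases hc : K.verts.card = 1
    · generalize (ord.take k).reverse = vs at hr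
      cases hr with
      | yes _ _ _ => exact .yes _ _ hc
      | no _ hn => exact absurd hc hn
      | contract _ _ _ _ _ _ _ hn => exact absurd hc hn
      | skip _ _ _ _ _ hn => exact absurd hc hn
    · refine .skip _ _ _ _ _ hc ?_ hr
      rintro ⟨H, t, hp⟩
      obtain ⟨j, hj⟩ := hp.primeShape hL.represents hL.ordered
      exact hno t j hj

/-- All vertices of a prime come at or after its source. So the vertices still to be treated survive
the contraction, and only the segment of the vertex just treated has changed. -/
theorem contract (hL : LoopState G s₀ ord lo₀ hi₀ adj (k + 1) K tr lo hi deg cyc)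
    (h : k < ord.length) {t j : ℕ} (hs : PrimeShape lo hi adj deg cyc ord[k] t j) :
    ∃ K', LoopState G s₀ ord lo₀ hi₀ adj k K' (tr ++ [ord[k]])
        (Function.update lo ord[k] (lo t)) (Function.update hi ord[k] (hi t))
        (Function.update deg ord[k] (deg ord[k] - cyc ord[k])) (Function.update cyc ord[k] 0) ∧
      cyc ord[k] < 2 ∧ K'.verts.card = K.verts.card - j := by
  obtain ⟨H, hp, hcard⟩ := hL.represents.isPrime_of_primeShape hL.ordered (hL.current h).1 hs
  have hc := hp.card_contract
  refine ⟨K.contract H ord[k], ⟨hL.nodup, h.le, hp.ordered_contract hL.ordered,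
    hL.represents.contract hL.ordered hp, fun x hx => ?_, fun tr' b hr => ?_⟩, hs.1, by omega⟩
  · obtain ⟨h1, h2, h3⟩ := hL.rest x (by rw [take_succ h]; exact List.mem_append_left _ hx)
    obtain ⟨i, hi', rfl⟩ := List.mem_take_iff_getElem.1 hx
    have hik : i < k := by omega
    have hne : ord[i] ≠ ord[k] := fun e => by
      have := (hL.nodup.getElem_inj_iff).1 e
      omega
    rw [Function.update_of_ne hne, Function.update_of_ne hne]
    refine ⟨hp.mem_contract_verts.2 ⟨h1, fun hx => ?_⟩, h2, h3⟩
    have := hp.pos_le hL.ordered hx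
    rw [hL.nodup.idxOf_getElem, hL.nodup.idxOf_getElem] at this
    omega
  · rw [List.append_assoc]
    refine hL.run _ b ?_
    rw [take_succ h, List.reverse_append]
    exact .contract _ t _ _ H _ _ hp.one_lt_card.ne' hp hr

/-- The graph always contains `s₀`, so fewer than two vertices means exactly one. -/
theorem finish (hL : LoopState G s₀ ord lo₀ hi₀ adj 0 K tr lo hi deg cyc) :
    GreedyRun ord.reverse G tr (decide (K.verts.card < 2)) := by
  have hpos := Finset.card_pos.2 ⟨s₀, hL.ordered.src⟩
  have := hL.run [] (decide (K.verts.card < 2)) ?_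
  · simpa using this
  · by_cases hc : K.verts.card = 1
    · rw [hc]
      exact .yes _ _ hc
    · rw [decide_eq_false (by omega)]
      exact .no _ hc

end LoopState

/-- Contracts the prime that has been found. -/
def contractPrime : Prog :=
  .seq (load 17 9 14) <| .seq (load 21 0 19) <| .seq (store 0 14 21) <| .seq (load 21 1 19) <| .seq (store 1 14 21) <|
    .seq (load 22 8 14) <| .seq (.ifLt 9 17 (decr 22) skip) <| .seq (store 8 14 22) <|
      .seq (store 9 14 9) <| .seq (store 4 34 14) <| .seq (incr 34) <| copy 35 20

/-- Treats the vertices of the topological sorting from the last to the first. -/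
def mainLoop : Prog :=
  .whileLt 9 33 <|
    .seq (decr 33) <| .seq (load 14 3 33) <| .seq findPrime <| .ifLt 9 18 contractPrime skip

/-- The invariant of the main loop, with the number of remaining vertices in register 33. -/
structure LoopInvariant (G : MarkedGraph ℕ) (s₀ : ℕ) (ord : List ℕ) (lo₀ hi₀ adj : ℕ → ℕ)
    (K : MarkedGraph ℕ) (tr : List ℕ) (σ : Store) : Prop where
  state : LoopState G s₀ ord lo₀ hi₀ adj (σ.reg 33) K tr (σ.arr 0) (σ.arr 1) (σ.arr 8) (σ.arr 9)
  adj_eq : σ.arr 2 = adj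
  zero_eq : σ.reg 9 = 0
  two_eq : σ.reg 12 = 2
  ord_eq : σ.ArrayHolds 3 ord
  trace_eq : σ.ArrayHolds 4 tr
  length_eq : σ.reg 34 = tr.length
  card_eq : σ.reg 35 = K.verts.card

/-- The costs of treating the first `k` vertices of `ord`. -/
def loopCost (ord : List ℕ) (lo hi : ℕ → ℕ) (k : ℕ) : ℕ :=
  160 * k + 20 * ((ord.take k).map fun x => hi x - lo x).sum

theorem loopCost_succ {ord : List ℕ} {lo hi : ℕ → ℕ} {k : ℕ} (h : k < ord.length) :
    loopCost ord lo hi (k + 1) = loopCost ord lo hi k + 160 + 20 * (hi ord[k] - lo ord[k]) := by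
  simp only [loopCost, LoopState.take_succ h, List.map_append, List.sum_append, List.map_cons,
    List.map_nil, List.sum_cons, List.sum_nil]
  omega

theorem Store.ArrayHolds.append {σ : Store} {a : ℕ} {l : List ℕ} (h : σ.ArrayHolds a l)
    {f : ℕ → ℕ} {v : ℕ} (hf : f = Function.update (σ.arr a) l.length v) {σ' : Store}
    (h' : σ'.arr a = f) : σ'.ArrayHolds a (l ++ [v]) := by
  intro i hi
  rw [h', hf]
  by_cases hil : i < l.length
  · rw [Function.update_of_ne hil.ne, h i hil, List.getElem_append_left hil]
  · have : i = l.length := by simp at hi; omega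
    subst this
    simp

/-- The potential is `loopCost` of the vertices still to be treated: a constant for each and a
multiple of its original outdegree. -/
theorem mainLoop_halts {G : MarkedGraph ℕ} {s₀ : ℕ} {ord : List ℕ} {lo₀ hi₀ adj : ℕ → ℕ}
    {K : MarkedGraph ℕ} {tr : List ℕ} {σ : Store}
    (h : LoopInvariant G s₀ ord lo₀ hi₀ adj K tr σ) :
    mainLoop.Halts σ fun n σ' => n ≤ loopCost ord lo₀ hi₀ (σ.reg 33) + 1 ∧
      ∃ K tr, LoopInvariant G s₀ ord lo₀ hi₀ adj K tr σ' ∧ σ'.reg 33 = 0 := by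
  refine Halts.mono (halts_whileLt (fun φ τ => φ = loopCost ord lo₀ hi₀ (τ.reg 33) ∧
    ∃ K tr, LoopInvariant G s₀ ord lo₀ hi₀ adj K tr τ) ?_ ⟨rfl, K, tr, h⟩) ?_
  · rintro φ τ ⟨rfl, K, tr, hI⟩ hlt
    rw [hI.zero_eq] at hlt
    obtain ⟨k, hk⟩ : ∃ k, τ.reg 33 = k + 1 := ⟨τ.reg 33 - 1, by omega⟩
    have hL := hI.state
    rw [hk] at hL
    have hkl : k < ord.length := hL.le
    have hord := hI.ord_eq k hkl
    have hcur := hL.current hkl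
    rw [hk, loopCost_succ hkl]
    simp only [halts_seq, halts_decr, halts_load, Store.reg_setReg, Store.arr_setReg, hk, hord, if_true,
       Nat.add_sub_cancel]
    generalize hv : ord[k] = v at *
    refine Halts.mono (findPrime_halts (by simpa [Store.reg_setReg] using hI.zero_eq)
      (by simpa [Store.reg_setReg] using hI.two_eq)) ?_
    rintro n ρ ⟨hn, ha, hA⟩
    simp only [Store.reg_setReg, Store.arr_setReg, if_true] at hn hA
    have r9 := ha.reg 9 (.inl (by norm_num))
    have r12 := ha.reg 12 (.inl (by norm_num))
    have r14 := ha.reg 14 (.inl (by norm_num))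
    have r33 := ha.reg 33 (.inr (by norm_num))
    have r34 := ha.reg 34 (.inr (by norm_num))
    have r35 := ha.reg 35 (.inr (by norm_num))
    have harr := ha.arr
    simp only [Store.reg_setReg, Store.arr_setReg, Nat.reduceEqDiff, if_true, if_false]
      at r9 r12 r14 r33 r34 r35 harr
    -- The segment of a vertex not yet treated is still the original one, so the search is charged
    -- to the original outdegree.
    rw [hcur.2.1, hcur.2.2] at hn
    rw [halts_ifLt, r9, hI.zero_eq]
    rcases hA with ⟨h18, j, hs, h20⟩ | ⟨h18, hno⟩
    · obtain ⟨K', hL', hc2, hcard⟩ := hL.contract hkl (t := ρ.reg 19) (j := j)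
        (by rwa [hv, ← hI.adj_eq])
      simp only [hv] at hL' hc2
      rw [h18, if_pos one_pos]
      refine Halts.intro fun Q hQ => ?_
      simp only [contractPrime, Prog.skip, halts_seq, halts_load, halts_store, halts_ifLt,
        halts_decr, halts_incr, halts_copy, halts_const, Store.reg_setReg, Store.arr_setReg,
        Store.reg_setArr, Store.arr_setArr]
      simp only [Nat.reduceEqDiff, if_true, if_false, r9, r14, r34, harr, hI.zero_eq,
        one_ne_zero, OfNat.ofNat_ne_zero, OfNat.ofNat_ne_one]
      -- A prime has at most one cycle edge into its source, so the program subtracts `cyc v` by at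
      -- most one decrement.
      have hd : τ.arr 8 v - τ.arr 9 v = if 0 < τ.arr 9 v then τ.arr 8 v - 1 else τ.arr 8 v := by
        split_ifs <;> omega
      split_ifs at hd ⊢ with hc
      all_goals
        refine hQ _ _ ⟨loopCost ord lo₀ hi₀ k, ⟨?_, K', tr ++ [v],
          ⟨?_, ?_, ?_, ?_, ?_, ?_, ?_, ?_⟩⟩, by omega⟩
        · simp [Store.reg_setReg, Store.reg_setArr, r33]
        · convert hL' using 1
          · simp [Store.reg_setReg, Store.reg_setArr, r33]
          all_goals simp [Store.arr_setReg, Store.arr_setArr, harr, hd]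
        · simp [Store.arr_setReg, Store.arr_setArr, harr, hI.adj_eq]
        · simp [Store.reg_setReg, Store.reg_setArr, r9, hI.zero_eq]
        · simp [Store.reg_setReg, Store.reg_setArr, r12, hI.two_eq]
        · simpa [Store.ArrayHolds, Store.arr_setReg, Store.arr_setArr, harr] using hI.ord_eq
        · refine hI.trace_eq.append rfl ?_
          simp [Store.arr_setReg, Store.arr_setArr, harr, hI.length_eq]
        · simp [Store.reg_setReg, hI.length_eq]
        · simp [Store.reg_setReg, h20, r35, hI.card_eq, hcard]
    · rw [h18, if_neg (lt_irrefl 0), Prog.skip, halts_const]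
      refine ⟨loopCost ord lo₀ hi₀ k, ⟨?_, K, tr, ⟨?_, ?_, ?_, ?_, ?_, ?_, ?_, ?_⟩⟩, by omega⟩
      · simp [Store.reg_setReg, r33]
      · simp only [Store.reg_setReg, Store.arr_setReg, r33, harr]
        exact hL.skip hkl (by rwa [hv, ← hI.adj_eq])
      · rw [Store.arr_setReg, harr, hI.adj_eq]
      · simp [Store.reg_setReg, r9, hI.zero_eq]
      · simp [Store.reg_setReg, r12, hI.two_eq]
      · simpa [Store.ArrayHolds, Store.arr_setReg, harr] using hI.ord_eq
      · simpa [Store.ArrayHolds, Store.arr_setReg, harr] using hI.trace_eq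
      · simp [Store.reg_setReg, r34, hI.length_eq]
      · simp [Store.reg_setReg, r35, hI.card_eq]
  · rintro n τ ⟨φ, ⟨rfl, K, tr, hI⟩, hge, hn⟩
    have := hI.zero_eq
    exact ⟨by omega, K, tr, hI, by omega⟩

end MainLoop

/-! ### The linear-time implementation -/

section Implementation

open Prog

/-- The number of entries in the adjacency lists is the number of edges. -/
theorem FinDigraph.Adjacency.sum_eq {G : FinDigraph ℕ} {lo hi adj : ℕ → ℕ}
    (h : G.Adjacency lo hi adj) {ord : List ℕ} (hn : ord.Nodup) (hv : ord.toFinset = G.verts) :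
    (ord.map fun x => hi x - lo x).sum = G.edges.card := by
  rw [← List.sum_toFinset _ hn, hv,
    Finset.card_eq_sum_card_fiberwise (f := Prod.fst) (t := G.verts) (fun e he => G.fst_mem he)]
  refine Finset.sum_congr rfl fun x hx => ?_
  have : (G.edges.filter fun e => e.1 = x) =
      (Finset.Ico (lo x) (hi x)).image fun i => (x, adj i) := by
    ext ⟨p, q⟩
    simp only [Finset.mem_filter, Finset.mem_image, Finset.mem_Ico, Prod.mk.injEq]
    constructor
    · rintro ⟨h1, rfl⟩
      obtain ⟨i, h2, h3, h4⟩ := (h.iff p hx q).1 h1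
      exact ⟨i, ⟨h2, h3⟩, rfl, h4⟩
    · rintro ⟨i, ⟨h2, h3⟩, rfl, h4⟩
      exact ⟨(h.iff x hx q).2 ⟨i, h2, h3, h4⟩, rfl⟩
  rw [this, Finset.card_image_of_injOn, Nat.card_Ico]
  intro i hi' j hj e
  simp only [Finset.coe_Ico, Set.mem_Ico] at hi' hj
  exact h.inj x hx i j hi'.1 hi'.2 hj.1 hj.2 (Prod.mk.inj e).2

/-- The recognition algorithm. -/
def recognize : Prog :=
  .seq searchProgram <| .ifLt 9 13 (.seq (const 0 0) (const 1 0)) <|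
    .seq (copy 33 0) <| .seq (const 34 0) <| .seq (copy 35 0) <| .seq mainLoop <|
      .seq (copy 1 34) <| .ifLt 35 12 (const 0 1) (const 0 0)

/-- At the end of the search all vertices are finished, so no cell is free and array 3 holds the
topological sorting from index 0 on. All edges are scanned, so the counters are the true degrees. -/
theorem Searching.loopInvariant {G : FlowGraph ℕ} {lo hi adj : ℕ → ℕ} {fin : List ℕ}
    {vis : Finset ℕ} {C X : Finset (ℕ × ℕ)} {σ σ' : Store} (hA : G.Adjacency lo hi adj)
    (hS : Searching G lo hi adj [] fin vis C X σ) (harr : σ'.arr = σ.arr)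
    (h9 : σ'.reg 9 = σ.reg 9) (h12 : σ'.reg 12 = σ.reg 12) (h33 : σ'.reg 33 = σ.reg 0)
    (h34 : σ'.reg 34 = 0) (h35 : σ'.reg 35 = σ.reg 0) :
    LoopInvariant ⟨G.toFinDigraph, C⟩ G.source fin lo hi adj ⟨G.toFinDigraph, C⟩ [] σ' := by
  obtain ⟨hF, -, hS⟩ := hS
  obtain ⟨hC, hT, -⟩ := hS.trace.final
  have hO := hC.ordered hT
  have hX := hS.scanned_eq hA
  have hlen : fin.length = G.verts.card := by
    rw [← hT.2.1, List.toFinset_card_of_nodup hT.1]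
  have hfree := hS.free_add
  have htake : fin.take (σ'.reg 33) = fin :=
    List.take_of_length_le (by rw [h33, hF.card_eq, hlen])
  refine ⟨⟨hT.1, by rw [h33, hF.card_eq, hlen], hO, ⟨?_, ?_, ?_⟩, ?_, ?_⟩, ?_, ?_, ?_, ?_, ?_, ?_,
    ?_⟩
  · rw [harr, hF.lo_eq, hF.hi_eq]
    exact hA
  · intro x _
    rw [harr, hS.deg_eq x, hX]
  · intro x _
    rw [harr, hS.cyc_eq x, hX, Finset.inter_eq_right.2 hO.sub]
  · intro x hx
    rw [htake] at hx
    rw [harr, hF.lo_eq, hF.hi_eq]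
    exact ⟨by rw [← hT.2.1]; exact List.mem_toFinset.2 hx, rfl, rfl⟩
  · intro tr' b hr
    rwa [htake] at hr
  · rw [harr, hF.adj_eq]
  · rw [h9, hF.zero_eq]
  · rw [h12, hF.two_eq]
  · intro i hi
    rw [harr, ← hS.done_eq i hi, show σ.reg 10 + i = i by omega]
  · intro i hi
    simp at hi
  · rw [h34]; rfl
  · rw [h35, hF.card_eq]

/-- The search takes at most `79n + 12` steps. As it did not give up, `m < 2n`, and the main loop
costs at most `160n + 20 · 2n` steps and a final test. The few remaining steps are absorbed in
`300n` because `n ≥ 1`. -/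
theorem recognize_halts {G : FlowGraph ℕ} {n : ℕ} {σ : Store} (h : EncodesGraph G n σ) :
    recognize.Halts σ fun t σ' => t ≤ 300 * n ∧ ∃ ord tr b, RecognitionRun G ord tr b ∧
      σ'.reg 0 = (if b = true then 1 else 0) ∧ σ'.ArrayHolds 3 ord ∧
      σ'.reg 1 = tr.length ∧ σ'.ArrayHolds 4 tr := by
  have hn : 0 < n := by
    rw [← h.card_eq]
    exact Finset.card_pos.2 ⟨_, G.source_mem⟩
  rw [recognize, halts_seq]
  refine (searchProgram_halts h).mono ?_
  rintro t₁ σ₁ ⟨ht₁, ⟨h9, h13, -, hm⟩ | ⟨fin, vis, C, X, hS⟩⟩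
  · rw [halts_ifLt, h9, h13, if_pos one_pos]
    simp only [halts_seq, halts_const]
    refine ⟨by omega, [], [], false, .tooManyEdges hm, ?_, ?_, ?_, ?_⟩
    · simp [Store.reg_setReg]
    · intro i hi; simp at hi
    · simp [Store.reg_setReg]
    · intro i hi; simp at hi
  · have hF := hS.1
    have hT := hS.2.2.trace.final.2.1
    rw [halts_ifLt, hF.zero_eq, hS.2.1, if_neg (lt_irrefl 0)]
    simp only [halts_seq, halts_copy, halts_const, Store.reg_setReg, Nat.reduceEqDiff, if_false]
    refine (mainLoop_halts (hS.loopInvariant h.adjacency ?_ ?_ ?_ ?_ ?_ ?_)).mono ?_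
    · rfl
    iterate 5 simp [Store.reg_setReg]
    rintro t₂ σ₂ ⟨ht₂, K, tr, hI, h33⟩
    have hrun := (h33 ▸ hI.state).finish
    have hb := hS.2.2.budget_add
    have hb' := hS.2.2.budget_pos
    rw [hS.2.2.scanned_eq h.adjacency] at hb
    have hcost : loopCost fin (σ.arr 0) (σ.arr 1) (G.verts.card) ≤ 160 * n + 20 * (2 * n) := by
      rw [loopCost, List.take_of_length_le, h.adjacency.sum_eq hT.1 hT.2.1]
      · have := h.card_eq
        omega
      · rw [← hT.2.1, List.toFinset_card_of_nodup hT.1]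
    simp only [Store.reg_setReg, Nat.reduceEqDiff, if_true, if_false, hF.card_eq] at ht₂
    have hR : RecognitionRun G fin tr (decide (K.verts.card < 2)) :=
      .greedy C fin tr _ (by omega) ⟨vis, hS.2.2.trace.reflTransGen⟩ hT hrun
    refine Halts.intro fun Q hQ => ?_
    rw [halts_ifLt]
    simp only [halts_const, Store.reg_setReg, Nat.reduceEqDiff, if_false, hI.card_eq, hI.two_eq]
    split_ifs with hc
    all_goals
      refine hQ _ _ ⟨by omega, fin, tr, _, hR, ?_, hI.ord_eq, ?_, hI.trace_eq⟩
      · simp [Store.reg_setReg, hc]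
      · simp [Store.reg_setReg, hI.length_eq]

end Implementation
/-- Correctness of the recognition algorithm on every flow graph, for every depth-first search and
every topological sorting, and an implementation that carries out the algorithm in `O(n)` steps:
register 0 receives the answer, array 3 the topological sorting, register 1 the number of
contractions and array 4 the sources of the contracted primes. -/
theorem mainTheorem2 :
    (∀ (V : Type*) [DecidableEq V] (G : FlowGraph V),
      (∃ C, G.IsDFSCycleEdges C) ∧
      (∀ C, G.IsDFSCycleEdges C → ∃ ord, G.IsTopSort C ord) ∧
      (∀ C ord, G.IsDFSCycleEdges C → G.IsTopSort C ord →
        ∃ tr b, GreedyRun ord.reverse ⟨G.toFinDigraph, C⟩ tr b) ∧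
      (∀ ord tr b, RecognitionRun G ord tr b → (b = true ↔ G.IsDijkstra)) ∧
      (¬ G.Reducible → ∀ ord tr b, RecognitionRun G ord tr b → b = false)) ∧
    (∃ (P : Prog) (c : ℕ), ∀ (G : FlowGraph ℕ) (n : ℕ) (σ : Store), EncodesGraph G n σ →
      ∃ (t : ℕ) (σ' : Store) (ord tr : List ℕ) (b : Bool),
        Exec P σ t σ' ∧ t ≤ c * n ∧ RecognitionRun G ord tr b ∧
        σ'.reg 0 = (if b = true then 1 else 0) ∧ σ'.ArrayHolds 3 ord ∧
        σ'.reg 1 = tr.length ∧ σ'.ArrayHolds 4 tr) := by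
  refine ⟨fun V _ G => recognition_correct G, recognize, 300, fun G n σ h => ?_⟩
  obtain ⟨t, σ', h1, h2, ord, tr, b, h3⟩ := recognize_halts h
  exact ⟨t, σ', ord, tr, b, h1, h2, h3⟩
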